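/- Let $n\ge 1$ and let $(M,g_0)$ be a closed (i.e. compact, without boundary), connected, smooth Riemannian manifold of dimension $n$. For a continuous function $f\colon M\to\mathbb R$ let $g_f=e^{2f}g_0$, and let $d_f$ and $\mu_f$ be the Riemannian distance (infimum of the $g_f$-lengths of $C^1$ curves) and the Riemannian volume measure of $g_f$, so that $d\mu_f=e^{nf}\,d\mu_0$; $d_0$ and $\mu_0$ are those of $g_0$. Then for every $\mathbf I\ge 0$ and every $\alpha\in(0,1)$ there is a constant $C=C(g_0,\mathbf I,\alpha)>0$ with the following property: for every continuous function $f\colon M\to\mathbb R$ that has a weak differential $df$ with $$\|df\|_{L^n(M,g_0)}=\Big(\int_M |df|_{g_0}^n\,d\mu_0\Big)^{1/n}\le \mathbf I ,$$ one has, for all $x,y\in M$, $$\frac{\mu_f(M)^{\frac1n}}{C}\,d_0(x,y)^{\frac1\alpha}\;\le\; d_f(x,y)\;\le\; C\,\mu_f(M)^{\frac1n}\,d_0(x,y)^{\alpha}.$$ -/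

import Mathlib

open Bundle Set MeasureTheory Manifold
open scoped ENNReal NNReal ContDiff Topology

noncomputable section

namespace ConformalDeformation

variable {n : ℕ} {M : Type*} [TopologicalSpace M]
  [ChartedSpace (EuclideanSpace ℝ (Fin n)) M]

/-- A (pointwise) Riemannian metric on the `n`-manifold `M`: an inner product on every tangent
space. Regularity in the base point is imposed separately where it is needed. -/
abbrev RMetric (n : ℕ) (M : Type*) [TopologicalSpace M]
    [ChartedSpace (EuclideanSpace ℝ (Fin n)) M] :=
  RiemannianMetric (fun x : M ↦ TangentSpace (𝓡 n) x)

/-- The conformal deformation `e^{2f} g` of the metric `g`. -/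
def conformal (g : RMetric n M) (f : M → ℝ) : RMetric n M where
  inner x := Real.exp (2 * f x) • g.inner x
  symm x v w := by simp [g.symm x v w]
  pos x v hv := by
    simpa using mul_pos (Real.exp_pos (2 * f x)) (g.pos x v hv)
  continuousAt x := by
    exact (g.continuousAt x).const_smul (Real.exp (2 * f x))
  isVonNBounded x := by
    have hb := (g.isVonNBounded x).image
      ((Real.exp (-f x)) • ContinuousLinearMap.id ℝ (TangentSpace (𝓡 n) x))
    refine hb.subset ?_
    intro v hv
    refine ⟨Real.exp (f x) • v, ?_, ?_⟩
    · have h2 : Real.exp (2 * f x) = Real.exp (f x) * Real.exp (f x) := by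
        rw [← Real.exp_add]; ring_nf
      simp only [mem_ofPred_eq] at hv ⊢
      simpa [h2, mul_assoc] using hv
    · simp [smul_smul, ← Real.exp_add]

/-- The Riemannian (extended) distance of `g`: the infimum of the `g`-lengths of the `C^1` paths
from `x` to `y`. -/
def rdist (g : RMetric n M) (x y : M) : ℝ≥0∞ :=
  letI : RiemannianBundle (fun x : M ↦ TangentSpace (𝓡 n) x) := ⟨g⟩
  riemannianEDist (𝓡 n) x y

/-- The coordinate vector field `∂/∂v` of the chart at `c`, at the point with coordinates `u`. -/
def coordVec (c : M) (v u : EuclideanSpace ℝ (Fin n)) :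
    TangentSpace (𝓡 n) ((extChartAt (𝓡 n) c).symm u) :=
  mfderiv (𝓡 n) (𝓡 n) (extChartAt (𝓡 n) c).symm u v

/-- The matrix `(g_ij)` of `g` in the chart at `c`, at the point with coordinates `u`. -/
def gramMatrix (g : RMetric n M) (c : M) (u : EuclideanSpace ℝ (Fin n)) :
    Matrix (Fin n) (Fin n) ℝ :=
  Matrix.of fun i j ↦ g.inner ((extChartAt (𝓡 n) c).symm u)
    (coordVec c (EuclideanSpace.single i 1) u) (coordVec c (EuclideanSpace.single j 1) u)

/-- The Riemannian volume of `g` restricted to the domain of the chart at `c`, i.e. the image under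
the inverse chart of the measure `√(det g_ij) du` on the range of the chart. -/
def chartVolume [MeasurableSpace M] (g : RMetric n M) (c : M) : Measure M :=
  ((volume.restrict (extChartAt (𝓡 n) c).target).withDensity
    fun u ↦ ENNReal.ofReal (Real.sqrt (gramMatrix g c u).det)).map (extChartAt (𝓡 n) c).symm

/-- The Riemannian volume measure of `g`. By the change of variables formula the measures
`chartVolume g c` agree on overlaps of chart domains; their supremum in the lattice of measures is
the measure on `M` obtained by glueing them. -/
def rvolume [MeasurableSpace M] (g : RMetric n M) : Measure M :=
  ⨆ c : M, chartVolume g c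

/-- The covector field `df` is the weak (distributional) differential of the function `f`:
in every chart of the manifold `f` and the components of `df` are locally integrable, and the
integration by parts formula against smooth compactly supported functions holds. -/
structure IsWeakDifferential (f : M → ℝ) (df : ∀ x : M, TangentSpace (𝓡 n) x →L[ℝ] ℝ) :
    Prop where
  locallyIntegrable (c : M) : LocallyIntegrableOn (fun u ↦ f ((extChartAt (𝓡 n) c).symm u))
    (extChartAt (𝓡 n) c).target volume
  locallyIntegrable_diff (c : M) (v : EuclideanSpace ℝ (Fin n)) : LocallyIntegrableOn
    (fun u ↦ df ((extChartAt (𝓡 n) c).symm u) (coordVec c v u))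
    (extChartAt (𝓡 n) c).target volume
  integral_eq (c : M) (v : EuclideanSpace ℝ (Fin n)) (ψ : EuclideanSpace ℝ (Fin n) → ℝ)
    (hψ : ContDiff ℝ ∞ ψ) (hc : HasCompactSupport ψ)
    (hs : tsupport ψ ⊆ (extChartAt (𝓡 n) c).target) :
    ∫ u, f ((extChartAt (𝓡 n) c).symm u) * fderiv ℝ ψ u v =
      - ∫ u, df ((extChartAt (𝓡 n) c).symm u) (coordVec c v u) * ψ u

/-- The norm of the covector `θ` at `x` with respect to `g`. -/
def covectorNorm (g : RMetric n M) (x : M) (θ : TangentSpace (𝓡 n) x →L[ℝ] ℝ) : ℝ :=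
  letI : RiemannianBundle (fun x : M ↦ TangentSpace (𝓡 n) x) := ⟨g⟩
  ‖θ‖

/-- The `L^p` norm of a covector field with respect to `g` and its Riemannian volume. -/
def covectorLpNorm [MeasurableSpace M] (g : RMetric n M) (p : ℝ≥0∞)
    (θ : ∀ x : M, TangentSpace (𝓡 n) x →L[ℝ] ℝ) : ℝ≥0∞ :=
  eLpNorm (fun x ↦ covectorNorm g x (θ x)) p (rvolume g)

end ConformalDeformation

end

open ConformalDeformation

open Bundle Set MeasureTheory Manifold
open scoped ENNReal NNReal ContDiff Topology

noncomputable section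

namespace ConformalDeformation

open Metric

/-! ### Euclidean potential estimates: oscillation bounded by a threshold term plus a weighted
energy -/

section Potential

variable {n : ℕ}

/-! Everything rests on one Euclidean estimate, `HasWeakGradientOn.abs_integral_sub_average_le`. Let
`F` be continuous with gradient bounded in `L^n` on a ball, and let `σ` be a probability measure
with `σ (B(w,s)) ≤ K s` for all `w` and `s`. Then the `σ`-mean of `F` differs from its Lebesgue mean
by at most `ε log K + A`, where `ε` is arbitrarily small and `A` depends on `ε` and the energy but
not on `K`. The gradient along segments is cut at a threshold `η t^(θ-1)`. The part below is
integrated explicitly, the part above is absorbed into its `n`-th power, and `θ` of order `1 / (1 +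
log K)` balances the two.

Three choices of `σ` give the consequences. Normalised volume on a superlevel set gives exponential
decay of the level sets at any prescribed rate, hence a bound for the integral of `exp (p (F -
mean))` for every `p` (`HasWeakGradientOn.lintegral_exp_le`). Radially parametrised points of a
curve leaving a coordinate ball of radius `ρ` have `K` of order `1/ρ`. Jensen's inequality then
shows that the curve has conformal length at least a constant times `ρ^(1+ε) exp (mean)`
(`IsGoodChart.exists_le_rdist_conformal`). Normalised volume on a small ball inside two charts shows
that the means of `f` in the two charts differ by a bounded amount
(`IsGoodChart.exists_abs_chartMean_sub_le`).

For the upper bound, two nearby points are joined through a third point `w`. Averaging over `w` in a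
ball whose radius is their distance `r` and applying Hölder with exponent `n / (1 - α)` bounds the
length by a constant times `r^α exp (mean)` (`IsGoodChart.exists_rdist_conformal_le`). The volume to
the power `1/n` is also comparable to `exp (mean)`, by Jensen from below and by exponential
integrability from above (`exists_rvolume_conformal_bounds`). Compactness and connectedness reduce
all charts to a single one, and eliminating `exp (mean)` between the volume and distance bounds
gives the theorem. -/

lemma lintegral_comp_homothety (z : EuclideanSpace ℝ (Fin n)) {t : ℝ} (ht : 0 < t)
    (H : EuclideanSpace ℝ (Fin n) → ℝ≥0∞) :
    ∫⁻ y, H (z + t • (y - z)) = ENNReal.ofReal ((t ^ n)⁻¹) * ∫⁻ w, H w := by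
  have h1 : ∫⁻ y, H (z + t • (y - z)) = ∫⁻ y, H (z + t • y) :=
    lintegral_sub_right_eq_self (μ := volume) (fun y ↦ H (z + t • y)) z
  have h2 : ∫⁻ y, H (z + t • y) = ∫⁻ w, H (z + w) ∂(Measure.map (t • ·) volume) :=
    ((Homeomorph.smulOfNeZero t ht.ne').toMeasurableEquiv.measurableEmbedding.lintegral_map
      (fun w ↦ H (z + w))).symm
  rw [h1, h2, Measure.map_addHaar_smul volume ht.ne', lintegral_smul_measure,
    lintegral_add_left_eq_self, finrank_euclideanSpace, Fintype.card_fin,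
    abs_of_pos (by positivity)]
  rfl

/-- With threshold `b = η t^(θ-1)`, either `a ≤ b` and the first summand suffices, or `a > b` and `a
≤ a^n / b^(n-1)`, which is the second. Here `a` will be the size of the gradient and `d` the length
of a segment. -/
lemma mul_le_add_of_threshold (hn : 1 ≤ n) {a d D t θ η : ℝ} (ha : 0 ≤ a) (hd : 0 ≤ d)
    (hD : d ≤ D) (ht : 0 < t) (hη : 0 < η) :
    a * d ≤ D * (η * t ^ (θ - 1)) +
      (η⁻¹) ^ (n - 1) * t ^ ((1 - θ) * ((n : ℝ) - 1)) * a ^ n * d := by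
  set b := η * t ^ (θ - 1) with hb
  have hbpos : 0 < b := by positivity
  have hD0 : 0 ≤ D := hd.trans hD
  rcases le_or_gt a b with h | h
  · have : a * d ≤ D * b := by
      rw [mul_comm]
      exact mul_le_mul hD h ha hD0
    have : 0 ≤ (η⁻¹) ^ (n - 1) * t ^ ((1 - θ) * ((n : ℝ) - 1)) * a ^ n * d := by positivity
    linarith
  · have hbn : (η⁻¹) ^ (n - 1) * t ^ ((1 - θ) * ((n : ℝ) - 1)) = (b⁻¹) ^ (n - 1) := by
      rw [hb, mul_inv, mul_pow, ← Real.rpow_neg ht.le, ← Real.rpow_natCast (t ^ _),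
        ← Real.rpow_mul ht.le, Nat.cast_sub hn]
      congr 2
      push_cast
      ring
    have key : a ≤ (b⁻¹) ^ (n - 1) * a ^ n := by
      obtain ⟨k, rfl⟩ : ∃ k, n = k + 1 := ⟨n - 1, by omega⟩
      rw [Nat.add_sub_cancel, pow_succ, ← mul_assoc, ← mul_pow]
      have : 1 ≤ b⁻¹ * a := by
        rw [inv_mul_eq_div, one_le_div hbpos]
        exact h.le
      exact le_mul_of_one_le_left ha (one_le_pow₀ this)
    rw [hbn]
    have h1 : a * d ≤ (b⁻¹) ^ (n - 1) * a ^ n * d := mul_le_mul_of_nonneg_right key hd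
    have : 0 ≤ D * b := by positivity
    linarith

lemma lintegral_Ioo_rpow_sub_one {θ : ℝ} (hθ : 0 < θ) :
    ∫⁻ t in Ioo (0 : ℝ) 1, ENNReal.ofReal (t ^ (θ - 1)) = ENNReal.ofReal θ⁻¹ := by
  have hi : IntervalIntegrable (fun t : ℝ ↦ t ^ (θ - 1)) volume 0 1 :=
    intervalIntegral.intervalIntegrable_rpow' (by linarith)
  rw [intervalIntegrable_iff_integrableOn_Ioo_of_le zero_le_one] at hi
  rw [← ofReal_integral_eq_lintegral_ofReal hi, ← integral_Ioc_eq_integral_Ioo,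
    ← intervalIntegral.integral_of_le zero_le_one, integral_rpow (Or.inl (by linarith))]
  · simp [hθ.ne']
  · filter_upwards [ae_restrict_mem measurableSet_Ioo] with t ht
    exact Real.rpow_nonneg ht.1.le _

lemma lintegral_Ici_rpow_le {s κ : ℝ} (hs : 0 < s) (hκ : 0 ≤ κ) :
    ∫⁻ t in Ici s, ENNReal.ofReal (t ^ (-2 - κ)) ≤ ENNReal.ofReal (s ^ (-1 - κ)) := by
  have hi : IntegrableOn (fun t : ℝ ↦ t ^ (-2 - κ)) (Ioi s) :=
    integrableOn_Ioi_rpow_of_lt (by linarith) hs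
  rw [restrict_Ioi_eq_restrict_Ici.symm, ← ofReal_integral_eq_lintegral_ofReal hi,
    integral_Ioi_rpow_of_lt (by linarith) hs]
  · apply ENNReal.ofReal_le_ofReal
    rw [show -2 - κ + 1 = -1 - κ by ring, show -1 - κ = -(1 + κ) by ring, neg_div_neg_eq]
    apply div_le_self (by positivity)
    linarith
  · filter_upwards [ae_restrict_mem measurableSet_Ioi] with t ht
    exact Real.rpow_nonneg (hs.le.trans (le_of_lt ht)) _

lemma enorm_sub_le_lintegral_fderiv {F : EuclideanSpace ℝ (Fin n) → ℝ} (hF : ContDiff ℝ 1 F)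
    (y z : EuclideanSpace ℝ (Fin n)) :
    ‖F y - F z‖ₑ ≤
      ∫⁻ t in Ioo (0 : ℝ) 1, ‖fderiv ℝ F (z + t • (y - z))‖ₑ * ‖y - z‖ₑ := by
  have hd : ∀ t : ℝ, HasDerivAt (fun t : ℝ ↦ F (z + t • (y - z)))
      (fderiv ℝ F (z + t • (y - z)) (y - z)) t := fun t ↦ by
    have h1 : HasDerivAt (fun t : ℝ ↦ z + t • (y - z)) (y - z) t := by
      simpa using ((hasDerivAt_id t).smul_const (y - z)).const_add z
    exact ((hF.differentiable one_ne_zero _).hasFDerivAt).comp_hasDerivAt t h1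
  have hc : Continuous fun t : ℝ ↦ fderiv ℝ F (z + t • (y - z)) (y - z) := by
    have := hF.continuous_fderiv one_ne_zero
    fun_prop
  have h2 : F y - F z = ∫ t in (0 : ℝ)..1, fderiv ℝ F (z + t • (y - z)) (y - z) := by
    rw [intervalIntegral.integral_eq_sub_of_hasDerivAt (fun t _ ↦ hd t)
      (hc.intervalIntegrable _ _)]
    simp
  rw [h2, intervalIntegral.integral_of_le zero_le_one, integral_Ioc_eq_integral_Ioo]
  refine (enorm_integral_le_lintegral_enorm _).trans (lintegral_mono fun t ↦ ?_)
  exact ContinuousLinearMap.le_opENorm _ _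

/-- A quantitative form of the estimate of the oscillation of a function by a Riesz potential of
its gradient: the part of the gradient below a threshold is integrated explicitly, the rest is
controlled by its `n`-th power. -/
lemma lintegral_enorm_sub_le (hn : 1 ≤ n) {F : EuclideanSpace ℝ (Fin n) → ℝ}
    (hF : ContDiff ℝ 1 F) {u z : EuclideanSpace ℝ (Fin n)} {R θ η : ℝ} (hR : 0 < R)
    (hz : z ∈ ball u R) (hθ : 0 < θ) (hη : 0 < η) :
    ∫⁻ y in ball u R, ‖F y - F z‖ₑ ≤
      volume (ball u R) * ENNReal.ofReal (2 * R * (η * θ⁻¹)) +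
      ENNReal.ofReal ((η⁻¹) ^ (n - 1) * (2 * R) ^ (1 + θ * ((n : ℝ) - 1))) *
        ∫⁻ w in ball u R,
          ‖fderiv ℝ F w‖ₑ ^ n * ENNReal.ofReal (‖w - z‖ ^ (-(θ * ((n : ℝ) - 1)))) := by
  have hn' : (0 : ℝ) ≤ (n : ℝ) - 1 := by
    have : (1 : ℝ) ≤ n := by exact_mod_cast hn
    linarith
  set κ := θ * ((n : ℝ) - 1) with hκ
  have hκ0 : 0 ≤ κ := by positivity
  have hfc : Continuous (fderiv ℝ F) := hF.continuous_fderiv one_ne_zero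
  set N : EuclideanSpace ℝ (Fin n) → ℝ≥0∞ := fun w ↦ ‖fderiv ℝ F w‖ₑ with hN
  have hNm : Measurable N := by
    have : Continuous N := by fun_prop
    exact this.measurable
  set c := (η⁻¹) ^ (n - 1) with hc
  have hc0 : 0 ≤ c := by positivity
  -- pointwise bound of the integrand
  have hpt : ∀ y ∈ ball u R, ∀ t ∈ Ioo (0 : ℝ) 1,
      N (z + t • (y - z)) * ‖y - z‖ₑ ≤ ENNReal.ofReal (2 * R * η) * ENNReal.ofReal (t ^ (θ - 1)) +
        ENNReal.ofReal (c * t ^ ((1 - θ) * ((n : ℝ) - 1))) *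
          (N (z + t • (y - z)) ^ n * ‖y - z‖ₑ) := by
    intro y hy t ht
    have hd : ‖y - z‖ ≤ 2 * R := by
      have := dist_triangle_right y z u
      rw [mem_ball] at hy hz
      rw [← dist_eq_norm]
      linarith
    have h := mul_le_add_of_threshold (θ := θ) hn (norm_nonneg (fderiv ℝ F (z + t • (y - z))))
      (norm_nonneg (y - z)) hd ht.1 hη
    have ht0 := ht.1
    simp only [hN, ← ofReal_norm]
    rw [← ENNReal.ofReal_pow (norm_nonneg _), ← ENNReal.ofReal_mul (norm_nonneg _),
      ← ENNReal.ofReal_mul (by positivity), ← ENNReal.ofReal_mul (by positivity),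
      ← ENNReal.ofReal_mul (by positivity), ← ENNReal.ofReal_add (by positivity) (by positivity)]
    apply ENNReal.ofReal_le_ofReal
    refine h.trans (le_of_eq ?_)
    ring
  have hm1 : Measurable (Function.uncurry fun (y : EuclideanSpace ℝ (Fin n)) (t : ℝ) ↦
      N (z + t • (y - z)) ^ n * ‖y - z‖ₑ) := by
    simp only [Function.uncurry_def]
    have : Measurable fun p : EuclideanSpace ℝ (Fin n) × ℝ ↦ z + p.2 • (p.1 - z) := by fun_prop
    exact ((hNm.comp this).pow_const n).mul (by fun_prop)
  set D : Set (EuclideanSpace ℝ (Fin n)) := ball u R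
  have hD : MeasurableSet D := measurableSet_ball
  -- substitution at a fixed time
  have hsub : ∀ t ∈ Ioo (0 : ℝ) 1,
      ∫⁻ y in D, N (z + t • (y - z)) ^ n * ‖y - z‖ₑ ≤
        ∫⁻ w in D, ENNReal.ofReal ((t ^ n)⁻¹ * t⁻¹) *
          (N w ^ n * ‖w - z‖ₑ * (Ici (‖w - z‖ / (2 * R))).indicator 1 t) := by
    intro t ht
    have ht0 := ht.1
    set H : EuclideanSpace ℝ (Fin n) → ℝ≥0∞ := fun w ↦ D.indicator (fun w ↦
      ENNReal.ofReal t⁻¹ * (N w ^ n * ‖w - z‖ₑ * (Ici (‖w - z‖ / (2 * R))).indicator 1 t)) w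
      with hH
    have h1 : ∀ y ∈ D, N (z + t • (y - z)) ^ n * ‖y - z‖ₑ ≤ H (z + t • (y - z)) := by
      intro y hy
      have hmem : z + t • (y - z) ∈ D := by
        have := (convex_ball u R).add_smul_sub_mem hz hy (t := t) ⟨ht.1.le, ht.2.le⟩
        exact this
      have hd : ‖y - z‖ ≤ 2 * R := by
        have := dist_triangle_right y z u
        have hy' := mem_ball.1 hy
        have hz' := mem_ball.1 hz
        rw [← dist_eq_norm]
        linarith
      -- The substituted point `w` satisfies `‖w - z‖ ≤ 2 R t`. Kept as an indicator, this bounds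
      -- `t` from below, without which the later integral of `t^(-2-κ)` would diverge at `0`.
      have hind : t ∈ Ici (‖z + t • (y - z) - z‖ / (2 * R)) := by
        rw [mem_Ici, add_sub_cancel_left, norm_smul, Real.norm_of_nonneg ht0.le,
          div_le_iff₀ (by positivity)]
        exact mul_le_mul_of_nonneg_left hd ht0.le
      simp only [hH]
      rw [indicator_of_mem hmem, indicator_of_mem hind, Pi.one_apply, mul_one,
        add_sub_cancel_left, enorm_smul, Real.enorm_eq_ofReal ht0.le, mul_left_comm (_ ^ n),
        ← mul_assoc (ENNReal.ofReal t⁻¹), ← ENNReal.ofReal_mul (by positivity),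
        inv_mul_cancel₀ ht0.ne', ENNReal.ofReal_one, one_mul]
    calc ∫⁻ y in D, N (z + t • (y - z)) ^ n * ‖y - z‖ₑ
        ≤ ∫⁻ y in D, H (z + t • (y - z)) := setLIntegral_mono' hD h1
      _ ≤ ∫⁻ y, H (z + t • (y - z)) := setLIntegral_le_lintegral _ _
      _ = ENNReal.ofReal ((t ^ n)⁻¹) * ∫⁻ w, H w := lintegral_comp_homothety z ht0 H
      _ = _ := by
        rw [hH, lintegral_indicator hD, ← lintegral_const_mul' _ _ ENNReal.ofReal_ne_top]
        simp_rw [← mul_assoc, ← ENNReal.ofReal_mul (inv_nonneg.2 (pow_nonneg ht0.le n))]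
  -- the time integral
  have htime : ∀ w, ∫⁻ t in Ioo (0 : ℝ) 1, ENNReal.ofReal (t ^ (-2 - κ)) *
      (N w ^ n * ‖w - z‖ₑ * (Ici (‖w - z‖ / (2 * R))).indicator 1 t) ≤
      ENNReal.ofReal ((2 * R) ^ (1 + κ)) * (N w ^ n * ENNReal.ofReal (‖w - z‖ ^ (-κ))) := by
    intro w
    rcases eq_or_ne w z with rfl | hw
    · simp
    have hpos : 0 < ‖w - z‖ := norm_pos_iff.2 (sub_ne_zero.2 hw)
    have hNt : N w ^ n * ‖w - z‖ₑ ≠ ⊤ :=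
      ENNReal.mul_ne_top (ENNReal.pow_ne_top enorm_ne_top) enorm_ne_top
    calc _ ≤ ∫⁻ t, (N w ^ n * ‖w - z‖ₑ) *
          (Ici (‖w - z‖ / (2 * R))).indicator (fun t ↦ ENNReal.ofReal (t ^ (-2 - κ))) t := by
          refine (setLIntegral_le_lintegral _ _).trans (lintegral_mono fun t ↦ le_of_eq ?_)
          by_cases ht : t ∈ Ici (‖w - z‖ / (2 * R))
          · rw [indicator_of_mem ht, indicator_of_mem ht, Pi.one_apply, mul_one, mul_comm]
          · rw [indicator_of_notMem ht, indicator_of_notMem ht, mul_zero, mul_zero]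
      _ = (N w ^ n * ‖w - z‖ₑ) * ∫⁻ t in Ici (‖w - z‖ / (2 * R)),
            ENNReal.ofReal (t ^ (-2 - κ)) := by
          rw [lintegral_const_mul' _ _ hNt, lintegral_indicator measurableSet_Ici]
      _ ≤ (N w ^ n * ‖w - z‖ₑ) * ENNReal.ofReal ((‖w - z‖ / (2 * R)) ^ (-1 - κ)) := by
          gcongr
          exact lintegral_Ici_rpow_le (by positivity) hκ0
      _ = _ := by
          rw [← ofReal_norm, mul_assoc, ← ENNReal.ofReal_mul hpos.le, mul_left_comm,
            ← ENNReal.ofReal_mul (by positivity)]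
          congr 2
          have e1 : ‖w - z‖ ^ (-κ) = ‖w - z‖ * ‖w - z‖ ^ (-(1 + κ)) := by
            rw [show -κ = 1 + -(1 + κ) by ring, Real.rpow_add hpos, Real.rpow_one]
          rw [Real.div_rpow hpos.le (by positivity), show -1 - κ = -(1 + κ) by ring,
            Real.rpow_neg (by positivity : (0 : ℝ) ≤ 2 * R), div_inv_eq_mul, e1]
          ring
  set Φ : EuclideanSpace ℝ (Fin n) → ℝ → ℝ≥0∞ := fun w t ↦
    N w ^ n * ‖w - z‖ₑ * (Ici (‖w - z‖ / (2 * R))).indicator 1 t with hΦ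
  have hΦm : Measurable (Function.uncurry Φ) := by
    have hs : MeasurableSet {p : EuclideanSpace ℝ (Fin n) × ℝ | ‖p.1 - z‖ / (2 * R) ≤ p.2} :=
      measurableSet_le (by fun_prop) (by fun_prop)
    have h1 : Measurable ({p : EuclideanSpace ℝ (Fin n) × ℝ | ‖p.1 - z‖ / (2 * R) ≤ p.2}.indicator
        (1 : EuclideanSpace ℝ (Fin n) × ℝ → ℝ≥0∞)) := measurable_one.indicator hs
    have h2 : Measurable fun p : EuclideanSpace ℝ (Fin n) × ℝ ↦ N p.1 ^ n * ‖p.1 - z‖ₑ :=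
      ((hNm.comp measurable_fst).pow_const n).mul (by fun_prop)
    exact h2.mul h1
  -- The factor `t^(-n)` is the Jacobian of the homothety and `t⁻¹` comes from `‖y - z‖ = ‖w - z‖ /
  -- t`.
  have hexp : ∀ t ∈ Ioo (0 : ℝ) 1, c * t ^ ((1 - θ) * ((n : ℝ) - 1)) * ((t ^ n)⁻¹ * t⁻¹) =
      c * t ^ (-2 - κ) := by
    intro t ht
    have ht0 := ht.1
    rw [mul_assoc, ← Real.rpow_natCast, ← Real.rpow_neg ht0.le, ← Real.rpow_neg_one,
      ← Real.rpow_add ht0, ← Real.rpow_add ht0, hκ]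
    congr 2
    ring
  have hm2 : Measurable (Function.uncurry fun (y : EuclideanSpace ℝ (Fin n)) (t : ℝ) ↦
      ENNReal.ofReal (c * t ^ ((1 - θ) * ((n : ℝ) - 1))) *
        (N (z + t • (y - z)) ^ n * ‖y - z‖ₑ)) := by
    simp only [Function.uncurry_def]
    exact Measurable.mul (by fun_prop) hm1
  calc ∫⁻ y in D, ‖F y - F z‖ₑ
      ≤ ∫⁻ y in D, ∫⁻ t in Ioo (0 : ℝ) 1,
          (ENNReal.ofReal (2 * R * η) * ENNReal.ofReal (t ^ (θ - 1)) +
          ENNReal.ofReal (c * t ^ ((1 - θ) * ((n : ℝ) - 1))) *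
            (N (z + t • (y - z)) ^ n * ‖y - z‖ₑ)) := by
        refine setLIntegral_mono' hD fun y hy ↦ (enorm_sub_le_lintegral_fderiv hF y z).trans ?_
        exact setLIntegral_mono' measurableSet_Ioo fun t ht ↦ hpt y hy t ht
    _ = volume D * ENNReal.ofReal (2 * R * (η * θ⁻¹)) + ∫⁻ y in D, ∫⁻ t in Ioo (0 : ℝ) 1,
          ENNReal.ofReal (c * t ^ ((1 - θ) * ((n : ℝ) - 1))) *
            (N (z + t • (y - z)) ^ n * ‖y - z‖ₑ) := by
        have e : ∀ y, ∫⁻ t in Ioo (0 : ℝ) 1,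
            (ENNReal.ofReal (2 * R * η) * ENNReal.ofReal (t ^ (θ - 1)) +
            ENNReal.ofReal (c * t ^ ((1 - θ) * ((n : ℝ) - 1))) *
              (N (z + t • (y - z)) ^ n * ‖y - z‖ₑ)) = ENNReal.ofReal (2 * R * (η * θ⁻¹)) +
              ∫⁻ t in Ioo (0 : ℝ) 1, ENNReal.ofReal (c * t ^ ((1 - θ) * ((n : ℝ) - 1))) *
              (N (z + t • (y - z)) ^ n * ‖y - z‖ₑ) := by
          intro y
          rw [lintegral_add_left (by fun_prop), lintegral_const_mul' _ _ ENNReal.ofReal_ne_top,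
            lintegral_Ioo_rpow_sub_one hθ, ← ENNReal.ofReal_mul (by positivity)]
          congr 2
          ring
        simp_rw [e]
        rw [lintegral_add_left measurable_const, setLIntegral_const, mul_comm]
    _ ≤ _ := by
        gcongr
        rw [lintegral_lintegral_swap hm2.aemeasurable]
        calc _ ≤ ∫⁻ t in Ioo (0 : ℝ) 1, ∫⁻ w in D,
              ENNReal.ofReal c * (ENNReal.ofReal (t ^ (-2 - κ)) * Φ w t) := by
              refine setLIntegral_mono' measurableSet_Ioo fun t ht ↦ ?_
              rw [lintegral_const_mul' _ _ ENNReal.ofReal_ne_top]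
              refine (mul_le_mul_right (hsub t ht) _).trans (le_of_eq ?_)
              rw [← lintegral_const_mul' _ _ ENNReal.ofReal_ne_top]
              refine lintegral_congr fun w ↦ ?_
              have ht0 := ht.1
              rw [← mul_assoc, ← ENNReal.ofReal_mul (by positivity), hexp t ht,
                ENNReal.ofReal_mul hc0, mul_assoc]
          _ = ∫⁻ w in D, ∫⁻ t in Ioo (0 : ℝ) 1,
              ENNReal.ofReal c * (ENNReal.ofReal (t ^ (-2 - κ)) * Φ w t) := by
              refine (lintegral_lintegral_swap ?_).symm
              apply Measurable.aemeasurable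
              simp only [Function.uncurry_def]
              exact Measurable.mul measurable_const (Measurable.mul (by fun_prop) hΦm)
          _ ≤ ∫⁻ w in D, ENNReal.ofReal c * (ENNReal.ofReal ((2 * R) ^ (1 + κ)) *
                (N w ^ n * ENNReal.ofReal (‖w - z‖ ^ (-κ)))) := by
              refine lintegral_mono fun w ↦ ?_
              rw [lintegral_const_mul' _ _ ENNReal.ofReal_ne_top]
              gcongr
              exact htime w
          _ = _ := by
              simp_rw [← mul_assoc, ← ENNReal.ofReal_mul hc0, mul_assoc]
              rw [lintegral_const_mul' _ _ ENNReal.ofReal_ne_top]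

/-- Negative powers of the distance to a point are integrable against a measure of at most linear
growth. -/
lemma lintegral_rpow_neg_le {σ : Measure (EuclideanSpace ℝ (Fin n))} [IsProbabilityMeasure σ]
    {K κ : ℝ} (hK : 1 ≤ K) (hκ0 : 0 ≤ κ) (hκ : κ ≤ 1 / 2)
    (hσ : ∀ w, ∀ s > 0, σ (closedBall w s) ≤ ENNReal.ofReal (K * s))
    (w : EuclideanSpace ℝ (Fin n)) :
    ∫⁻ z, ENNReal.ofReal (‖w - z‖ ^ (-κ)) ∂σ ≤ ENNReal.ofReal (2 * K ^ κ) := by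
  have hK0 : 0 < K := by linarith
  rcases hκ0.eq_or_lt with rfl | hκ0
  · simp
  have h1 : ∀ z, ‖w - z‖ ^ (-κ) = (‖w - z‖⁻¹) ^ κ := fun z ↦ by
    rw [Real.rpow_neg (norm_nonneg _), Real.inv_rpow (norm_nonneg _)]
  simp_rw [h1]
  rw [lintegral_rpow_eq_lintegral_meas_lt_mul σ (Filter.Eventually.of_forall fun z ↦ by positivity)
    (by fun_prop) hκ0]
  have hlev : ∀ t > 0, σ {z | t < ‖w - z‖⁻¹} ≤ ENNReal.ofReal (K * t⁻¹) := by
    intro t ht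
    refine (measure_mono fun z hz ↦ ?_).trans (hσ w t⁻¹ (by positivity))
    rw [mem_closedBall, dist_comm, dist_eq_norm]
    have hz' : t < ‖w - z‖⁻¹ := hz
    have : 0 < ‖w - z‖ := by
      by_contra h
      have : ‖w - z‖ = 0 := le_antisymm (not_lt.1 h) (norm_nonneg _)
      rw [this, inv_zero] at hz'
      linarith
    exact ((lt_inv_comm₀ ht this).1 hz').le
  have hsplit : ∫⁻ t in Ioi 0, σ {z | t < ‖w - z‖⁻¹} * ENNReal.ofReal (t ^ (κ - 1)) ≤
      ENNReal.ofReal (K ^ κ / κ) + ENNReal.ofReal (K ^ κ / (1 - κ)) := by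
    -- Layer cake split at level `K`: below it `σ` has mass at most `1`, above it the growth bound
    -- `K / t` is the better one.
    rw [← Ioc_union_Ioi_eq_Ioi hK0.le]
    refine (lintegral_union_le _ _ _).trans (add_le_add ?_ ?_)
    · calc _ ≤ ∫⁻ t in Ioc 0 K, ENNReal.ofReal (t ^ (κ - 1)) := by
            refine lintegral_mono fun t ↦ ?_
            exact mul_le_of_le_one_left' prob_le_one
        _ = _ := by
            have hi : IntervalIntegrable (fun t : ℝ ↦ t ^ (κ - 1)) volume 0 K :=
              intervalIntegral.intervalIntegrable_rpow' (by linarith)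
            rw [intervalIntegrable_iff_integrableOn_Ioc_of_le hK0.le] at hi
            rw [← ofReal_integral_eq_lintegral_ofReal hi,
              ← intervalIntegral.integral_of_le hK0.le, integral_rpow (Or.inl (by linarith))]
            · simp [hκ0.ne']
            · filter_upwards [ae_restrict_mem measurableSet_Ioc] with t ht
              exact Real.rpow_nonneg ht.1.le _
    · calc _ ≤ ∫⁻ t in Ioi K, ENNReal.ofReal (K * t ^ (κ - 2)) := by
            refine setLIntegral_mono' measurableSet_Ioi fun t ht ↦ ?_
            have ht0 : 0 < t := hK0.trans ht
            refine (mul_le_mul_left (hlev t ht0) _).trans (le_of_eq ?_)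
            rw [← ENNReal.ofReal_mul (by positivity), mul_assoc, ← Real.rpow_neg_one,
              ← Real.rpow_add ht0]
            congr 3
            ring
        _ = _ := by
            have hi : IntegrableOn (fun t : ℝ ↦ K * t ^ (κ - 2)) (Ioi K) :=
              (integrableOn_Ioi_rpow_of_lt (by linarith) hK0).const_mul K
            rw [← ofReal_integral_eq_lintegral_ofReal hi, integral_const_mul,
              integral_Ioi_rpow_of_lt (by linarith) hK0]
            · congr 1
              have e : K ^ κ = K * K ^ (κ - 2 + 1) := by
                rw [show κ = 1 + (κ - 2 + 1) by ring, Real.rpow_add hK0, Real.rpow_one]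
                congr 2
                ring
              rw [e, show κ - 2 + 1 = -(1 - κ) by ring, neg_div_neg_eq, mul_div_assoc]
            · filter_upwards [ae_restrict_mem measurableSet_Ioi] with t ht
              have ht0 : 0 < t := hK0.trans ht
              positivity
  refine (mul_le_mul_right hsplit _).trans ?_
  have h1κ : 0 < 1 - κ := by linarith
  rw [← ENNReal.ofReal_add (by positivity) (by positivity), ← ENNReal.ofReal_mul hκ0.le]
  apply ENNReal.ofReal_le_ofReal
  have hp : 0 < K ^ κ := by positivity
  rw [mul_add, mul_div_cancel₀ _ hκ0.ne', two_mul]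
  gcongr
  rw [mul_div_left_comm]
  apply mul_le_of_le_one_right hp.le
  rw [div_le_one h1κ]
  linarith

end Potential

/-! ### Approximation by smooth functions without loss of energy -/

section Mollification

variable {n : ℕ}

/-- `F` is continuous on the closed ball and has there the weak partial derivatives `P i`. -/
structure HasWeakGradientOn (F : EuclideanSpace ℝ (Fin n) → ℝ)
    (P : Fin n → EuclideanSpace ℝ (Fin n) → ℝ) (u : EuclideanSpace ℝ (Fin n)) (r : ℝ) :
    Prop where
  continuousOn : ContinuousOn F (closedBall u r)
  integrableOn (i : Fin n) : IntegrableOn (P i) (closedBall u r)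
  integral_eq (i : Fin n) (ψ : EuclideanSpace ℝ (Fin n) → ℝ) (hψ : ContDiff ℝ ∞ ψ)
    (hc : HasCompactSupport ψ) (hs : tsupport ψ ⊆ closedBall u r) :
    ∫ w, F w * fderiv ℝ ψ w (EuclideanSpace.single i 1) = - ∫ w, P i w * ψ w

lemma enorm_le_sum_enorm_apply_single (L : EuclideanSpace ℝ (Fin n) →L[ℝ] ℝ) :
    ‖L‖ₑ ≤ ∑ i, ‖L (EuclideanSpace.single i 1)‖ₑ := by
  have h : ‖L‖ ≤ ∑ i, ‖L (EuclideanSpace.single i 1)‖ := by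
    refine L.opNorm_le_bound (by positivity) fun v ↦ ?_
    have hv : v = ∑ i, v i • EuclideanSpace.single i (1 : ℝ) := by
      have := ((EuclideanSpace.basisFun (Fin n) ℝ).sum_repr v).symm
      simpa using this
    conv_lhs => rw [hv, map_sum]
    rw [Finset.sum_mul]
    refine (norm_sum_le _ _).trans (Finset.sum_le_sum fun i _ ↦ ?_)
    rw [map_smul, norm_smul, mul_comm]
    gcongr
    exact PiLp.norm_apply_le v i
  rw [← ofReal_norm]
  refine (ENNReal.ofReal_le_ofReal h).trans (le_of_eq ?_)
  rw [ENNReal.ofReal_sum_of_nonneg fun i _ ↦ norm_nonneg _]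
  simp_rw [ofReal_norm]

lemma lintegral_pow_le_of_isProbabilityMeasure {α : Type*} [MeasurableSpace α] {ν : Measure α}
    [IsProbabilityMeasure ν] (hn : 1 ≤ n) {N : α → ℝ≥0∞} (hN : AEMeasurable N ν) :
    (∫⁻ w, N w ∂ν) ^ n ≤ ∫⁻ w, N w ^ n ∂ν := by
  have hn' : (0 : ℝ) < n := by exact_mod_cast hn
  have h := eLpNorm'_le_eLpNorm'_of_exponent_le (f := N) (p := 1) (q := n) one_pos
    (by exact_mod_cast hn) ν hN.aestronglyMeasurable
  simp only [eLpNorm', enorm_eq_self, ENNReal.rpow_one, ENNReal.rpow_natCast, div_one] at h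
  rw [← ENNReal.rpow_natCast]
  calc _ ≤ ((∫⁻ w, N w ^ n ∂ν) ^ (1 / (n : ℝ))) ^ (n : ℝ) := by gcongr
    _ = _ := by rw [← ENNReal.rpow_mul, one_div_mul_cancel hn'.ne', ENNReal.rpow_one]

lemma exists_mollifier {r : ℝ} (hr : 0 < r) : ∃ k : EuclideanSpace ℝ (Fin n) → ℝ,
    ContDiff ℝ ∞ k ∧ HasCompactSupport k ∧ (∀ x, 0 ≤ k x) ∧ ∫ x, k x = 1 ∧
      Function.support k ⊆ ball 0 r := by
  let φ : ContDiffBump (0 : EuclideanSpace ℝ (Fin n)) := ⟨r / 2, r, by positivity, by linarith⟩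
  exact ⟨φ.normed volume, φ.contDiff_normed, φ.hasCompactSupport_normed, φ.nonneg_normed,
    φ.integral_normed, φ.support_normed_eq.subset⟩

/-- Mollification: uniform continuity gives the uniform closeness, and Jensen's inequality for the
kernel keeps the energy on the small ball below that on the doubled ball. -/
lemma HasWeakGradientOn.exists_contDiff_approx (hn : 1 ≤ n)
    {F : EuclideanSpace ℝ (Fin n) → ℝ} {P : Fin n → EuclideanSpace ℝ (Fin n) → ℝ}
    {u : EuclideanSpace ℝ (Fin n)} {R : ℝ} (hR : 0 < R) (hF : HasWeakGradientOn F P u (2 * R))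
    {δ : ℝ} (hδ : 0 < δ) :
    ∃ G : EuclideanSpace ℝ (Fin n) → ℝ, ContDiff ℝ 1 G ∧ (∀ x ∈ ball u R, dist (G x) (F x) ≤ δ) ∧
      ∫⁻ x in ball u R, ‖fderiv ℝ G x‖ₑ ^ n ≤
        ∫⁻ w in closedBall u (2 * R), (∑ i, ‖P i w‖ₑ) ^ n := by
  set S := closedBall u (2 * R) with hS
  have hSm : MeasurableSet S := measurableSet_closedBall
  have hSc : IsCompact S := isCompact_closedBall _ _
  set F' := S.indicator F with hF'
  have hFi : Integrable F' := by
    rw [hF', integrable_indicator_iff hSm]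
    exact hF.continuousOn.integrableOn_compact hSc
  obtain ⟨ρ, hρ, hρF⟩ := Metric.uniformContinuousOn_iff.1
    (hSc.uniformContinuousOn_of_continuous hF.continuousOn) δ hδ
  -- `ρ` serves the closeness `δ`, and `R` keeps the kernel centred in the small ball supported in
  -- the doubled ball, where the weak derivatives live and `F'` agrees with `F`.
  set r := min ρ R with hr
  have hr0 : 0 < r := lt_min hρ hR
  obtain ⟨k, hkc, hkcs, hk0, hk1, hksupp⟩ := exists_mollifier (n := n) hr0
  have hki : Integrable k := hkc.continuous.integrable_of_hasCompactSupport hkcs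
  have hball : ∀ x ∈ ball u R, closedBall x r ⊆ S := fun x hx y hy ↦ by
    rw [hS, mem_closedBall]
    have h1 := mem_ball.1 hx
    have h2 := mem_closedBall.1 hy
    have h3 : r ≤ R := min_le_right _ _
    linarith [dist_triangle y x u]
  have hkl1 : ∫⁻ x, ENNReal.ofReal (k x) = 1 := by
    rw [← ofReal_integral_eq_lintegral_ofReal hki (Filter.Eventually.of_forall hk0), hk1,
      ENNReal.ofReal_one]
  set G := MeasureTheory.convolution k F' (ContinuousLinearMap.lsmul ℝ ℝ) volume with hG
  have hGc : ContDiff ℝ 1 G := hkcs.contDiff_convolution_left _ (hkc.of_le (by simp))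
    hFi.locallyIntegrable
  refine ⟨G, hGc, fun x hx ↦ ?_, ?_⟩
  · have hxS : x ∈ S := hball x hx (mem_closedBall_self hr0.le)
    have h := dist_convolution_le (μ := volume) (g := F') (x₀ := x) (z₀ := F' x) (ε := δ) hδ.le
      hksupp hk0 hk1 hFi.aestronglyMeasurable (fun y hy ↦ by
        have hy' : dist y x < r := hy
        have hyS : y ∈ S := hball x hx (ball_subset_closedBall hy)
        rw [hF', indicator_of_mem hyS, indicator_of_mem hxS]
        exact (hρF y hyS x hxS (hy'.trans_le (min_le_left _ _))).le)
    rwa [hF', indicator_of_mem hxS] at h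
  · set N₀ : EuclideanSpace ℝ (Fin n) → ℝ≥0∞ := S.indicator fun w ↦ ∑ i, ‖P i w‖ₑ with hN₀
    have hN₀m : AEMeasurable N₀ := by
      rw [hN₀, aemeasurable_indicator_iff hSm]
      exact Finset.aemeasurable_fun_sum _ fun i _ ↦ (hF.integrableOn i).aestronglyMeasurable.enorm
    have hder : ∀ x ∈ ball u R, ‖fderiv ℝ G x‖ₑ ≤ ∫⁻ w, N₀ w * ENNReal.ofReal (k (x - w)) := by
      intro x hx
      -- The reflected kernel is an admissible test function, so the derivative falling on the
      -- kernel is moved onto `F` by the weak formulation.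
      set ψ : EuclideanSpace ℝ (Fin n) → ℝ := fun w ↦ k (x - w) with hψ
      have hψc : ContDiff ℝ ∞ ψ := hkc.comp (contDiff_const.sub contDiff_id)
      have hψs : tsupport ψ ⊆ closedBall x r := by
        refine closure_minimal (fun w hw ↦ ?_) isClosed_closedBall
        have h1 : x - w ∈ Function.support k := hw
        have h1 := hksupp h1
        rw [mem_ball_zero_iff] at h1
        rw [mem_closedBall, dist_comm, dist_eq_norm]
        exact h1.le
      have hψcs : HasCompactSupport ψ :=
        (isCompact_closedBall x r).of_isClosed_subset (isClosed_tsupport _) hψs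
      have hψd : ∀ w v, fderiv ℝ ψ w v = - fderiv ℝ k (x - w) v := by
        intro w v
        have h1 : HasFDerivAt ψ ((fderiv ℝ k (x - w)).comp
            (-(ContinuousLinearMap.id ℝ (EuclideanSpace ℝ (Fin n))))) w :=
          ((hkc.differentiable (by simp) (x - w)).hasFDerivAt).comp w
            ((hasFDerivAt_id w).const_sub x)
        rw [h1.fderiv]
        simp
      have hi : ∀ i, fderiv ℝ G x (EuclideanSpace.single i 1) = ∫ w, P i w * ψ w := by
        intro i
        have h1 := hkcs.hasFDerivAt_convolution_left (ContinuousLinearMap.lsmul ℝ ℝ)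
          (hkc.of_le (by simp)) hFi.locallyIntegrable x
        rw [h1.fderiv]
        have h2 := hkcs.fderiv (𝕜 := ℝ)
        have h3 : ConvolutionExistsAt (fderiv ℝ k) F' x
            ((ContinuousLinearMap.lsmul ℝ ℝ).precompL (EuclideanSpace ℝ (Fin n))) volume :=
          h2.convolutionExists_left _ (hkc.continuous_fderiv (by simp)) hFi.locallyIntegrable x
        rw [convolution_eq_swap]
        have h4 := h3.integrable_swap
        rw [ContinuousLinearMap.integral_apply h4]
        have h5 := hF.integral_eq i ψ hψc hψcs (hψs.trans (hball x hx))
        rw [← neg_eq_iff_eq_neg] at h5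
        rw [← h5, ← integral_neg]
        refine integral_congr_ae (Filter.Eventually.of_forall fun w ↦ ?_)
        simp only [ContinuousLinearMap.precompL_apply, ContinuousLinearMap.lsmul_apply,
          smul_eq_mul, hψd]
        by_cases hw : w ∈ S
        · rw [hF', indicator_of_mem hw]
          ring
        · have : fderiv ℝ ψ w = 0 := by
            by_contra h
            exact hw (hball x hx (hψs (support_fderiv_subset ℝ h)))
          have h6 := hψd w (EuclideanSpace.single i 1)
          rw [this, zero_apply] at h6
          rw [← h6, neg_eq_zero.1 h6.symm]
          simp
      calc ‖fderiv ℝ G x‖ₑ ≤ ∑ i, ‖∫ w, P i w * ψ w‖ₑ := by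
            simpa only [hi] using enorm_le_sum_enorm_apply_single (fderiv ℝ G x)
        _ ≤ ∑ i, ∫⁻ w in S, ‖P i w‖ₑ * ENNReal.ofReal (ψ w) := by
            refine Finset.sum_le_sum fun i _ ↦ (enorm_integral_le_lintegral_enorm _).trans ?_
            rw [← lintegral_indicator hSm]
            refine lintegral_mono fun w ↦ ?_
            by_cases hw : w ∈ S
            · rw [indicator_of_mem hw, enorm_mul, Real.enorm_eq_ofReal (hk0 _)]
            · have : ψ w = 0 := by
                by_contra h
                exact hw (hball x hx (hψs (subset_tsupport _ h)))
              simp [this]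
        _ = ∫⁻ w in S, (∑ i, ‖P i w‖ₑ) * ENNReal.ofReal (ψ w) := by
            simp_rw [Finset.sum_mul]
            refine (lintegral_finsetSum' _ fun i _ ↦ ?_).symm
            have := hψc.continuous.measurable
            exact (hF.integrableOn i).aestronglyMeasurable.enorm.mul (by fun_prop)
        _ = _ := by
            rw [← lintegral_indicator hSm]
            refine lintegral_congr fun w ↦ ?_
            by_cases hw : w ∈ S
            · simp [hw, hN₀, hψ]
            · simp [hw, hN₀]
    -- A measurable representative, so that the integrand below is jointly measurable and Tonelli
    -- applies.
    set N₁ := hN₀m.mk N₀ with hN₁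
    have hN₁m : Measurable N₁ := hN₀m.measurable_mk
    have hae : N₀ =ᵐ[volume] N₁ := hN₀m.ae_eq_mk
    have hkmeas : Measurable k := hkc.continuous.measurable
    have hkm : Measurable fun p : EuclideanSpace ℝ (Fin n) × EuclideanSpace ℝ (Fin n) ↦
        ENNReal.ofReal (k (p.1 - p.2)) := by
      fun_prop
    have hjen : ∀ x ∈ ball u R, ‖fderiv ℝ G x‖ₑ ^ n ≤
        ∫⁻ w, N₁ w ^ n * ENNReal.ofReal (k (x - w)) := by
      intro x hx
      have hkx : Measurable fun w ↦ ENNReal.ofReal (k (x - w)) := by fun_prop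
      set ν := (volume : Measure (EuclideanSpace ℝ (Fin n))).withDensity
        fun w ↦ ENNReal.ofReal (k (x - w)) with hν
      have : IsProbabilityMeasure ν := ⟨by
        rw [hν, withDensity_apply _ MeasurableSet.univ, setLIntegral_univ,
          lintegral_sub_left_eq_self (fun w ↦ ENNReal.ofReal (k w)) x, hkl1]⟩
      have h1 : ∫⁻ w, N₀ w * ENNReal.ofReal (k (x - w)) = ∫⁻ w, N₁ w ∂ν := by
        rw [hν, lintegral_withDensity_eq_lintegral_mul _ hkx hN₁m]
        refine lintegral_congr_ae (hae.mono fun w hw ↦ ?_)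
        simp [hw, mul_comm]
      calc ‖fderiv ℝ G x‖ₑ ^ n ≤ (∫⁻ w, N₁ w ∂ν) ^ n := by
            gcongr
            exact (hder x hx).trans_eq h1
        _ ≤ ∫⁻ w, N₁ w ^ n ∂ν := lintegral_pow_le_of_isProbabilityMeasure hn hN₁m.aemeasurable
        _ = _ := by
            rw [hν, lintegral_withDensity_eq_lintegral_mul _ hkx (hN₁m.pow_const n)]
            simp [mul_comm]
    calc ∫⁻ x in ball u R, ‖fderiv ℝ G x‖ₑ ^ n
        ≤ ∫⁻ x in ball u R, ∫⁻ w, N₁ w ^ n * ENNReal.ofReal (k (x - w)) :=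
          setLIntegral_mono' measurableSet_ball hjen
      _ ≤ ∫⁻ x, ∫⁻ w, N₁ w ^ n * ENNReal.ofReal (k (x - w)) := setLIntegral_le_lintegral _ _
      _ = ∫⁻ w, ∫⁻ x, N₁ w ^ n * ENNReal.ofReal (k (x - w)) := by
          refine lintegral_lintegral_swap (Measurable.aemeasurable ?_)
          exact ((hN₁m.comp measurable_snd).pow_const n).mul hkm
      _ = ∫⁻ w, N₁ w ^ n := by
          refine lintegral_congr fun w ↦ ?_
          have hkx : Measurable fun x ↦ ENNReal.ofReal (k (x - w)) := by fun_prop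
          rw [lintegral_const_mul _ hkx,
            lintegral_sub_right_eq_self (fun w ↦ ENNReal.ofReal (k w)) w, hkl1, mul_one]
      _ = ∫⁻ w, N₀ w ^ n := lintegral_congr_ae (hae.mono fun w hw ↦ by simp [hw])
      _ = _ := by
          rw [← lintegral_indicator hSm]
          refine lintegral_congr fun w ↦ ?_
          by_cases hw : w ∈ S
          · simp [hw, hN₀]
          · simp [hw, hN₀]
            omega

end Mollification

/-! ### Means against measures of linear growth, exponential integrability, averages over segments
-/

section Oscillation

variable {n : ℕ}

/-- The constant in front of the energy in the oscillation estimate with slope `ε`. -/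
def oscConst (n : ℕ) (R ε : ℝ) : ℝ :=
  4 * ((ε / (4 * n * R))⁻¹) ^ (n - 1) * (max 1 (2 * R)) ^ 2

lemma oscConst_nonneg (n : ℕ) {R ε : ℝ} (hR : 0 < R) (hε : 0 < ε) : 0 ≤ oscConst n R ε := by
  unfold oscConst
  positivity

lemma lintegral_lintegral_enorm_sub_le (hn : 1 ≤ n) {F : EuclideanSpace ℝ (Fin n) → ℝ}
    (hF : ContDiff ℝ 1 F) {u : EuclideanSpace ℝ (Fin n)} {R ε : ℝ} (hR : 0 < R) (hε : 0 < ε)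
    {σ : Measure (EuclideanSpace ℝ (Fin n))} [IsProbabilityMeasure σ]
    (hσB : ∀ᵐ z ∂σ, z ∈ ball u R) {K : ℝ} (hK : 1 ≤ K)
    (hσ : ∀ w, ∀ s > 0, σ (closedBall w s) ≤ ENNReal.ofReal (K * s)) :
    ∫⁻ z, (∫⁻ y in ball u R, ‖F y - F z‖ₑ) ∂σ ≤
      volume (ball u R) * ENNReal.ofReal (ε * (1 + Real.log K)) +
      ENNReal.ofReal (oscConst n R ε) * ∫⁻ w in ball u R, ‖fderiv ℝ F w‖ₑ ^ n := by
  have hn0 : (1 : ℝ) ≤ n := by exact_mod_cast hn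
  have hK0 : 0 < K := by linarith
  have hlog : 0 ≤ Real.log K := Real.log_nonneg hK
  -- The choice of `η` and `θ` makes `2 R η / θ` equal to `ε (1 + log K)`. It also gives `κ (1 + log
  -- K) ≤ 1/2`, so `K^κ ≤ e^(1/2) ≤ 2` and the energy term becomes independent of `K`.
  set η := ε / (4 * n * R) with hη
  have hη0 : 0 < η := by positivity
  set θ := (2 * n * (1 + Real.log K))⁻¹ with hθ
  have hθ0 : 0 < θ := by positivity
  set κ := θ * ((n : ℝ) - 1) with hκ
  have hκ0 : 0 ≤ κ := mul_nonneg hθ0.le (by linarith)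
  have hκl : κ * (1 + Real.log K) ≤ 1 / 2 := by
    rw [hκ, hθ]
    have : (2 * n * (1 + Real.log K))⁻¹ * ((n : ℝ) - 1) * (1 + Real.log K) =
      1 / 2 * (((n : ℝ) - 1) / n) := by field_simp
    rw [this]
    have h2 : ((n : ℝ) - 1) / n ≤ 1 := by rw [div_le_one (by linarith)]; linarith
    linarith
  have hκ2 : κ ≤ 1 / 2 := by nlinarith
  have hKκ : K ^ κ ≤ 2 := by
    rw [Real.rpow_def_of_pos hK0]
    have h1 : Real.log K * κ ≤ 1 / 2 := by nlinarith
    have h2 : Real.exp (1 / 2) ≤ 2 := by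
      have h3 : Real.exp (1 / 2) * Real.exp (1 / 2) = Real.exp 1 := by
        rw [← Real.exp_add]; norm_num
      have h4 := Real.exp_one_lt_d9
      nlinarith [Real.exp_pos (1 / 2)]
    exact (Real.exp_le_exp.2 h1).trans h2
  set N : EuclideanSpace ℝ (Fin n) → ℝ≥0∞ := fun w ↦ ‖fderiv ℝ F w‖ₑ with hN
  have hNm : Measurable N := by
    have := hF.continuous_fderiv one_ne_zero
    exact (by fun_prop : Continuous N).measurable
  set c₂ := (η⁻¹) ^ (n - 1) * (2 * R) ^ (1 + κ) with hc₂
  have hc₂0 : 0 ≤ c₂ := by positivity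
  have hm : Measurable (Function.uncurry fun (z w : EuclideanSpace ℝ (Fin n)) ↦
      N w ^ n * ENNReal.ofReal (‖w - z‖ ^ (-κ))) := by
    simp only [Function.uncurry_def]
    exact ((hNm.comp measurable_snd).pow_const n).mul (by fun_prop)
  calc ∫⁻ z, (∫⁻ y in ball u R, ‖F y - F z‖ₑ) ∂σ
      ≤ ∫⁻ z, (volume (ball u R) * ENNReal.ofReal (2 * R * (η * θ⁻¹)) + ENNReal.ofReal c₂ *
          ∫⁻ w in ball u R, N w ^ n * ENNReal.ofReal (‖w - z‖ ^ (-κ))) ∂σ :=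
        lintegral_mono_ae (hσB.mono fun z hz ↦ lintegral_enorm_sub_le hn hF hR hz hθ0 hη0)
    _ = volume (ball u R) * ENNReal.ofReal (2 * R * (η * θ⁻¹)) + ENNReal.ofReal c₂ *
          ∫⁻ w in ball u R, N w ^ n * ∫⁻ z, ENNReal.ofReal (‖w - z‖ ^ (-κ)) ∂σ := by
        rw [lintegral_add_left measurable_const, lintegral_const, measure_univ, mul_one,
          lintegral_const_mul' _ _ ENNReal.ofReal_ne_top,
          lintegral_lintegral_swap hm.aemeasurable]
        congr 2
        refine lintegral_congr fun w ↦ lintegral_const_mul _ (by fun_prop)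
    _ ≤ volume (ball u R) * ENNReal.ofReal (2 * R * (η * θ⁻¹)) + ENNReal.ofReal c₂ *
          ∫⁻ w in ball u R, N w ^ n * ENNReal.ofReal (2 * K ^ κ) := by
        gcongr with w
        exact lintegral_rpow_neg_le hK hκ0 hκ2 hσ w
    _ ≤ _ := by
        rw [lintegral_mul_const' _ _ ENNReal.ofReal_ne_top, mul_left_comm (ENNReal.ofReal c₂),
          mul_comm (ENNReal.ofReal (oscConst n R ε))]
        refine add_le_add (le_of_eq ?_) ?_
        · congr 2
          rw [hη, hθ]
          field_simp
          ring
        · gcongr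
          rw [← ENNReal.ofReal_mul hc₂0]
          apply ENNReal.ofReal_le_ofReal
          rw [hc₂, oscConst, ← hη]
          have h1 : (2 * R) ^ (1 + κ) ≤ (max 1 (2 * R)) ^ 2 := by
            calc (2 * R) ^ (1 + κ) ≤ (max 1 (2 * R)) ^ (1 + κ) := by
                  gcongr
                  exact le_max_right _ _
              _ ≤ (max 1 (2 * R)) ^ (2 : ℝ) :=
                  Real.rpow_le_rpow_of_exponent_le (le_max_left _ _) (by linarith)
              _ = _ := by norm_cast
          calc _ ≤ (η⁻¹) ^ (n - 1) * (max 1 (2 * R)) ^ 2 * (2 * 2) := by gcongr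
            _ = _ := by ring

/-- The mean of `F` with respect to a measure `σ` of at most linear growth differs from the mean
over the ball by an arbitrarily small multiple of the logarithm of the growth constant, up to a
constant depending on the energy. -/
lemma HasWeakGradientOn.abs_integral_sub_average_le (hn : 1 ≤ n) {R ε : ℝ} (hR : 0 < R)
    (hε : 0 < ε) (J : ℝ≥0) : ∃ A : ℝ, 0 ≤ A ∧
    ∀ (F : EuclideanSpace ℝ (Fin n) → ℝ) (P : Fin n → EuclideanSpace ℝ (Fin n) → ℝ)
      (u : EuclideanSpace ℝ (Fin n)), HasWeakGradientOn F P u (2 * R) →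
      ∫⁻ w in closedBall u (2 * R), (∑ i, ‖P i w‖ₑ) ^ n ≤ J →
    ∀ (σ : Measure (EuclideanSpace ℝ (Fin n))) [IsProbabilityMeasure σ] (K : ℝ), 1 ≤ K →
      (∀ᵐ z ∂σ, z ∈ ball u R) →
      (∀ w, ∀ s > 0, σ (closedBall w s) ≤ ENNReal.ofReal (K * s)) →
      |∫ z, F z ∂σ - ⨍ y in ball u R, F y| ≤ ε * Real.log K + A := by
  have hV0 : volume (ball (0 : EuclideanSpace ℝ (Fin n)) R) ≠ 0 := (measure_ball_pos _ _ hR).ne'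
  have hVt : volume (ball (0 : EuclideanSpace ℝ (Fin n)) R) ≠ ⊤ := measure_ball_lt_top.ne
  set V := (volume (ball (0 : EuclideanSpace ℝ (Fin n)) R)).toReal with hV
  have hVpos : 0 < V := ENNReal.toReal_pos hV0 hVt
  -- The summand `ε` is the constant part of `ε (1 + log K)`; the other is the energy term divided
  -- by the volume of the ball.
  refine ⟨ε + V⁻¹ * (oscConst n R ε * J), by
    have := oscConst_nonneg n hR hε
    positivity, ?_⟩
  intro F P u hF hJ σ _ K hK hσB hσ
  have hK0 : 0 ≤ Real.log K := Real.log_nonneg hK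
  have hvol : volume (ball u R) = ENNReal.ofReal V := by
    rw [Measure.addHaar_ball_center, hV, ENNReal.ofReal_toReal hVt]
  have hsub : ball u R ⊆ closedBall u (2 * R) :=
    ball_subset_closedBall.trans (closedBall_subset_closedBall (by linarith))
  have hFc : ContinuousOn F (closedBall u (2 * R)) := hF.continuousOn
  have hFv : IntegrableOn F (ball u R) :=
    (hFc.integrableOn_compact (isCompact_closedBall _ _)).mono_set hsub
  have hσr : σ.restrict (closedBall u (2 * R)) = σ :=
    Measure.restrict_eq_self_of_ae_mem (hσB.mono fun z hz ↦ hsub hz)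
  have hFσ : Integrable F σ := by
    have := hFc.integrableOn_compact (μ := σ) (isCompact_closedBall u (2 * R))
    rwa [IntegrableOn, hσr] at this
  set m := ⨍ y in ball u R, F y with hm
  -- reduction to the double integral
  have h1 : ENNReal.ofReal V * ‖∫ z, F z ∂σ - m‖ₑ ≤ ∫⁻ z, (∫⁻ y in ball u R, ‖F y - F z‖ₑ) ∂σ := by
    have e1 : ∫ z, F z ∂σ - m = ∫ z, (F z - m) ∂σ := by
      rw [integral_sub hFσ (integrable_const _)]
      simp
    rw [e1]
    refine (mul_le_mul_right (enorm_integral_le_lintegral_enorm _) _).trans ?_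
    rw [← lintegral_const_mul' _ _ ENNReal.ofReal_ne_top]
    refine lintegral_mono fun z ↦ ?_
    have e2 : V * (m - F z) = ∫ y in ball u R, (F y - F z) := by
      rw [integral_sub hFv (integrableOn_const (by rw [hvol]; exact ENNReal.ofReal_ne_top)),
        setIntegral_const, hm, setAverage_eq, Measure.real, hvol, ENNReal.toReal_ofReal hVpos.le,
        smul_eq_mul, smul_eq_mul, mul_sub, mul_inv_cancel_left₀ hVpos.ne']
    rw [← Real.enorm_eq_ofReal hVpos.le, ← enorm_neg (F z - m), neg_sub, ← enorm_mul, e2]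
    exact enorm_integral_le_lintegral_enorm _
  -- approximation
  have h2 : ∀ δ : ℝ, 0 < δ → ∫⁻ z, (∫⁻ y in ball u R, ‖F y - F z‖ₑ) ∂σ ≤
      ENNReal.ofReal (V * (2 * δ) + (V * (ε * (1 + Real.log K)) + oscConst n R ε * J)) := by
    intro δ hδ
    -- Closeness has to be uniform, because `σ` may be singular with respect to Lebesgue measure, as
    -- it is for measures carried by curves.
    obtain ⟨G, hG, hGF, hGJ⟩ := hF.exists_contDiff_approx hn hR hδ
    have h3 := lintegral_lintegral_enorm_sub_le hn hG hR hε hσB hK hσ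
    have hosc := oscConst_nonneg n hR hε
    calc _ ≤ ∫⁻ z, (∫⁻ y in ball u R, (ENNReal.ofReal (2 * δ) + ‖G y - G z‖ₑ)) ∂σ := by
          refine lintegral_mono_ae (hσB.mono fun z hz ↦ ?_)
          refine setLIntegral_mono' measurableSet_ball fun y hy ↦ ?_
          rw [← ofReal_norm, ← ofReal_norm, ← ENNReal.ofReal_add (by positivity) (norm_nonneg _)]
          apply ENNReal.ofReal_le_ofReal
          have h4 := hGF y hy
          have h5 := hGF z hz
          rw [Real.dist_eq] at h4 h5
          rw [Real.norm_eq_abs, Real.norm_eq_abs]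
          have h6 : F y - F z = -(G y - F y) + (G y - G z) + (G z - F z) := by ring
          rw [h6]
          refine (abs_add_three _ _ _).trans ?_
          rw [abs_neg]
          linarith
      _ = ENNReal.ofReal (V * (2 * δ)) + ∫⁻ z, (∫⁻ y in ball u R, ‖G y - G z‖ₑ) ∂σ := by
          simp_rw [lintegral_add_left measurable_const, setLIntegral_const, lintegral_const,
            measure_univ, mul_one]
          rw [hvol, ← ENNReal.ofReal_mul (by positivity), mul_comm]
      _ ≤ ENNReal.ofReal (V * (2 * δ)) + (ENNReal.ofReal (V * (ε * (1 + Real.log K))) +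
            ENNReal.ofReal (oscConst n R ε * J)) := by
          gcongr
          refine h3.trans ?_
          rw [hvol, ← ENNReal.ofReal_mul hVpos.le]
          gcongr
          rw [ENNReal.ofReal_mul hosc, ENNReal.ofReal_coe_nnreal]
          gcongr
          exact hGJ.trans hJ
      _ = _ := by
          rw [← ENNReal.ofReal_add (by positivity) (by positivity),
            ← ENNReal.ofReal_add (by positivity) (by positivity)]
  have h3 : ∀ δ : ℝ, 0 < δ → V * |∫ z, F z ∂σ - m| ≤
      (V * (ε * (1 + Real.log K)) + oscConst n R ε * J) + δ := by
    intro δ hδ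
    have h4 := h1.trans (h2 (δ / (2 * V)) (by positivity))
    have hosc := oscConst_nonneg n hR hε
    rw [← ofReal_norm, ← ENNReal.ofReal_mul hVpos.le,
      ENNReal.ofReal_le_ofReal_iff (by positivity), Real.norm_eq_abs] at h4
    have h5 : V * (2 * (δ / (2 * V))) = δ := by field_simp
    linarith
  have h4 := le_of_forall_pos_le_add h3
  rw [← le_div_iff₀' hVpos] at h4
  refine h4.trans (le_of_eq ?_)
  field_simp
  ring

/-- Exponential integrability of functions with gradient in `L^n`. -/
lemma HasWeakGradientOn.lintegral_exp_le (hn : 1 ≤ n) {R p : ℝ} (hR : 0 < R)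
    (hp : 0 < p) (J : ℝ≥0) : ∃ A : ℝ≥0,
    ∀ (F : EuclideanSpace ℝ (Fin n) → ℝ) (P : Fin n → EuclideanSpace ℝ (Fin n) → ℝ)
      (u : EuclideanSpace ℝ (Fin n)), HasWeakGradientOn F P u (2 * R) →
      ∫⁻ w in closedBall u (2 * R), (∑ i, ‖P i w‖ₑ) ^ n ≤ J →
      ∫⁻ y in ball u R, ENNReal.ofReal (Real.exp (p * (F y - ⨍ y in ball u R, F y))) ≤ A := by
  have hn0 : (0 : ℝ) < n := by exact_mod_cast hn
  -- This slope gives level sets decaying like `exp (-2 p t)`, twice the rate needed to integrate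
  -- `exp (p t)`.
  obtain ⟨A, hA0, hA⟩ := HasWeakGradientOn.abs_integral_sub_average_le hn hR
    (ε := n / (2 * p)) (by positivity) J
  set b₁ := (volume (ball (0 : EuclideanSpace ℝ (Fin n)) 1)).toReal with hb₁
  have hb₁t : volume (ball (0 : EuclideanSpace ℝ (Fin n)) 1) = ENNReal.ofReal b₁ :=
    (ENNReal.ofReal_toReal measure_ball_lt_top.ne).symm
  have hb₁0 : 0 < b₁ := ENNReal.toReal_pos (measure_ball_pos _ _ one_pos).ne' measure_ball_lt_top.ne
  set V := (volume (ball (0 : EuclideanSpace ℝ (Fin n)) R)).toReal with hV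
  refine ⟨Real.toNNReal (V * Real.exp (p * A) + b₁ * Real.exp (p * A)), ?_⟩
  intro F P u hF hJ
  set B := ball u R with hB
  have hvol : volume B = ENNReal.ofReal V := by
    rw [Measure.addHaar_ball_center, hV, ENNReal.ofReal_toReal measure_ball_lt_top.ne]
  have hsub : ball u R ⊆ closedBall u (2 * R) :=
    ball_subset_closedBall.trans (closedBall_subset_closedBall (by linarith))
  have hFB : ContinuousOn F B := hF.continuousOn.mono hsub
  set m := ⨍ y in B, F y with hm
  have hlev : ∀ t > A, volume (B ∩ F ⁻¹' Ioi (m + t)) ≤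
      ENNReal.ofReal (b₁ * Real.exp (-(2 * p * (t - A)))) := by
    intro t ht
    set E := B ∩ F ⁻¹' Ioi (m + t) with hE
    have hEo : IsOpen E := hFB.isOpen_inter_preimage isOpen_ball isOpen_Ioi
    have hEB : E ⊆ B := inter_subset_left
    rcases eq_or_ne (volume E) 0 with h0 | h0
    · rw [h0]; exact zero_le
    have hEt : volume E ≠ ⊤ := ((measure_mono hEB).trans_lt measure_ball_lt_top).ne
    set v := (volume E).toReal with hv
    have hv0 : 0 < v := ENNReal.toReal_pos h0 hEt
    have hvE : volume E = ENNReal.ofReal v := (ENNReal.ofReal_toReal hEt).symm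
    set σ := ProbabilityTheory.cond volume E with hσ
    have hσp : IsProbabilityMeasure σ :=
      ProbabilityTheory.cond_isProbabilityMeasure_of_finite h0 hEt
    -- Normalised volume on `E` gives a ball of radius `s` mass at most `(b₁ / v) s^n ≤ (K s)^n`.
    -- This is at most `K s` when `K s < 1`, and otherwise the linear bound is trivial.
    set K := max 1 ((b₁ / v) ^ (1 / (n : ℝ))) with hK
    have hK1 : 1 ≤ K := le_max_left _ _
    have hK0 : 0 < K := by linarith
    have hσE : ∀ᵐ z ∂σ, z ∈ E := by
      rw [hσ, ProbabilityTheory.cond]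
      exact Measure.ae_smul_measure (ae_restrict_mem hEo.measurableSet) _
    have hKn : b₁ / v ≤ K ^ n := by
      calc b₁ / v = ((b₁ / v) ^ (1 / (n : ℝ))) ^ n := by
            rw [← Real.rpow_natCast, ← Real.rpow_mul (by positivity), one_div_mul_cancel hn0.ne',
              Real.rpow_one]
        _ ≤ _ := by gcongr; exact le_max_right _ _
    have hσK : ∀ w, ∀ s > 0, σ (closedBall w s) ≤ ENNReal.ofReal (K * s) := by
      intro w s hs
      rcases le_or_gt 1 (K * s) with h1 | h1
      · exact prob_le_one.trans (by rw [← ENNReal.ofReal_one]; exact ENNReal.ofReal_le_ofReal h1)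
      · rw [hσ, ProbabilityTheory.cond_apply hEo.measurableSet]
        calc _ ≤ (volume E)⁻¹ * volume (closedBall w s) := by
              gcongr
              exact inter_subset_right
          _ = ENNReal.ofReal (v⁻¹ * (s ^ n * b₁)) := by
              rw [Measure.addHaar_closedBall _ _ hs.le, finrank_euclideanSpace, Fintype.card_fin,
                hb₁t, hvE, ← ENNReal.ofReal_inv_of_pos hv0, ← ENNReal.ofReal_mul (by positivity),
                ← ENNReal.ofReal_mul (by positivity)]
          _ ≤ _ := by
              apply ENNReal.ofReal_le_ofReal
              calc v⁻¹ * (s ^ n * b₁) = (b₁ / v) * s ^ n := by field_simp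
                _ ≤ K ^ n * s ^ n := by gcongr
                _ = (K * s) ^ n := (mul_pow _ _ _).symm
                _ ≤ (K * s) ^ 1 := pow_le_pow_of_le_one (by positivity) h1.le hn
                _ = K * s := pow_one _
    have hmain := hA F P u hF hJ σ K hK1 (hσE.mono fun z hz ↦ hEB hz) hσK
    have hFσ : Integrable F σ := by
      have h1 := hF.continuousOn.integrableOn_compact (μ := σ) (isCompact_closedBall u (2 * R))
      rwa [IntegrableOn, Measure.restrict_eq_self_of_ae_mem
        (hσE.mono fun z hz ↦ hsub (hEB hz))] at h1
    have hge : m + t ≤ ∫ z, F z ∂σ := by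
      have h1 : ∫ z, (m + t) ∂σ ≤ ∫ z, F z ∂σ :=
        integral_mono_ae (integrable_const _) hFσ (hσE.mono fun z hz ↦ le_of_lt hz.2)
      simpa using h1
    have h2 : t - A ≤ n / (2 * p) * Real.log K := by
      have := (le_abs_self _).trans hmain
      linarith
    -- Since `t > A`, the value `K = 1` is excluded, so the maximum is attained by the power of `b₁
    -- / v`.
    have hlogK : 0 < Real.log K := by
      by_contra h
      have : n / (2 * p) * Real.log K ≤ 0 :=
        mul_nonpos_of_nonneg_of_nonpos (by positivity) (not_lt.1 h)
      linarith
    have hKe : K = (b₁ / v) ^ (1 / (n : ℝ)) := by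
      rcases max_choice 1 ((b₁ / v) ^ (1 / (n : ℝ))) with h | h
      · rw [hK, h] at hlogK
        simp at hlogK
      · rw [hK, h]
    rw [hKe, Real.log_rpow (by positivity)] at h2
    have h3 : 2 * p * (t - A) ≤ Real.log (b₁ / v) := by
      have h4 : n / (2 * p) * (1 / n * Real.log (b₁ / v)) = Real.log (b₁ / v) / (2 * p) := by
        field_simp
      rw [h4, le_div_iff₀ (by positivity)] at h2
      linarith
    rw [hvE]
    apply ENNReal.ofReal_le_ofReal
    rw [Real.exp_neg, ← div_eq_mul_inv, le_div_iff₀ (Real.exp_pos _), ← le_div_iff₀' hv0]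
    calc _ ≤ Real.exp (Real.log (b₁ / v)) := Real.exp_le_exp.2 h3
      _ = _ := Real.exp_log (by positivity)
  have hWm : AEMeasurable (fun y ↦ Real.exp (p * (F y - m))) (volume.restrict B) := by
    have h1 : AEMeasurable F (volume.restrict B) := hFB.aemeasurable isOpen_ball.measurableSet
    fun_prop
  rw [lintegral_eq_lintegral_meas_lt _ (Filter.Eventually.of_forall fun y ↦ (Real.exp_pos _).le)
    hWm]
  set s₀ := Real.exp (p * A) with hs₀
  have hs₀0 : 0 < s₀ := Real.exp_pos _
  -- Below `s₀` the level sets are bounded by the whole ball; above it they decay like `s^(-2)`.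
  rw [← Ioc_union_Ioi_eq_Ioi hs₀0.le]
  refine (lintegral_union_le _ _ _).trans ?_
  have hV0 : 0 ≤ V := ENNReal.toReal_nonneg
  rw [show ((Real.toNNReal (V * s₀ + b₁ * s₀) : ℝ≥0) : ℝ≥0∞) = ENNReal.ofReal (V * s₀ + b₁ * s₀)
    from rfl, ENNReal.ofReal_add (by positivity) (by positivity)]
  refine add_le_add ?_ ?_
  · calc _ ≤ ∫⁻ s in Ioc 0 s₀, volume B := by
          refine lintegral_mono fun s ↦ (measure_mono (subset_univ _)).trans ?_
          rw [Measure.restrict_apply_univ]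
      _ = _ := by
          rw [setLIntegral_const, Real.volume_Ioc, sub_zero, hvol, ENNReal.ofReal_mul hV0]
  · calc _ ≤ ∫⁻ s in Ioi s₀, ENNReal.ofReal (b₁ * Real.exp (2 * p * A)) *
          ENNReal.ofReal (s ^ (-2 - 0 : ℝ)) := by
          refine setLIntegral_mono' measurableSet_Ioi fun s hs ↦ ?_
          have hs0 : 0 < s := hs₀0.trans hs
          have hAs : A < Real.log s / p := by
            rw [lt_div_iff₀ hp, mul_comm, Real.lt_log_iff_exp_lt hs0]
            exact hs
          have h1 := hlev _ hAs
          calc _ = volume (B ∩ F ⁻¹' Ioi (m + Real.log s / p)) := by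
                rw [Measure.restrict_apply' isOpen_ball.measurableSet, inter_comm]
                congr 2
                ext y
                simp only [mem_ofPred_eq, mem_preimage, mem_Ioi]
                rw [← Real.log_lt_iff_lt_exp hs0, ← lt_sub_iff_add_lt', div_lt_iff₀' hp]
            _ ≤ _ := h1
            _ = _ := by
                rw [← ENNReal.ofReal_mul (by positivity), sub_zero, Real.rpow_def_of_pos hs0,
                  mul_assoc b₁, ← Real.exp_add]
                congr 3
                field_simp
                ring
      _ ≤ ENNReal.ofReal (b₁ * Real.exp (2 * p * A)) * ENNReal.ofReal (s₀ ^ (-1 - 0 : ℝ)) := by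
          rw [lintegral_const_mul' _ _ ENNReal.ofReal_ne_top, restrict_Ioi_eq_restrict_Ici]
          gcongr
          exact lintegral_Ici_rpow_le hs₀0 le_rfl
      _ = _ := by
          rw [← ENNReal.ofReal_mul (by positivity), sub_zero, Real.rpow_neg_one, hs₀, mul_assoc,
            ← Real.exp_neg, ← Real.exp_add]
          congr 3
          ring

/-- The average over the points `w` of `D` of the integral of `H` along the segment from `a`
to `w` is controlled by an `L^p` norm of `H`. -/
lemma lintegral_segment_le {H : EuclideanSpace ℝ (Fin n) → ℝ≥0∞} (hn : 1 ≤ n) (hH : Measurable H)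
    {B D : Set (EuclideanSpace ℝ (Fin n))} (hB : Convex ℝ B) (hBm : MeasurableSet B)
    (hDm : MeasurableSet D) (hDB : D ⊆ B) {a : EuclideanSpace ℝ (Fin n)} (ha : a ∈ B) {α : ℝ}
    (hα₀ : 0 < α) (hα₁ : α < 1) :
    ∫⁻ w in D, ∫⁻ t in Ioo (0 : ℝ) 1, H (a + t • (w - a)) ≤
      volume D ^ (1 - (1 - α) / n) * (∫⁻ w in B, H w ^ (n / (1 - α))) ^ ((1 - α) / n) *
        ENNReal.ofReal α⁻¹ := by
  have hn0 : (1 : ℝ) ≤ n := by exact_mod_cast hn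
  have h1α : 0 < 1 - α := by linarith
  set p := n / (1 - α) with hp
  have hp1 : 1 ≤ p := by rw [hp, le_div_iff₀ h1α]; linarith
  have hpi : (1 - α) / n = 1 / p := by rw [hp, one_div_div]
  have hm : Measurable (Function.uncurry fun (w : EuclideanSpace ℝ (Fin n)) (t : ℝ) ↦
      H (a + t • (w - a))) := by
    simp only [Function.uncurry_def]
    exact hH.comp (by fun_prop)
  rw [lintegral_lintegral_swap hm.aemeasurable]
  set Q := ∫⁻ w in B, H w ^ p with hQ
  -- At fixed time, Hölder and the homothety with centre `a` cost `t^(-n/p) = t^(α-1)`, which is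
  -- integrable at `0` because `α > 0`.
  have hfix : ∀ t ∈ Ioo (0 : ℝ) 1, ∫⁻ w in D, H (a + t • (w - a)) ≤
      volume D ^ (1 - 1 / p) * Q ^ (1 / p) * ENNReal.ofReal (t ^ (α - 1)) := by
    intro t ht
    have ht0 := ht.1
    have h1 := eLpNorm'_le_eLpNorm'_mul_rpow_measure_univ (μ := volume.restrict D)
      (f := fun w ↦ H (a + t • (w - a))) (p := 1) (q := p) one_pos hp1
      (hH.comp (by fun_prop)).aestronglyMeasurable
    simp only [eLpNorm', enorm_eq_self, ENNReal.rpow_one, div_one,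
      Measure.restrict_apply_univ] at h1
    have h2 : ∫⁻ w in D, H (a + t • (w - a)) ^ p ≤ ENNReal.ofReal ((t ^ n)⁻¹) * Q := by
      calc _ ≤ ∫⁻ w, B.indicator (fun w ↦ H w ^ p) (a + t • (w - a)) := by
            rw [← lintegral_indicator hDm]
            refine lintegral_mono fun w ↦ ?_
            by_cases hw : w ∈ D
            · have : a + t • (w - a) ∈ B :=
                hB.add_smul_sub_mem ha (hDB hw) ⟨ht.1.le, ht.2.le⟩
              rw [indicator_of_mem hw, indicator_of_mem this]
            · rw [indicator_of_notMem hw]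
              exact zero_le
        _ = _ := by rw [lintegral_comp_homothety a ht0, lintegral_indicator hBm]
    refine h1.trans ?_
    calc _ ≤ (ENNReal.ofReal ((t ^ n)⁻¹) * Q) ^ (1 / p) * volume D ^ (1 - 1 / p) := by gcongr
      _ = _ := by
          rw [ENNReal.mul_rpow_of_nonneg _ _ (by positivity),
            ENNReal.ofReal_rpow_of_pos (by positivity)]
          have : ((t ^ n)⁻¹) ^ (1 / p) = t ^ (α - 1) := by
            rw [← Real.rpow_natCast, ← Real.rpow_neg ht0.le, ← Real.rpow_mul ht0.le, ← hpi]
            congr 1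
            field_simp
            ring
          rw [this]
          ring
  rw [hpi]
  calc _ ≤ ∫⁻ t in Ioo (0 : ℝ) 1,
        volume D ^ (1 - 1 / p) * Q ^ (1 / p) * ENNReal.ofReal (t ^ (α - 1)) :=
        setLIntegral_mono' measurableSet_Ioo hfix
    _ = _ := by rw [lintegral_const_mul _ (by fun_prop), lintegral_Ioo_rpow_sub_one hα₀]

end Oscillation

/-! ### Norms and lengths of the metric, and charts with bounded distortion -/

section Basic

attribute [local instance] normedAddCommGroupTangentSpaceVectorSpace
attribute [local instance] normedSpaceTangentSpaceVectorSpace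

variable {n : ℕ} {M : Type*} [TopologicalSpace M]
  [ChartedSpace (EuclideanSpace ℝ (Fin n)) M]

/-- The norm of the tangent vector `v` with respect to `g`. -/
def gnorm (g : RMetric n M) (x : M) (v : TangentSpace (𝓡 n) x) : ℝ := √(g.inner x v v)

lemma gnorm_nonneg (g : RMetric n M) (x : M) (v : TangentSpace (𝓡 n) x) : 0 ≤ gnorm g x v :=
  Real.sqrt_nonneg _

lemma gnorm_conformal (g : RMetric n M) (f : M → ℝ) (x : M) (v : TangentSpace (𝓡 n) x) :
    gnorm (conformal g f) x v = Real.exp (f x) * gnorm g x v := by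
  have h : (conformal g f).inner x v v = Real.exp (f x) ^ 2 * g.inner x v v := by
    have : Real.exp (2 * f x) = Real.exp (f x) ^ 2 := by rw [← Real.exp_nat_mul]; norm_num
    rw [← this]
    rfl
  rw [gnorm, h, Real.sqrt_mul (by positivity), Real.sqrt_sq (Real.exp_pos _).le, gnorm]

lemma norm_eq_gnorm (g : RMetric n M) (x : M) (v : TangentSpace (𝓡 n) x) :
    letI : RiemannianBundle (fun x : M ↦ TangentSpace (𝓡 n) x) := ⟨g⟩
    ‖v‖ = gnorm g x v := by
  let : RiemannianBundle (fun x : M ↦ TangentSpace (𝓡 n) x) := ⟨g⟩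
  exact norm_eq_sqrt_real_inner v

lemma enorm_eq_gnorm (g : RMetric n M) (x : M) (v : TangentSpace (𝓡 n) x) :
    letI : RiemannianBundle (fun x : M ↦ TangentSpace (𝓡 n) x) := ⟨g⟩
    ‖v‖ₑ = ENNReal.ofReal (gnorm g x v) := by
  let : RiemannianBundle (fun x : M ↦ TangentSpace (𝓡 n) x) := ⟨g⟩
  rw [← norm_eq_gnorm, ofReal_norm]

lemma abs_apply_le_covectorNorm (g : RMetric n M) (x : M) (θ : TangentSpace (𝓡 n) x →L[ℝ] ℝ)
    (v : TangentSpace (𝓡 n) x) : |θ v| ≤ covectorNorm g x θ * gnorm g x v := by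
  let : RiemannianBundle (fun x : M ↦ TangentSpace (𝓡 n) x) := ⟨g⟩
  rw [← norm_eq_gnorm]
  exact θ.le_opNorm v

lemma covectorNorm_nonneg (g : RMetric n M) (x : M) (θ : TangentSpace (𝓡 n) x →L[ℝ] ℝ) :
    0 ≤ covectorNorm g x θ := by
  let : RiemannianBundle (fun x : M ↦ TangentSpace (𝓡 n) x) := ⟨g⟩
  exact norm_nonneg θ

lemma rdist_le_lintegral (g : RMetric n M) {γ : ℝ → M}
    (hγ : ContMDiffOn 𝓘(ℝ) (𝓡 n) 1 γ (Icc 0 1)) :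
    rdist g (γ 0) (γ 1) ≤
      ∫⁻ t in Ioo (0 : ℝ) 1, ENNReal.ofReal (gnorm g (γ t) (mfderiv 𝓘(ℝ) (𝓡 n) γ t 1)) := by
  let : RiemannianBundle (fun x : M ↦ TangentSpace (𝓡 n) x) := ⟨g⟩
  have h := riemannianEDist_le_pathELength hγ rfl rfl zero_le_one
  rw [pathELength_eq_lintegral_mfderiv_Ioo] at h
  refine h.trans (le_of_eq (lintegral_congr fun t ↦ ?_))
  exact enorm_eq_gnorm g _ _

lemma exists_path_of_rdist_lt (g : RMetric n M) {x y : M} {r : ℝ≥0∞} (h : rdist g x y < r) :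
    ∃ γ : ℝ → M, γ 0 = x ∧ γ 1 = y ∧ ContMDiff 𝓘(ℝ) (𝓡 n) 1 γ ∧
      ∫⁻ t in Ioo (0 : ℝ) 1, ENNReal.ofReal (gnorm g (γ t) (mfderiv 𝓘(ℝ) (𝓡 n) γ t 1)) < r := by
  let : RiemannianBundle (fun x : M ↦ TangentSpace (𝓡 n) x) := ⟨g⟩
  obtain ⟨γ, h0, h1, hγ, hlt, -, -⟩ :=
    exists_lt_locally_constant_of_riemannianEDist_lt (I := 𝓡 n) h zero_lt_one
  refine ⟨γ, h0, h1, hγ, ?_⟩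
  rw [pathELength_eq_lintegral_mfderiv_Ioo] at hlt
  refine lt_of_eq_of_lt (lintegral_congr fun t ↦ ?_) hlt
  exact (enorm_eq_gnorm g _ _).symm

lemma rdist_self (g : RMetric n M) (x : M) : rdist g x x = 0 := by
  let : RiemannianBundle (fun x : M ↦ TangentSpace (𝓡 n) x) := ⟨g⟩
  exact riemannianEDist_self

lemma rdist_comm (g : RMetric n M) (x y : M) : rdist g x y = rdist g y x := by
  let : RiemannianBundle (fun x : M ↦ TangentSpace (𝓡 n) x) := ⟨g⟩
  exact riemannianEDist_comm

lemma rdist_triangle (g : RMetric n M) (x y z : M) : rdist g x z ≤ rdist g x y + rdist g y z := by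
  let : RiemannianBundle (fun x : M ↦ TangentSpace (𝓡 n) x) := ⟨g⟩
  exact riemannianEDist_triangle

variable [IsManifold (𝓡 n) ∞ M]

lemma mdifferentiableAt_extChartAt_symm' {c : M} {u : EuclideanSpace ℝ (Fin n)}
    (hu : u ∈ (extChartAt (𝓡 n) c).target) :
    MDifferentiableAt (𝓡 n) (𝓡 n) (extChartAt (𝓡 n) c).symm u :=
  ((contMDiffOn_extChartAt_symm (n := ∞) c).contMDiffAt
    ((isOpen_extChartAt_target c).mem_nhds hu)).mdifferentiableAt (by simp)

lemma mdifferentiableAt_extChartAt' {c x : M} (hx : x ∈ (extChartAt (𝓡 n) c).source) :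
    MDifferentiableAt (𝓡 n) (𝓡 n) (extChartAt (𝓡 n) c) x :=
  mdifferentiableAt_extChartAt (by simpa using hx)

lemma mfderiv_extChartAt_coordVec {c : M} {u : EuclideanSpace ℝ (Fin n)}
    (hu : u ∈ (extChartAt (𝓡 n) c).target) (v : EuclideanSpace ℝ (Fin n)) :
    mfderiv (𝓡 n) (𝓡 n) (extChartAt (𝓡 n) c) ((extChartAt (𝓡 n) c).symm u) (coordVec c v u) =
      v := by
  have h := mfderiv_extChartAt_comp_mfderivWithin_extChartAt_symm (I := 𝓡 n) hu
  have h2 := congrArg (fun L ↦ L v) h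
  rw [ModelWithCorners.range_eq_univ, mfderivWithin_univ] at h2
  exact h2

lemma coordVec_mfderiv_extChartAt {c : M} {u : EuclideanSpace ℝ (Fin n)}
    (hu : u ∈ (extChartAt (𝓡 n) c).target)
    (w : TangentSpace (𝓡 n) ((extChartAt (𝓡 n) c).symm u)) :
    coordVec c (mfderiv (𝓡 n) (𝓡 n) (extChartAt (𝓡 n) c) ((extChartAt (𝓡 n) c).symm u) w) u =
      w := by
  have h := mfderivWithin_extChartAt_symm_comp_mfderiv_extChartAt (I := 𝓡 n) hu
  have h2 := congrArg (fun L ↦ L w) h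
  rw [ModelWithCorners.range_eq_univ, mfderivWithin_univ] at h2
  exact h2

/-- On the closed ball of radius `2 * R` around the centre of the chart at `c`, the metric `g` is
comparable to the Euclidean one, with factor `l`. -/
structure IsGoodChart (g : RMetric n M) (c : M) (R l : ℝ) : Prop where
  pos : 0 < R
  one_le : 1 ≤ l
  subset : closedBall (extChartAt (𝓡 n) c c) (2 * R) ⊆ (extChartAt (𝓡 n) c).target
  gnorm_le : ∀ u ∈ closedBall (extChartAt (𝓡 n) c c) (2 * R), ∀ v : EuclideanSpace ℝ (Fin n),
    gnorm g _ (coordVec c v u) ≤ l * ‖v‖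
  le_gnorm : ∀ u ∈ closedBall (extChartAt (𝓡 n) c c) (2 * R), ∀ v : EuclideanSpace ℝ (Fin n),
    ‖v‖ ≤ l * gnorm g _ (coordVec c v u)

/-- Around every point the chart distorts lengths by a bounded factor. -/
lemma exists_isGoodChart
    (g₀ : ContMDiffRiemannianMetric (𝓡 n) ∞ (EuclideanSpace ℝ (Fin n))
      (fun x : M ↦ TangentSpace (𝓡 n) x)) (c : M) :
    ∃ R l : ℝ, IsGoodChart g₀.toRiemannianMetric c R l := by
  let : RiemannianBundle (fun x : M ↦ TangentSpace (𝓡 n) x) := ⟨g₀.toRiemannianMetric⟩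
  have : IsManifold (𝓡 n) 1 M := IsManifold.of_le (n := ∞) (by simp)
  have : IsContinuousRiemannianBundle (EuclideanSpace ℝ (Fin n))
      (fun x : M ↦ TangentSpace (𝓡 n) x) := ⟨g₀.inner, g₀.contMDiff.continuous, fun _ _ _ ↦ rfl⟩
  obtain ⟨C₁, hC₁, h₁⟩ := eventually_norm_mfderiv_extChartAt_lt (𝓡 n) c
  obtain ⟨C₂, hC₂, h₂⟩ := eventually_norm_mfderivWithin_symm_extChartAt_lt (𝓡 n) c
  rw [ModelWithCorners.range_eq_univ, nhdsWithin_univ] at h₂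
  have hsymm : Filter.Tendsto (extChartAt (𝓡 n) c).symm (𝓝 (extChartAt (𝓡 n) c c)) (𝓝 c) := by
    have := continuousAt_extChartAt_symm (I := 𝓡 n) c
    rwa [ContinuousAt, extChartAt_to_inv] at this
  have h₃ := (hsymm.eventually h₁).and (h₂.and (extChartAt_target_mem_nhds (I := 𝓡 n) c))
  obtain ⟨R, hR, hball⟩ := Metric.eventually_nhds_iff_ball.1 h₃
  have hsub : closedBall (extChartAt (𝓡 n) c c) (2 * (R / 4)) ⊆ ball (extChartAt (𝓡 n) c c) R :=
    closedBall_subset_ball (by linarith)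
  refine ⟨R / 4, max 1 (max C₁ C₂), by positivity, le_max_left _ _,
    fun u hu ↦ (hball u (hsub hu)).2.2, fun u hu v ↦ ?_, fun u hu v ↦ ?_⟩
  · obtain ⟨-, h, -⟩ := hball u (hsub hu)
    rw [← norm_eq_gnorm]
    rw [mfderivWithin_univ] at h
    refine (ContinuousLinearMap.le_of_opNorm_le _ h.le v).trans ?_
    exact mul_le_mul_of_nonneg_right ((le_max_right C₁ C₂).trans (le_max_right _ _)) (norm_nonneg _)
  · obtain ⟨h, -, hut⟩ := hball u (hsub hu)
    rw [← norm_eq_gnorm]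
    have h4 := ContinuousLinearMap.le_of_opNorm_le _ h.le (coordVec c v u)
    have h5 : ‖v‖ ≤ C₁ * ‖coordVec c v u‖ := le_trans (le_of_eq
      (congrArg (fun z : EuclideanSpace ℝ (Fin n) ↦ ‖z‖)
        (mfderiv_extChartAt_coordVec hut v).symm)) h4
    refine h5.trans ?_
    exact mul_le_mul_of_nonneg_right ((le_max_left C₁ C₂).trans (le_max_right _ _)) (norm_nonneg _)

end Basic

/-! ### Lengths of segments in a chart and radial sections of paths -/

section Paths

variable {n : ℕ} {M : Type*} [TopologicalSpace M]
  [ChartedSpace (EuclideanSpace ℝ (Fin n)) M] [IsManifold (𝓡 n) ∞ M]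

/-- The coordinate segment is an admissible curve, and the chart stretches its velocity by at most
`l`. -/
lemma IsGoodChart.rdist_conformal_le {g : RMetric n M} {c : M} {R l : ℝ}
    (hc : IsGoodChart g c R l) (f : M → ℝ) {a b : EuclideanSpace ℝ (Fin n)}
    (ha : a ∈ closedBall (extChartAt (𝓡 n) c c) (2 * R))
    (hb : b ∈ closedBall (extChartAt (𝓡 n) c c) (2 * R)) :
    rdist (conformal g f) ((extChartAt (𝓡 n) c).symm a) ((extChartAt (𝓡 n) c).symm b) ≤
      ENNReal.ofReal (l * ‖b - a‖) * ∫⁻ t in Ioo (0 : ℝ) 1,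
        ENNReal.ofReal (Real.exp (f ((extChartAt (𝓡 n) c).symm (a + t • (b - a))))) := by
  set s : ℝ → EuclideanSpace ℝ (Fin n) := fun t ↦ a + t • (b - a) with hs
  have hsd : ∀ t, HasDerivAt s (b - a) t := fun t ↦ by
    simpa [hs] using ((hasDerivAt_id t).smul_const (b - a)).const_add a
  have hsmem : ∀ t ∈ Icc (0 : ℝ) 1, s t ∈ closedBall (extChartAt (𝓡 n) c c) (2 * R) :=
    fun t ht ↦ (convex_closedBall _ _).add_smul_sub_mem ha hb ht
  have hsc : ContDiff ℝ 1 s := by fun_prop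
  have hγ : ContMDiffOn 𝓘(ℝ) (𝓡 n) 1 ((extChartAt (𝓡 n) c).symm ∘ s) (Icc 0 1) := by
    have h1 : ContMDiffOn (𝓡 n) (𝓡 n) 1 (extChartAt (𝓡 n) c).symm (extChartAt (𝓡 n) c).target :=
      (contMDiffOn_extChartAt_symm (n := ∞) c).of_le (by simp)
    exact h1.comp hsc.contMDiff.contMDiffOn fun t ht ↦ hc.subset (hsmem t ht)
  have h := rdist_le_lintegral (conformal g f) hγ
  have e0 : s 0 = a := by simp [hs]
  have e1 : s 1 = b := by simp [hs]
  simp only [Function.comp_apply, e0, e1] at h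
  refine h.trans ?_
  rw [← lintegral_const_mul' _ _ ENNReal.ofReal_ne_top]
  refine setLIntegral_mono' measurableSet_Ioo fun t ht ↦ ?_
  have ht' := hsmem t ⟨ht.1.le, ht.2.le⟩
  have hd : mfderiv 𝓘(ℝ) (𝓡 n) ((extChartAt (𝓡 n) c).symm ∘ s) t 1 = coordVec c (b - a) (s t) := by
    have h2 : MDifferentiableAt 𝓘(ℝ) (𝓡 n) s t :=
      (hsd t).differentiableAt.mdifferentiableAt
    rw [mfderiv_comp t (mdifferentiableAt_extChartAt_symm' (hc.subset ht')) h2]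
    have h3 : mfderiv 𝓘(ℝ) (𝓡 n) s t = fderiv ℝ s t := mfderiv_eq_fderiv
    have h4 : mfderiv 𝓘(ℝ) (𝓡 n) s t 1 = b - a := by
      rw [h3, (hsd t).hasFDerivAt.fderiv]
      change ContinuousLinearMap.toSpanSingleton ℝ (b - a) (1 : ℝ) = b - a
      simp
    exact congrArg (mfderiv (𝓡 n) (𝓡 n) (extChartAt (𝓡 n) c).symm (s t)) h4
  rw [hd, ← ENNReal.ofReal_mul (mul_nonneg (by linarith [hc.one_le]) (norm_nonneg _))]
  apply ENNReal.ofReal_le_ofReal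
  rw [gnorm_conformal, mul_comm]
  gcongr
  exact hc.gnorm_le _ ht' _

/-- The components of the tangent vector `w` in the chart at `c`. -/
def chartVec (c x : M) (w : TangentSpace (𝓡 n) x) : EuclideanSpace ℝ (Fin n) :=
  mfderiv (𝓡 n) (𝓡 n) (extChartAt (𝓡 n) c) x w

lemma IsGoodChart.norm_chartVec_le {g : RMetric n M} {c : M} {R l : ℝ}
    (hc : IsGoodChart g c R l) {x : M} (hx : x ∈ (extChartAt (𝓡 n) c).source)
    (hxb : extChartAt (𝓡 n) c x ∈ closedBall (extChartAt (𝓡 n) c c) (2 * R))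
    (w : TangentSpace (𝓡 n) x) :
    ‖chartVec c x w‖ ≤ l * gnorm g x w := by
  obtain ⟨u, hu, rfl⟩ : ∃ u ∈ closedBall (extChartAt (𝓡 n) c c) (2 * R),
      (extChartAt (𝓡 n) c).symm u = x := ⟨_, hxb, (extChartAt (𝓡 n) c).left_inv hx⟩
  have h := hc.le_gnorm u hu (chartVec c _ w)
  rwa [show coordVec c (chartVec c _ w) u = w from
    coordVec_mfderiv_extChartAt (hc.subset hu) w] at h

lemma hasDerivAt_extChartAt_comp {c : M} {γ : ℝ → M} (hγ : ContMDiff 𝓘(ℝ) (𝓡 n) 1 γ) {t : ℝ}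
    (ht : γ t ∈ (extChartAt (𝓡 n) c).source) :
    HasDerivAt (fun t ↦ extChartAt (𝓡 n) c (γ t))
      (chartVec c (γ t) (mfderiv 𝓘(ℝ) (𝓡 n) γ t 1)) t := by
  have h1 := (mdifferentiableAt_extChartAt' ht).hasMFDerivAt.comp t
    ((hγ t).mdifferentiableAt one_ne_zero).hasMFDerivAt
  obtain ⟨L, hL, h2⟩ : ∃ L : ℝ →L[ℝ] EuclideanSpace ℝ (Fin n),
      L 1 = chartVec c (γ t) (mfderiv 𝓘(ℝ) (𝓡 n) γ t 1) ∧
      HasFDerivAt (fun t ↦ extChartAt (𝓡 n) c (γ t)) L t := ⟨_, rfl, h1.hasFDerivAt⟩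
  exact hL ▸ h2.hasDerivAt

/-- A path from `x` leaving a ball of radius `ρ` in the chart at `c` passes through points at every
distance `s < ρ`; the integral over `s` of the conformal factor at these points is bounded by the
length of the path. -/
lemma IsGoodChart.exists_radial_section [T2Space M] {g : RMetric n M} {c : M} {R l : ℝ}
    (hc : IsGoodChart g c R l) {f : M → ℝ} {x : M}
    (hx : x ∈ (extChartAt (𝓡 n) c).source) {ρ : ℝ}
    (hsub : closedBall (extChartAt (𝓡 n) c x) ρ ⊆ closedBall (extChartAt (𝓡 n) c c) (2 * R))
    {y : M} (hy : ¬ (y ∈ (extChartAt (𝓡 n) c).source ∧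
      extChartAt (𝓡 n) c y ∈ ball (extChartAt (𝓡 n) c x) ρ))
    {r : ℝ≥0∞} (hr : rdist (conformal g f) x y < r) :
    ∃ z : ℝ → EuclideanSpace ℝ (Fin n), AEMeasurable z (volume.restrict (Ioo 0 ρ)) ∧
      (∀ s ∈ Ioo 0 ρ, dist (z s) (extChartAt (𝓡 n) c x) = s) ∧
      ∫⁻ s in Ioo 0 ρ, ENNReal.ofReal (Real.exp (f ((extChartAt (𝓡 n) c).symm (z s)))) ≤
        ENNReal.ofReal l * r := by
  obtain ⟨γ, hγ0, hγ1, hγ, hlen⟩ := exists_path_of_rdist_lt _ hr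
  set φ := extChartAt (𝓡 n) c with hφ
  set p := φ x with hp
  set h : ℝ → EuclideanSpace ℝ (Fin n) := fun t ↦ φ (γ t) with hh
  have hγc : Continuous γ := hγ.continuous
  set U : ℝ → Set M := fun s ↦ φ.source ∩ φ ⁻¹' ball p s with hU
  have hUo : ∀ s, IsOpen (U s) := fun s ↦
    (continuousOn_extChartAt c).isOpen_inter_preimage (isOpen_extChartAt_source c) isOpen_ball
  set T : ℝ → Set ℝ := fun s ↦ Icc 0 1 ∩ γ ⁻¹' (U s)ᶜ with hT
  have hTc : ∀ s, IsCompact (T s) := fun s ↦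
    isCompact_Icc.inter_right ((hUo s).isClosed_compl.preimage hγc)
  have hT1 : ∀ s ∈ Ioo 0 ρ, (1 : ℝ) ∈ T s := by
    intro s hs
    refine ⟨⟨zero_le_one, le_rfl⟩, fun h1 ↦ hy ?_⟩
    rw [hγ1] at h1
    exact ⟨h1.1, ball_subset_ball hs.2.le h1.2⟩
  -- The first time the path is outside the coordinate ball of radius `s`. Leaving the chart domain
  -- also counts as being outside.
  set τ : ℝ → ℝ := fun s ↦ sInf (T s) with hτ
  have hτT : ∀ s ∈ Ioo 0 ρ, τ s ∈ T s := fun s hs ↦ (hTc s).sInf_mem ⟨1, hT1 s hs⟩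
  have hτlt : ∀ s, ∀ t ∈ Icc (0 : ℝ) 1, t < τ s → γ t ∈ U s := by
    intro s t ht hts
    by_contra hcon
    exact absurd (csInf_le (hTc s).bddBelow ⟨ht, hcon⟩) (not_le.2 hts)
  have hτpos : ∀ s ∈ Ioo 0 ρ, 0 < τ s := by
    intro s hs
    rcases (hτT s hs).1.1.eq_or_lt with h0 | h0
    · exfalso
      apply (hτT s hs).2
      rw [← h0, hγ0]
      exact ⟨hx, mem_ball_self hs.1⟩
    · exact h0
  have hτmem : ∀ s ∈ Ioo 0 ρ, γ (τ s) ∈ φ.source ∧ dist (h (τ s)) p = s := by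
    intro s hs
    -- Compactness and the Hausdorff property close this set, so at time `τ s` the path is still in
    -- the chart domain: it exits through the sphere of radius `s`, not by jumping out of the chart.
    have hcl : IsClosed (φ.symm '' closedBall p s) := by
      refine ((isCompact_closedBall p s).image_of_continuousOn ?_).isClosed
      refine (continuousOn_extChartAt_symm c).mono ?_
      exact (closedBall_subset_closedBall hs.2.le).trans (hsub.trans hc.subset)
    have hin : ∀ t ∈ Ico 0 (τ s), γ t ∈ φ.symm '' closedBall p s := by
      intro t ht
      have h1 := hτlt s t ⟨ht.1, ht.2.le.trans (hτT s hs).1.2⟩ ht.2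
      exact ⟨φ (γ t), ball_subset_closedBall h1.2, φ.left_inv h1.1⟩
    have h2 : τ s ∈ closure (Ico 0 (τ s)) := by
      rw [closure_Ico (hτpos s hs).ne]
      exact ⟨(hτpos s hs).le, le_rfl⟩
    have h3 : γ (τ s) ∈ φ.symm '' closedBall p s := by
      have h4 : closure (Ico 0 (τ s)) ⊆ γ ⁻¹' (φ.symm '' closedBall p s) :=
        closure_minimal hin (hcl.preimage hγc)
      exact h4 h2
    obtain ⟨u, hu, hux⟩ := h3
    have hut : u ∈ φ.target :=
      hc.subset (hsub (closedBall_subset_closedBall hs.2.le hu))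
    have hsrc : γ (τ s) ∈ φ.source := hux ▸ φ.map_target hut
    have hhu : h (τ s) = u := by
      simp only [hh, ← hux]
      exact φ.right_inv hut
    refine ⟨hsrc, le_antisymm (by rw [hhu]; exact hu) ?_⟩
    by_contra hlt
    exact (hτT s hs).2 ⟨hsrc, not_le.1 hlt⟩
  have hmono : MonotoneOn τ (Ioo 0 ρ) := by
    intro s hs s' hs' hss
    refine csInf_le_csInf (hTc s).bddBelow ⟨1, hT1 s' hs'⟩ ?_
    rintro t ⟨ht, htU⟩
    exact ⟨ht, fun h1 ↦ htU ⟨h1.1, ball_subset_ball hss h1.2⟩⟩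
  set k : ℝ → ℝ := fun t ↦ dist (h t) p with hk
  have hkτ : ∀ s ∈ Ioo 0 ρ, k (τ s) = s := fun s hs ↦ (hτmem s hs).2
  -- On the first-exit times the radial coordinate `k` is injective with inverse `τ`. Monotonicity
  -- of `τ` makes `A` measurable, so the integral over radii can be changed into one over times,
  -- although `k` need not be monotone along the path.
  set A := τ '' Ioo 0 ρ with hA
  have hAm : MeasurableSet A := measurableSet_Ioo.image_of_monotoneOn hmono
  have hkA : k '' A = Ioo 0 ρ := by
    rw [hA, image_image]
    ext s
    constructor
    · rintro ⟨s', hs', rfl⟩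
      change k (τ s') ∈ Ioo 0 ρ
      rwa [hkτ s' hs']
    · exact fun hs ↦ ⟨s, hs, hkτ s hs⟩
  have hinj : InjOn k A := by
    rintro _ ⟨s, hs, rfl⟩ _ ⟨s', hs', rfl⟩ he
    rw [hkτ s hs, hkτ s' hs'] at he
    rw [he]
  have hAsub : A ⊆ Ioc 0 1 := by
    rintro _ ⟨s, hs, rfl⟩
    exact ⟨hτpos s hs, (hτT s hs).1.2⟩
  -- the derivative of the radial coordinate
  have hder : ∀ t ∈ A, ∃ k' : ℝ, HasDerivAt k k' t ∧
      |k'| ≤ l * gnorm g (γ t) (mfderiv 𝓘(ℝ) (𝓡 n) γ t 1) := by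
    rintro _ ⟨s, hs, rfl⟩
    obtain ⟨hsrc, hdist⟩ := hτmem s hs
    have hd := hasDerivAt_extChartAt_comp hγ hsrc
    have hne : h (τ s) - p ≠ 0 := by
      rw [← norm_pos_iff, ← dist_eq_norm, hdist]
      exact hs.1
    have hN : DifferentiableAt ℝ (fun w : EuclideanSpace ℝ (Fin n) ↦ ‖w‖) (h (τ s) - p) :=
      differentiableAt_id.norm ℝ hne
    have hk1 := hN.hasFDerivAt.comp_hasDerivAt (τ s) (hd.sub_const p)
    refine ⟨_, hk1.congr_of_eventuallyEq (Filter.Eventually.of_forall fun t ↦ dist_eq_norm _ _),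
      ?_⟩
    refine le_trans ?_ (hc.norm_chartVec_le hsrc ?_ _)
    · have h1 := norm_fderiv_le_of_lipschitz ℝ (x₀ := h (τ s) - p)
        (lipschitzWith_one_norm (E := EuclideanSpace ℝ (Fin n)))
      have h2 := ContinuousLinearMap.le_of_opNorm_le _ h1
        (chartVec c (γ (τ s)) (mfderiv 𝓘(ℝ) (𝓡 n) γ (τ s) 1))
      simpa using h2
    · exact hsub (closedBall_subset_closedBall hs.2.le (mem_closedBall.2 hdist.le))
  choose! k' hk' hk'le using hder
  refine ⟨fun s ↦ h (τ s), ?_, fun s hs ↦ hkτ s hs, ?_⟩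
  · set O := γ ⁻¹' φ.source with hO
    have hOo : IsOpen O := (isOpen_extChartAt_source c).preimage hγc
    have hhO : ContinuousOn h O :=
      (continuousOn_extChartAt c).comp hγc.continuousOn fun t ht ↦ ht
    -- `h` is continuous only while the path is in the chart domain, so it is set to zero elsewhere.
    have hm1 : Measurable (O.indicator h) := by
      classical
      rw [← piecewise_eq_indicator]
      exact hhO.measurable_piecewise continuousOn_const hOo.measurableSet
    have hm2 : AEMeasurable τ (volume.restrict (Ioo 0 ρ)) :=
      aemeasurable_restrict_of_monotoneOn measurableSet_Ioo hmono
    refine (hm1.comp_aemeasurable hm2).congr ?_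
    filter_upwards [ae_restrict_mem measurableSet_Ioo] with s hs
    exact indicator_of_mem (s := O) (hτmem s hs).1 h
  · calc ∫⁻ s in Ioo 0 ρ, ENNReal.ofReal (Real.exp (f (φ.symm (h (τ s)))))
        = ∫⁻ s in k '' A, ENNReal.ofReal (Real.exp (f (γ (τ s)))) := by
          rw [hkA]
          refine setLIntegral_congr_fun measurableSet_Ioo fun s hs ↦ ?_
          simp only [hh]
          rw [φ.left_inv (hτmem s hs).1]
      _ = ∫⁻ t in A, ENNReal.ofReal |k' t| * ENNReal.ofReal (Real.exp (f (γ (τ (k t))))) :=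
          lintegral_image_eq_lintegral_abs_deriv_mul hAm
            (fun t ht ↦ (hk' t ht).hasDerivWithinAt) hinj _
      _ ≤ ∫⁻ t in A, ENNReal.ofReal l *
            ENNReal.ofReal (gnorm (conformal g f) (γ t) (mfderiv 𝓘(ℝ) (𝓡 n) γ t 1)) := by
          refine setLIntegral_mono' hAm fun t ht ↦ ?_
          have hτk : τ (k t) = t := by
            obtain ⟨s, hs, rfl⟩ := ht
            rw [hkτ s hs]
          rw [hτk, ← ENNReal.ofReal_mul (abs_nonneg _),
            ← ENNReal.ofReal_mul (by linarith [hc.one_le]), gnorm_conformal]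
          apply ENNReal.ofReal_le_ofReal
          calc _ ≤ l * gnorm g (γ t) (mfderiv 𝓘(ℝ) (𝓡 n) γ t 1) * Real.exp (f (γ t)) := by
                gcongr
                exact hk'le t ht
            _ = _ := by ring
      _ ≤ ENNReal.ofReal l * ∫⁻ t in Ioc 0 1,
            ENNReal.ofReal (gnorm (conformal g f) (γ t) (mfderiv 𝓘(ℝ) (𝓡 n) γ t 1)) := by
          rw [lintegral_const_mul' _ _ ENNReal.ofReal_ne_top]
          gcongr
      _ ≤ ENNReal.ofReal l * r := by
          rw [← restrict_Ioo_eq_restrict_Ioc]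
          gcongr

end Paths

/-! ### The Riemannian volume in charts -/

section Volume

variable {n : ℕ} {M : Type*} [TopologicalSpace M]
  [ChartedSpace (EuclideanSpace ℝ (Fin n)) M]

lemma coordVec_add (c : M) (v w u : EuclideanSpace ℝ (Fin n)) :
    coordVec c (v + w) u = coordVec c v u + coordVec c w u :=
  map_add (mfderiv (𝓡 n) (𝓡 n) (extChartAt (𝓡 n) c).symm u) v w

/-- The metric in the chart at `c`, as a bilinear form. -/
def chartForm (g : RMetric n M) (c : M) (u : EuclideanSpace ℝ (Fin n)) :
    EuclideanSpace ℝ (Fin n) →ₗ[ℝ] EuclideanSpace ℝ (Fin n) →ₗ[ℝ] ℝ :=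
  LinearMap.mk₂ ℝ (fun v w ↦ g.inner ((extChartAt (𝓡 n) c).symm u) (coordVec c v u)
    (coordVec c w u))
    (fun v v' w ↦ by rw [coordVec_add, map_add]; rfl)
    (fun a v w ↦ by
      have : coordVec c (a • v) u = a • coordVec c v u :=
        map_smul (mfderiv (𝓡 n) (𝓡 n) (extChartAt (𝓡 n) c).symm u) a v
      rw [this, map_smul]
      rfl)
    (fun v w w' ↦ by rw [coordVec_add, map_add])
    (fun a v w ↦ by
      have : coordVec c (a • w) u = a • coordVec c w u :=
        map_smul (mfderiv (𝓡 n) (𝓡 n) (extChartAt (𝓡 n) c).symm u) a w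
      rw [this, map_smul])

lemma chartForm_self (g : RMetric n M) (c : M) (u v : EuclideanSpace ℝ (Fin n)) :
    chartForm g c u v v = gnorm g _ (coordVec c v u) ^ 2 := by
  rw [gnorm, Real.sq_sqrt]
  · rfl
  · rcases eq_or_ne (coordVec c v u) 0 with h | h
    · rw [h, map_zero]
    · exact (g.pos _ _ h).le

lemma chartForm_eq_sum (g : RMetric n M) (c : M) (u v w : EuclideanSpace ℝ (Fin n)) :
    chartForm g c u v w = ∑ i, ∑ j, v i * gramMatrix g c u i j * w j := by
  have hv : ∀ v : EuclideanSpace ℝ (Fin n), v = ∑ i, v i • EuclideanSpace.single i (1 : ℝ) := by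
    intro v
    simpa using ((EuclideanSpace.basisFun (Fin n) ℝ).sum_repr v).symm
  conv_lhs => rw [hv v, hv w]
  simp only [map_sum, map_smul, LinearMap.sum_apply, LinearMap.smul_apply, smul_eq_mul,
    Finset.mul_sum]
  rw [Finset.sum_comm]
  refine Finset.sum_congr rfl fun i _ ↦ Finset.sum_congr rfl fun j _ ↦ ?_
  rw [show chartForm g c u (EuclideanSpace.single i 1) (EuclideanSpace.single j 1) =
    gramMatrix g c u i j from rfl]
  ring

lemma gramMatrix_isHermitian (g : RMetric n M) (c : M) (u : EuclideanSpace ℝ (Fin n)) :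
    (gramMatrix g c u).IsHermitian := by
  ext i j
  exact g.symm _ _ _

lemma sqrt_det_gramMatrix_conformal (g : RMetric n M) (f : M → ℝ) (c : M)
    (u : EuclideanSpace ℝ (Fin n)) :
    √(gramMatrix (conformal g f) c u).det =
      Real.exp (n * f ((extChartAt (𝓡 n) c).symm u)) * √(gramMatrix g c u).det := by
  have h : gramMatrix (conformal g f) c u =
      Real.exp (2 * f ((extChartAt (𝓡 n) c).symm u)) • gramMatrix g c u := by
    ext i j
    rfl
  rw [h, Matrix.det_smul, Fintype.card_fin, Real.sqrt_mul (by positivity), ← Real.exp_nat_mul,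
    Real.sqrt_eq_rpow, ← Real.exp_mul]
  congr 2
  ring

/-- Evaluating the metric on unit eigenvectors places every eigenvalue of the Gram matrix between
`l^(-2)` and `l^2`. -/
lemma IsGoodChart.sqrt_det_bounds {g : RMetric n M} {c : M} {R l : ℝ} (hc : IsGoodChart g c R l)
    {u : EuclideanSpace ℝ (Fin n)} (hu : u ∈ closedBall (extChartAt (𝓡 n) c c) (2 * R)) :
    (l ^ n)⁻¹ ≤ √(gramMatrix g c u).det ∧ √(gramMatrix g c u).det ≤ l ^ n := by
  have hl : 0 < l := by linarith [hc.one_le]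
  set hG := gramMatrix_isHermitian g c u
  have heig : ∀ i, (l⁻¹) ^ 2 ≤ hG.eigenvalues i ∧ hG.eigenvalues i ≤ l ^ 2 := by
    intro i
    set v : EuclideanSpace ℝ (Fin n) := hG.eigenvectorBasis i with hv
    have hv1 : ‖v‖ = 1 := hG.eigenvectorBasis.orthonormal.1 i
    have h1 : hG.eigenvalues i = gnorm g _ (coordVec c v u) ^ 2 := by
      rw [← chartForm_self, chartForm_eq_sum, hG.eigenvalues_eq i]
      simp only [dotProduct, Matrix.mulVec, Finset.mul_sum]
      simp [mul_assoc, hv]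
    have h2 := hc.gnorm_le u hu v
    have h3 := hc.le_gnorm u hu v
    rw [hv1] at h2 h3
    rw [h1]
    constructor
    · gcongr
      rwa [inv_le_iff_one_le_mul₀' hl]
    · have := gnorm_nonneg g _ (coordVec c v u)
      gcongr
      linarith
  have hdet : (gramMatrix g c u).det = ∏ i, hG.eigenvalues i := by
    simpa using hG.det_eq_prod_eigenvalues
  have e1 : (l ^ n)⁻¹ = √(∏ _i : Fin n, (l⁻¹) ^ 2) := by
    rw [Finset.prod_const, Finset.card_univ, Fintype.card_fin, ← pow_mul, mul_comm, pow_mul,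
      Real.sqrt_sq (by positivity), inv_pow]
  have e2 : l ^ n = √(∏ _i : Fin n, l ^ 2) := by
    rw [Finset.prod_const, Finset.card_univ, Fintype.card_fin, ← pow_mul, mul_comm, pow_mul,
      Real.sqrt_sq (by positivity)]
  rw [hdet]
  constructor
  · rw [e1]
    exact Real.sqrt_le_sqrt (Finset.prod_le_prod (fun _ _ ↦ by positivity) fun i _ ↦ (heig i).1)
  · rw [e2]
    exact Real.sqrt_le_sqrt (Finset.prod_le_prod
      (fun i _ ↦ le_trans (by positivity) (heig i).1) fun i _ ↦ (heig i).2)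

lemma aemeasurable_extChartAt_symm [MeasurableSpace M] [BorelSpace M] (c : M) :
    AEMeasurable (extChartAt (𝓡 n) c).symm (volume.restrict (extChartAt (𝓡 n) c).target) :=
  (continuousOn_extChartAt_symm c).aemeasurable (isOpen_extChartAt_target c).measurableSet

lemma chartVolume_apply [MeasurableSpace M] [BorelSpace M] (g : RMetric n M) (c : M) {A : Set M}
    (hA : MeasurableSet A) :
    chartVolume g c A =
      ∫⁻ u in (extChartAt (𝓡 n) c).symm ⁻¹' A ∩ (extChartAt (𝓡 n) c).target,
        ENNReal.ofReal √(gramMatrix g c u).det := by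
  rw [chartVolume, Measure.map_apply_of_aemeasurable
    ((aemeasurable_extChartAt_symm c).mono_ac (withDensity_absolutelyContinuous _ _)) hA,
    withDensity_apply', Measure.restrict_restrict' (isOpen_extChartAt_target c).measurableSet]

/-- The derivative of a change of charts. -/
lemma exists_hasFDerivAt_transition [IsManifold (𝓡 n) ∞ M] {c c' : M} {u : EuclideanSpace ℝ (Fin n)}
    (hu : u ∈ (extChartAt (𝓡 n) c).target)
    (hu' : (extChartAt (𝓡 n) c).symm u ∈ (extChartAt (𝓡 n) c').source) :
    ∃ L : EuclideanSpace ℝ (Fin n) →L[ℝ] EuclideanSpace ℝ (Fin n),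
      HasFDerivAt (fun u ↦ extChartAt (𝓡 n) c' ((extChartAt (𝓡 n) c).symm u)) L u ∧
      ∀ v, L v = chartVec c' ((extChartAt (𝓡 n) c).symm u) (coordVec c v u) := by
  have h1 := (mdifferentiableAt_extChartAt' hu').hasMFDerivAt.comp u
    (mdifferentiableAt_extChartAt_symm' hu).hasMFDerivAt
  exact ⟨_, h1.hasFDerivAt, fun v ↦ rfl⟩

lemma inner_eq_chartForm [IsManifold (𝓡 n) ∞ M] (g : RMetric n M) {c x : M}
    {u : EuclideanSpace ℝ (Fin n)}
    (hu : u ∈ (extChartAt (𝓡 n) c).target) (hx : (extChartAt (𝓡 n) c).symm u = x)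
    (w w' : TangentSpace (𝓡 n) x) :
    g.inner x w w' = chartForm g c u (chartVec c x w) (chartVec c x w') := by
  subst hx
  change _ = g.inner _ (coordVec c (chartVec c _ w) u) (coordVec c (chartVec c _ w') u)
  rw [show coordVec c (chartVec c _ w) u = w from coordVec_mfderiv_extChartAt hu w,
    show coordVec c (chartVec c _ w') u = w' from coordVec_mfderiv_extChartAt hu w']

/-- The Gram matrices are congruent through the Jacobian matrix `J` of the transition map, so the
determinants differ by the factor `(det J)^2`. -/
lemma sqrt_det_gramMatrix_transition [IsManifold (𝓡 n) ∞ M] (g : RMetric n M) {c c' : M}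
    {u : EuclideanSpace ℝ (Fin n)}
    (hu' : (extChartAt (𝓡 n) c).symm u ∈ (extChartAt (𝓡 n) c').source)
    {L : EuclideanSpace ℝ (Fin n) →L[ℝ] EuclideanSpace ℝ (Fin n)}
    (hL : ∀ v, L v = chartVec c' ((extChartAt (𝓡 n) c).symm u) (coordVec c v u)) :
    √(gramMatrix g c u).det =
      |L.det| * √(gramMatrix g c' (extChartAt (𝓡 n) c' ((extChartAt (𝓡 n) c).symm u))).det := by
  set u' := extChartAt (𝓡 n) c' ((extChartAt (𝓡 n) c).symm u) with hu'def
  have hut : u' ∈ (extChartAt (𝓡 n) c').target := (extChartAt (𝓡 n) c').map_source hu'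
  have hinv : (extChartAt (𝓡 n) c').symm u' = (extChartAt (𝓡 n) c).symm u :=
    (extChartAt (𝓡 n) c').left_inv hu'
  set b := (EuclideanSpace.basisFun (Fin n) ℝ).toBasis with hb
  set J := LinearMap.toMatrix b b (L : EuclideanSpace ℝ (Fin n) →ₗ[ℝ] EuclideanSpace ℝ (Fin n))
    with hJ
  have hJe : ∀ k i, J k i = L (EuclideanSpace.single i 1) k := by
    intro k i
    simp [hJ, hb, LinearMap.toMatrix_apply]
  have hmat : gramMatrix g c u = J.transpose * gramMatrix g c' u' * J := by
    ext i j
    have h1 : gramMatrix g c u i j = chartForm g c' u' (L (EuclideanSpace.single i 1))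
        (L (EuclideanSpace.single j 1)) := by
      rw [hL, hL]
      exact inner_eq_chartForm g hut hinv _ _
    rw [h1, chartForm_eq_sum]
    simp only [Matrix.mul_apply, Matrix.transpose_apply, hJe, Finset.sum_mul]
    exact Finset.sum_comm
  have hdet : L.det = J.det := by
    rw [hJ, LinearMap.det_toMatrix]
  rw [hmat, Matrix.det_mul, Matrix.det_mul, Matrix.det_transpose, hdet,
    show J.det * (gramMatrix g c' u').det * J.det = J.det ^ 2 * (gramMatrix g c' u').det by ring,
    Real.sqrt_mul (sq_nonneg _), Real.sqrt_sq_eq_abs]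

/-- Change of variables along the transition map. Only an inequality holds, since the chart at `c`
may miss part of `A`. -/
lemma chartVolume_le_of_subset [IsManifold (𝓡 n) ∞ M] [MeasurableSpace M] [BorelSpace M]
    (g : RMetric n M) {c c' : M}
    {A : Set M} (hA : MeasurableSet A) (hAc' : A ⊆ (extChartAt (𝓡 n) c').source) :
    chartVolume g c A ≤ chartVolume g c' A := by
  rw [chartVolume_apply g c hA, chartVolume_apply g c' hA]
  set φ := extChartAt (𝓡 n) c with hφ
  set φ' := extChartAt (𝓡 n) c' with hφ'
  set S := φ.symm ⁻¹' A ∩ φ.target with hS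
  have hSm : MeasurableSet S := by
    have h1 : Measurable (φ.target.domRestrict φ.symm) :=
      (continuousOn_iff_continuous_domRestrict.1 (continuousOn_extChartAt_symm c)).measurable
    have h2 := ((isOpen_extChartAt_target (I := 𝓡 n) c).measurableSet).subtype_image (h1 hA)
    convert h2 using 1
    ext u
    constructor
    · exact fun hu ↦ ⟨⟨u, hu.2⟩, hu.1, rfl⟩
    · rintro ⟨w, hw, rfl⟩
      exact ⟨hw, w.2⟩
  have hL : ∀ u ∈ S, ∃ L : EuclideanSpace ℝ (Fin n) →L[ℝ] EuclideanSpace ℝ (Fin n),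
      HasFDerivAt (fun u ↦ φ' (φ.symm u)) L u ∧
      ∀ v, L v = chartVec c' (φ.symm u) (coordVec c v u) := fun u hu ↦
    exists_hasFDerivAt_transition hu.2 (hAc' hu.1)
  choose! L hLd hLv using hL
  have hinj : InjOn (fun u ↦ φ' (φ.symm u)) S := by
    intro u hu w hw h
    exact φ.symm.injOn hu.2 hw.2 (φ'.injOn (hAc' hu.1) (hAc' hw.1) h)
  calc ∫⁻ u in S, ENNReal.ofReal √(gramMatrix g c u).det
      = ∫⁻ u in S, ENNReal.ofReal |(L u).det| *
          ENNReal.ofReal √(gramMatrix g c' (φ' (φ.symm u))).det := by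
        refine setLIntegral_congr_fun hSm fun u hu ↦ ?_
        rw [← ENNReal.ofReal_mul (abs_nonneg _)]
        exact congrArg _ (sqrt_det_gramMatrix_transition g (hAc' hu.1) (hLv u hu))
    _ = ∫⁻ w in (fun u ↦ φ' (φ.symm u)) '' S, ENNReal.ofReal √(gramMatrix g c' w).det :=
        (lintegral_image_eq_lintegral_abs_det_fderiv_mul volume hSm
          (fun u hu ↦ (hLd u hu).hasFDerivWithinAt) hinj
          fun w ↦ ENNReal.ofReal √(gramMatrix g c' w).det).symm
    _ ≤ _ := by
        refine lintegral_mono_set ?_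
        rintro _ ⟨u, hu, rfl⟩
        have := hAc' hu.1
        exact ⟨by rw [mem_preimage, φ'.left_inv this]; exact hu.1, φ'.map_source this⟩

/-- The part of the domain of the chart at `c` with coordinates in the ball of radius `r` around
the centre. -/
def chartBall (n : ℕ) {M : Type*} [TopologicalSpace M] [ChartedSpace (EuclideanSpace ℝ (Fin n)) M]
    (c : M) (r : ℝ) : Set M :=
  (extChartAt (𝓡 n) c).source ∩ extChartAt (𝓡 n) c ⁻¹' ball (extChartAt (𝓡 n) c c) r

lemma isOpen_chartBall (c : M) (r : ℝ) : IsOpen (chartBall n c r) :=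
  (continuousOn_extChartAt c).isOpen_inter_preimage (isOpen_extChartAt_source c) isOpen_ball

/-- A supremum of measures is bounded by any common upper bound; the sum of the chart volumes
restricted to the covering sets is one. -/
lemma rvolume_univ_le [IsManifold (𝓡 n) ∞ M] [MeasurableSpace M] [BorelSpace M]
    (g : RMetric n M) {S : Finset M}
    {r : M → ℝ} (hS : ⋃ c ∈ S, chartBall n c (r c) = univ) :
    rvolume g univ ≤ ∑ c ∈ S, ∫⁻ u in ball (extChartAt (𝓡 n) c c) (r c),
      ENNReal.ofReal √(gramMatrix g c u).det := by
  have h : rvolume g ≤ ∑ c ∈ S, (chartVolume g c).restrict (chartBall n c (r c)) := by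
    refine iSup_le fun c ↦ Measure.le_iff.2 fun A hA ↦ ?_
    calc _ ≤ chartVolume g c (⋃ c' ∈ S, A ∩ chartBall n c' (r c')) := by
          refine measure_mono fun x hx ↦ ?_
          have hxu : x ∈ ⋃ c ∈ S, chartBall n c (r c) := hS ▸ mem_univ x
          simp only [mem_iUnion] at hxu ⊢
          obtain ⟨c', hc', hxc⟩ := hxu
          exact ⟨c', hc', hx, hxc⟩
      _ ≤ ∑ c' ∈ S, chartVolume g c (A ∩ chartBall n c' (r c')) :=
          measure_biUnion_finset_le _ _
      _ ≤ ∑ c' ∈ S, chartVolume g c' (A ∩ chartBall n c' (r c')) :=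
          Finset.sum_le_sum fun c' _ ↦ chartVolume_le_of_subset g
            (hA.inter (isOpen_chartBall c' _).measurableSet) fun x hx ↦ hx.2.1
      _ = _ := by
          rw [Measure.finsetSum_apply]
          exact Finset.sum_congr rfl fun c' _ ↦ (Measure.restrict_apply hA).symm
  refine (h univ).trans ?_
  rw [Measure.finsetSum_apply]
  refine Finset.sum_le_sum fun c _ ↦ ?_
  rw [Measure.restrict_apply_univ, chartVolume_apply g c (isOpen_chartBall c _).measurableSet]
  refine lintegral_mono_set ?_
  rintro u ⟨⟨h1, h2⟩, h3⟩
  rwa [mem_preimage, (extChartAt (𝓡 n) c).right_inv h3] at h2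

lemma lintegral_le_rvolume_univ [MeasurableSpace M] [BorelSpace M] (g : RMetric n M) (c : M)
    {s : Set (EuclideanSpace ℝ (Fin n))} (hs : s ⊆ (extChartAt (𝓡 n) c).target) :
    ∫⁻ u in s, ENNReal.ofReal √(gramMatrix g c u).det ≤ rvolume g univ := by
  refine le_trans ?_ (le_iSup (fun c ↦ chartVolume g c) c univ)
  rw [chartVolume_apply g c MeasurableSet.univ, preimage_univ, univ_inter]
  exact lintegral_mono_set hs

lemma IsGoodChart.smul_map_le_rvolume [MeasurableSpace M] [BorelSpace M] {g : RMetric n M} {c : M}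
    {R l : ℝ} (hc : IsGoodChart g c R l) :
    ENNReal.ofReal ((l ^ n)⁻¹) •
      (volume.restrict (closedBall (extChartAt (𝓡 n) c c) (2 * R))).map (extChartAt (𝓡 n) c).symm ≤
      rvolume g := by
  refine le_trans (Measure.le_iff.2 fun A hA ↦ ?_) (le_iSup (fun c ↦ chartVolume g c) c)
  rw [chartVolume_apply g c hA, Measure.smul_apply, Measure.map_apply_of_aemeasurable
    ((aemeasurable_extChartAt_symm c).mono_measure (Measure.restrict_mono hc.subset le_rfl)) hA,
    Measure.restrict_apply' measurableSet_closedBall, smul_eq_mul, ← setLIntegral_const]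
  calc _ ≤ ∫⁻ u in (extChartAt (𝓡 n) c).symm ⁻¹' A ∩ closedBall (extChartAt (𝓡 n) c c) (2 * R),
        ENNReal.ofReal √(gramMatrix g c u).det := by
        refine lintegral_mono_ae ?_
        filter_upwards [ae_restrict_of_ae_restrict_of_subset inter_subset_right
          (ae_restrict_mem measurableSet_closedBall)] with u hu
        exact ENNReal.ofReal_le_ofReal (hc.sqrt_det_bounds hu).1
    _ ≤ _ := lintegral_mono_set (inter_subset_inter_right _ hc.subset)

end Volume

/-! ### Consequences of the energy bound within one chart -/

section Local

variable {n : ℕ} {M : Type*} [TopologicalSpace M]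
  [ChartedSpace (EuclideanSpace ℝ (Fin n)) M]

lemma IsGoodChart.continuousOn_comp_symm {g : RMetric n M} {c : M} {R l : ℝ}
    (hc : IsGoodChart g c R l) {f : M → ℝ} (hf : Continuous f) :
    ContinuousOn (fun u ↦ f ((extChartAt (𝓡 n) c).symm u))
      (closedBall (extChartAt (𝓡 n) c c) (2 * R)) :=
  hf.comp_continuousOn ((continuousOn_extChartAt_symm c).mono hc.subset)

variable [MeasurableSpace M]

/-- `f` is continuous and has a weak differential whose `L^n` norm with respect to `g` is at
most `B`. -/
def HasEnergyLE (g : RMetric n M) (B : ℝ≥0) (f : M → ℝ) : Prop :=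
  Continuous f ∧ ∃ df : ∀ x : M, TangentSpace (𝓡 n) x →L[ℝ] ℝ,
    IsWeakDifferential f df ∧ covectorLpNorm g n df ≤ B

/-- The mean of `f` in the chart at `c` over the ball of radius `R` around the centre. -/
def chartMean (n : ℕ) {M : Type*} [TopologicalSpace M] [ChartedSpace (EuclideanSpace ℝ (Fin n)) M]
    (f : M → ℝ) (c : M) (R : ℝ) : ℝ :=
  ⨍ u in ball (extChartAt (𝓡 n) c c) R, f ((extChartAt (𝓡 n) c).symm u)

lemma lintegral_covectorNorm_pow_le (hn : 1 ≤ n) {g : RMetric n M} {B : ℝ≥0}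
    {df : ∀ x : M, TangentSpace (𝓡 n) x →L[ℝ] ℝ} (h : covectorLpNorm g n df ≤ B) :
    ∫⁻ x, ENNReal.ofReal (covectorNorm g x (df x)) ^ n ∂(rvolume g) ≤ (B : ℝ≥0∞) ^ n := by
  have hn0 : (n : ℝ) ≠ 0 := by positivity
  rw [covectorLpNorm, eLpNorm_eq_lintegral_rpow_enorm_toReal (by positivity) (by simp),
    ENNReal.toReal_natCast] at h
  have h2 := ENNReal.rpow_le_rpow h (Nat.cast_nonneg n : (0 : ℝ) ≤ n)
  rw [← ENNReal.rpow_mul, one_div_mul_cancel hn0, ENNReal.rpow_one, ENNReal.rpow_natCast] at h2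
  refine le_trans (le_of_eq (lintegral_congr fun x ↦ ?_)) h2
  rw [ENNReal.rpow_natCast, Real.enorm_eq_ofReal (covectorNorm_nonneg _ _ _)]

variable [BorelSpace M]

/-- The `n`-energy in coordinates is comparable to the Riemannian one: each partial derivative is at
most `l` times the covector norm, and Lebesgue measure is at most `l^n` times the Riemannian volume.
-/
lemma IsGoodChart.lintegral_energy_le (hn : 1 ≤ n) {g : RMetric n M} {c : M} {R l : ℝ}
    (hc : IsGoodChart g c R l) {B : ℝ≥0} {df : ∀ x : M, TangentSpace (𝓡 n) x →L[ℝ] ℝ}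
    (h : covectorLpNorm g n df ≤ B) :
    ∫⁻ u in closedBall (extChartAt (𝓡 n) c c) (2 * R),
      (∑ i, ‖df ((extChartAt (𝓡 n) c).symm u) (coordVec c (EuclideanSpace.single i 1) u)‖ₑ) ^ n ≤
      ((Real.toNNReal (l ^ n * (n * l) ^ n) * B ^ n : ℝ≥0) : ℝ≥0∞) := by
  have hl : 0 < l := by linarith [hc.one_le]
  set φ := extChartAt (𝓡 n) c with hφ
  set Z := closedBall (φ c) (2 * R) with hZ
  set N : EuclideanSpace ℝ (Fin n) → ℝ≥0∞ := fun u ↦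
    (∑ i, ‖df (φ.symm u) (coordVec c (EuclideanSpace.single i 1) u)‖ₑ) ^ n with hN
  have hNle : ∀ u ∈ Z, N u ≤ ENNReal.ofReal ((n * l) ^ n) *
      ENNReal.ofReal (covectorNorm g (φ.symm u) (df (φ.symm u))) ^ n := by
    intro u hu
    rw [ENNReal.ofReal_pow (by positivity), ← mul_pow]
    simp only [hN]
    gcongr
    calc _ ≤ ∑ _i : Fin n, ENNReal.ofReal (l * covectorNorm g (φ.symm u) (df (φ.symm u))) := by
          refine Finset.sum_le_sum fun i _ ↦ ?_
          rw [← ofReal_norm]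
          apply ENNReal.ofReal_le_ofReal
          refine (abs_apply_le_covectorNorm g _ _ _).trans ?_
          rw [mul_comm]
          have h1 := hc.gnorm_le u hu (EuclideanSpace.single i 1)
          rw [PiLp.norm_single, norm_one, mul_one] at h1
          exact mul_le_mul_of_nonneg_right h1 (covectorNorm_nonneg _ _ _)
      _ = _ := by
          rw [Finset.sum_const, Finset.card_univ, Fintype.card_fin, nsmul_eq_mul,
            ENNReal.ofReal_mul hl.le, ENNReal.ofReal_mul (Nat.cast_nonneg n),
            ENNReal.ofReal_natCast, mul_assoc]
  -- The covector norm is not known to be measurable on `M`. A measurable minorant with the same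
  -- lower integral can be transported to `M` and compared with it pointwise there.
  obtain ⟨k, hkm, hkle, hkeq⟩ := exists_measurable_le_lintegral_eq volume (Z.indicator N)
  rw [lintegral_indicator measurableSet_closedBall] at hkeq
  rw [hkeq]
  have hkZ : ∀ u ∉ Z, k u = 0 := fun u hu ↦ by
    have := hkle u
    rwa [indicator_of_notMem hu, nonpos_iff_eq_zero] at this
  have hkint : ∫⁻ u, k u = ∫⁻ u in Z, k u := by
    rw [← lintegral_indicator measurableSet_closedBall]
    refine lintegral_congr fun u ↦ ?_
    by_cases hu : u ∈ Z
    · rw [indicator_of_mem hu]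
    · rw [indicator_of_notMem hu, hkZ u hu]
  set H : M → ℝ≥0∞ := φ.source.indicator (fun x ↦ k (φ x)) with hH
  have hHm : Measurable H := by
    classical
    have h1 : ContinuousOn φ φ.source := continuousOn_extChartAt c
    have h2 : MeasurableSet φ.source := (isOpen_extChartAt_source c).measurableSet
    have h3 : Measurable (φ.source.piecewise φ (fun _ ↦ φ c)) := by
      exact h1.measurable_piecewise continuousOn_const h2
    have h4 : H = φ.source.indicator (fun x ↦ k (φ.source.piecewise φ (fun _ ↦ φ c) x)) := by
      ext x
      by_cases hx : x ∈ φ.source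
      · simp [hH, hx]
      · simp [hH, hx]
    rw [h4]
    exact (hkm.comp h3).indicator h2
  have hHle : ∀ x, H x ≤ ENNReal.ofReal ((n * l) ^ n) *
      ENNReal.ofReal (covectorNorm g x (df x)) ^ n := by
    intro x
    by_cases hx : x ∈ φ.source
    · rw [hH, indicator_of_mem hx]
      by_cases hxZ : φ x ∈ Z
      · have h0 := hkle (φ x)
        rw [indicator_of_mem hxZ] at h0
        have h1 := h0.trans (hNle _ hxZ)
        rwa [φ.left_inv hx] at h1
      · rw [hkZ _ hxZ]
        exact zero_le
    · rw [hH, indicator_of_notMem hx]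
      exact zero_le
  have hHint : ENNReal.ofReal ((l ^ n)⁻¹) * ∫⁻ u in Z, k u ≤ ∫⁻ x, H x ∂(rvolume g) := by
    refine le_trans (le_of_eq ?_) (lintegral_mono' hc.smul_map_le_rvolume le_rfl)
    rw [lintegral_smul_measure, lintegral_map' hHm.aemeasurable
      ((aemeasurable_extChartAt_symm c).mono_measure (Measure.restrict_mono hc.subset le_rfl)),
      smul_eq_mul]
    congr 1
    refine setLIntegral_congr_fun measurableSet_closedBall fun u hu ↦ ?_
    have hut := hc.subset hu
    simp only [hH]
    rw [indicator_of_mem (φ.map_target hut), φ.right_inv hut]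
  have hfin : ENNReal.ofReal ((l ^ n)⁻¹) * ∫⁻ u in Z, k u ≤
      ENNReal.ofReal ((n * l) ^ n) * (B : ℝ≥0∞) ^ n := by
    refine hHint.trans ((lintegral_mono hHle).trans ?_)
    rw [lintegral_const_mul' _ _ ENNReal.ofReal_ne_top]
    gcongr
    exact lintegral_covectorNorm_pow_le hn h
  rw [hkint]
  calc ∫⁻ u in Z, k u = ENNReal.ofReal (l ^ n) *
        (ENNReal.ofReal ((l ^ n)⁻¹) * ∫⁻ u in Z, k u) := by
        rw [← mul_assoc, ← ENNReal.ofReal_mul (by positivity), mul_inv_cancel₀ (by positivity),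
          ENNReal.ofReal_one, one_mul]
    _ ≤ ENNReal.ofReal (l ^ n) * (ENNReal.ofReal ((n * l) ^ n) * (B : ℝ≥0∞) ^ n) := by gcongr
    _ = _ := by
        rw [← mul_assoc, ← ENNReal.ofReal_mul (by positivity)]
        push_cast
        rfl

lemma IsGoodChart.hasWeakGradientOn (hn : 1 ≤ n) {g : RMetric n M} {c : M} {R l : ℝ}
    (hc : IsGoodChart g c R l) {B : ℝ≥0} {f : M → ℝ} (hf : HasEnergyLE g B f) :
    ∃ P : Fin n → EuclideanSpace ℝ (Fin n) → ℝ,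
      HasWeakGradientOn (fun u ↦ f ((extChartAt (𝓡 n) c).symm u)) P (extChartAt (𝓡 n) c c)
        (2 * R) ∧
      ∫⁻ u in closedBall (extChartAt (𝓡 n) c c) (2 * R), (∑ i, ‖P i u‖ₑ) ^ n ≤
        ((Real.toNNReal (l ^ n * (n * l) ^ n) * B ^ n : ℝ≥0) : ℝ≥0∞) := by
  obtain ⟨hfc, df, hw, hB⟩ := hf
  refine ⟨fun i u ↦ df _ (coordVec c (EuclideanSpace.single i 1) u), ⟨?_, ?_, ?_⟩,
    hc.lintegral_energy_le hn hB⟩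
  · exact hc.continuousOn_comp_symm hfc
  · intro i
    exact (hw.locallyIntegrable_diff c (EuclideanSpace.single i 1)).integrableOn_compact_subset
      hc.subset (isCompact_closedBall _ _)
  · intro i ψ hψ hψc hs
    exact hw.integral_eq c (EuclideanSpace.single i 1) ψ hψ hψc (hs.trans hc.subset)

lemma IsGoodChart.exists_abs_integral_sub_chartMean_le (hn : 1 ≤ n) {g : RMetric n M} {c : M}
    {R l : ℝ} (hc : IsGoodChart g c R l) (B : ℝ≥0) {ε : ℝ} (hε : 0 < ε) :
    ∃ A : ℝ, 0 ≤ A ∧ ∀ f, HasEnergyLE g B f →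
      ∀ (σ : Measure (EuclideanSpace ℝ (Fin n))) [IsProbabilityMeasure σ] (K : ℝ), 1 ≤ K →
      (∀ᵐ z ∂σ, z ∈ ball (extChartAt (𝓡 n) c c) R) →
      (∀ w, ∀ s > 0, σ (closedBall w s) ≤ ENNReal.ofReal (K * s)) →
      |∫ z, f ((extChartAt (𝓡 n) c).symm z) ∂σ - chartMean n f c R| ≤ ε * Real.log K + A := by
  obtain ⟨A, hA0, hA⟩ := HasWeakGradientOn.abs_integral_sub_average_le hn hc.pos hε
    (Real.toNNReal (l ^ n * (n * l) ^ n) * B ^ n)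
  refine ⟨A, hA0, fun f hf σ _ K hK hσB hσ ↦ ?_⟩
  obtain ⟨P, hP, hPJ⟩ := hc.hasWeakGradientOn hn hf
  exact hA _ P _ hP hPJ σ K hK hσB hσ

lemma IsGoodChart.exists_lintegral_exp_le (hn : 1 ≤ n) {g : RMetric n M} {c : M}
    {R l : ℝ} (hc : IsGoodChart g c R l) (B : ℝ≥0) {p : ℝ} (hp : 0 < p) :
    ∃ A : ℝ≥0, ∀ f, HasEnergyLE g B f →
      ∫⁻ u in ball (extChartAt (𝓡 n) c c) R,
        ENNReal.ofReal (Real.exp (p * f ((extChartAt (𝓡 n) c).symm u))) ≤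
        ENNReal.ofReal (A * Real.exp (p * chartMean n f c R)) := by
  obtain ⟨A, hA⟩ := HasWeakGradientOn.lintegral_exp_le hn hc.pos hp
    (Real.toNNReal (l ^ n * (n * l) ^ n) * B ^ n)
  refine ⟨A, fun f hf ↦ ?_⟩
  obtain ⟨P, hP, hPJ⟩ := hc.hasWeakGradientOn hn hf
  have h := hA _ P _ hP hPJ
  rw [mul_comm, ENNReal.ofReal_mul (Real.exp_pos _).le, ENNReal.ofReal_coe_nnreal]
  refine le_trans (le_of_eq ?_) (mul_le_mul_right h _)
  rw [← lintegral_const_mul' _ _ ENNReal.ofReal_ne_top]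
  refine lintegral_congr fun u ↦ ?_
  rw [← ENNReal.ofReal_mul (Real.exp_pos _).le, ← Real.exp_add]
  congr 2
  rw [chartMean]
  ring

lemma ofReal_exp_integral_le {F : EuclideanSpace ℝ (Fin n) → ℝ}
    {Z : Set (EuclideanSpace ℝ (Fin n))} (hZ : IsCompact Z) (hF : ContinuousOn F Z)
    {σ : Measure (EuclideanSpace ℝ (Fin n))} [IsProbabilityMeasure σ] (hσ : ∀ᵐ z ∂σ, z ∈ Z) :
    ENNReal.ofReal (Real.exp (∫ z, F z ∂σ)) ≤ ∫⁻ z, ENNReal.ofReal (Real.exp (F z)) ∂σ := by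
  have hr : σ.restrict Z = σ := Measure.restrict_eq_self_of_ae_mem hσ
  have hi : Integrable F σ := by
    have := hF.integrableOn_compact (μ := σ) hZ
    rwa [IntegrableOn, hr] at this
  have hie : Integrable (fun z ↦ Real.exp (F z)) σ := by
    have := (Real.continuous_exp.comp_continuousOn hF).integrableOn_compact (μ := σ) hZ
    rwa [IntegrableOn, hr] at this
  rw [← ofReal_integral_eq_lintegral_ofReal hie
    (Filter.Eventually.of_forall fun z ↦ (Real.exp_pos _).le)]
  apply ENNReal.ofReal_le_ofReal
  exact convexOn_exp.map_integral_le Real.continuous_exp.continuousOn isClosed_univ (by simp)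
    hi hie

/-- Jensen's inequality for the exponential on a single ball; no energy bound enters. -/
lemma IsGoodChart.exists_le_rvolume_conformal {g : RMetric n M} {c : M}
    {R l : ℝ} (hc : IsGoodChart g c R l) :
    ∃ k : ℝ, 0 < k ∧ ∀ f, Continuous f →
      ENNReal.ofReal (k * Real.exp (n * chartMean n f c R)) ≤ rvolume (conformal g f) univ := by
  have hl : 0 < l := by linarith [hc.one_le]
  set D := ball (extChartAt (𝓡 n) c c) R with hD
  have hV0 : volume D ≠ 0 := (measure_ball_pos _ _ hc.pos).ne'
  have hVt : volume D ≠ ⊤ := measure_ball_lt_top.ne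
  have hVpos := ENNReal.toReal_pos hV0 hVt
  have hsub : D ⊆ closedBall (extChartAt (𝓡 n) c c) (2 * R) :=
    ball_subset_closedBall.trans (closedBall_subset_closedBall (by linarith [hc.pos]))
  refine ⟨(l ^ n)⁻¹ * (volume D).toReal, by positivity, fun f hf ↦ ?_⟩
  set F := fun u ↦ f ((extChartAt (𝓡 n) c).symm u) with hF
  -- Written in the form to which the average unfolds, so that `chartMean` is the `σ`-integral by
  -- definition.
  set σ := (volume.restrict D univ)⁻¹ • volume.restrict D with hσ
  have hσ' : σ = (volume D)⁻¹ • volume.restrict D := by rw [hσ, Measure.restrict_apply_univ]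
  have hprob : IsProbabilityMeasure σ := ⟨by
    rw [hσ', Measure.smul_apply, Measure.restrict_apply_univ, smul_eq_mul,
      ENNReal.inv_mul_cancel hV0 hVt]⟩
  have hmean : n * chartMean n f c R = ∫ u, n * F u ∂σ := by
    rw [integral_const_mul]
    rfl
  have hσZ : ∀ᵐ z ∂σ, z ∈ closedBall (extChartAt (𝓡 n) c c) (2 * R) := by
    rw [hσ']
    exact Measure.ae_smul_measure ((ae_restrict_mem measurableSet_ball).mono fun z hz ↦ hsub hz) _
  have hj := ofReal_exp_integral_le (F := fun u ↦ n * F u) (isCompact_closedBall _ _)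
    ((hc.continuousOn_comp_symm hf).const_smul (n : ℝ)) hσZ
  rw [← hmean, hσ', lintegral_smul_measure, smul_eq_mul] at hj
  refine le_trans ?_ (lintegral_le_rvolume_univ (conformal g f) c (hsub.trans hc.subset))
  calc _ = ENNReal.ofReal ((l ^ n)⁻¹) * (volume D *
        ENNReal.ofReal (Real.exp (n * chartMean n f c R))) := by
        rw [mul_assoc, ENNReal.ofReal_mul (by positivity), ENNReal.ofReal_mul hVpos.le,
          ENNReal.ofReal_toReal hVt]
    _ ≤ ENNReal.ofReal ((l ^ n)⁻¹) * (volume D *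
        ((volume D)⁻¹ * ∫⁻ u in D, ENNReal.ofReal (Real.exp (n * F u)))) := by gcongr
    _ = ∫⁻ u in D, ENNReal.ofReal ((l ^ n)⁻¹) * ENNReal.ofReal (Real.exp (n * F u)) := by
        rw [← mul_assoc (volume D), ENNReal.mul_inv_cancel hV0 hVt, one_mul,
          lintegral_const_mul' _ _ ENNReal.ofReal_ne_top]
    _ ≤ _ := by
        refine setLIntegral_mono' measurableSet_ball fun u hu ↦ ?_
        rw [← ENNReal.ofReal_mul (by positivity), sqrt_det_gramMatrix_conformal, mul_comm]
        gcongr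
        exact (hc.sqrt_det_bounds (hsub hu)).1

/-- Exponential integrability with exponent `p = n`, because the conformal volume density carries
the factor `exp (n f)`. -/
lemma IsGoodChart.exists_lintegral_sqrt_det_conformal_le (hn : 1 ≤ n) {g : RMetric n M} {c : M}
    {R l : ℝ} (hc : IsGoodChart g c R l) (B : ℝ≥0) :
    ∃ k : ℝ, 0 < k ∧ ∀ f, HasEnergyLE g B f →
      ∫⁻ u in ball (extChartAt (𝓡 n) c c) R,
        ENNReal.ofReal √(gramMatrix (conformal g f) c u).det ≤
        ENNReal.ofReal (k * Real.exp (n * chartMean n f c R)) := by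
  have hl : 0 < l := by linarith [hc.one_le]
  obtain ⟨A, hA⟩ := hc.exists_lintegral_exp_le hn B (p := n) (by exact_mod_cast hn)
  refine ⟨l ^ n * (A + 1), by positivity, fun f hf ↦ ?_⟩
  have hsub : ball (extChartAt (𝓡 n) c c) R ⊆ closedBall (extChartAt (𝓡 n) c c) (2 * R) :=
    ball_subset_closedBall.trans (closedBall_subset_closedBall (by linarith [hc.pos]))
  calc _ ≤ ∫⁻ u in ball (extChartAt (𝓡 n) c c) R, ENNReal.ofReal (l ^ n) *
        ENNReal.ofReal (Real.exp (n * f ((extChartAt (𝓡 n) c).symm u))) := by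
        refine setLIntegral_mono' measurableSet_ball fun u hu ↦ ?_
        rw [← ENNReal.ofReal_mul (by positivity), sqrt_det_gramMatrix_conformal, mul_comm]
        gcongr
        exact (hc.sqrt_det_bounds (hsub hu)).2
    _ ≤ ENNReal.ofReal (l ^ n) * ENNReal.ofReal (A * Real.exp (n * chartMean n f c R)) := by
        rw [lintegral_const_mul' _ _ ENNReal.ofReal_ne_top]
        gcongr
        exact hA f hf
    _ ≤ _ := by
        rw [← ENNReal.ofReal_mul (by positivity), mul_assoc]
        gcongr
        linarith

end Local

/-! ### Upper and lower distance bounds within one chart -/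

section LocalDist

variable {n : ℕ} {M : Type*} [TopologicalSpace M]
  [ChartedSpace (EuclideanSpace ℝ (Fin n)) M]

lemma conformal_zero (g : RMetric n M) : conformal g (fun _ ↦ 0) = g := by
  cases g
  simp [conformal]

lemma closedBall_subset_of_mem_chartBall {c x : M} {R ρ : ℝ} (hx : x ∈ chartBall n c (R / 2))
    (hρ : ρ ≤ R / 2) : closedBall (extChartAt (𝓡 n) c x) ρ ⊆ ball (extChartAt (𝓡 n) c c) R :=
  closedBall_subset_ball' (by have := mem_ball.1 hx.2; linarith)

lemma IsGoodChart.ball_subset {g : RMetric n M} {c : M} {R l : ℝ} (hc : IsGoodChart g c R l) :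
    ball (extChartAt (𝓡 n) c c) R ⊆ closedBall (extChartAt (𝓡 n) c c) (2 * R) :=
  ball_subset_closedBall.trans (closedBall_subset_closedBall (by linarith [hc.pos]))

variable [IsManifold (𝓡 n) ∞ M]

lemma IsGoodChart.rdist_le {g : RMetric n M} {c : M} {R l : ℝ} (hc : IsGoodChart g c R l)
    {a b : EuclideanSpace ℝ (Fin n)} (ha : a ∈ closedBall (extChartAt (𝓡 n) c c) (2 * R))
    (hb : b ∈ closedBall (extChartAt (𝓡 n) c c) (2 * R)) :
    rdist g ((extChartAt (𝓡 n) c).symm a) ((extChartAt (𝓡 n) c).symm b) ≤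
      ENNReal.ofReal (l * dist a b) := by
  have h := hc.rdist_conformal_le (fun _ ↦ 0) ha hb
  rw [conformal_zero] at h
  refine h.trans (le_of_eq ?_)
  simp [dist_eq_norm, norm_sub_rev]

/-- The radial section for `f = 0`: the integral over radii is then `ρ` itself. -/
lemma IsGoodChart.le_rdist [T2Space M] {g : RMetric n M} {c : M} {R l : ℝ}
    (hc : IsGoodChart g c R l) {x y : M} (hx : x ∈ chartBall n c (R / 2)) {ρ : ℝ}
    (hρ : ρ ≤ R / 2) (hy : ¬ (y ∈ (extChartAt (𝓡 n) c).source ∧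
      extChartAt (𝓡 n) c y ∈ ball (extChartAt (𝓡 n) c x) ρ)) :
    ENNReal.ofReal (ρ / l) ≤ rdist g x y := by
  have hl : 0 < l := by linarith [hc.one_le]
  refine le_of_forall_gt fun r hr ↦ ?_
  obtain ⟨r', hr', hr'r⟩ := exists_between hr
  refine lt_of_le_of_lt ?_ hr'r
  rw [← conformal_zero g] at hr'
  obtain ⟨z, -, -, hz⟩ := hc.exists_radial_section hx.1
    ((closedBall_subset_of_mem_chartBall hx hρ).trans hc.ball_subset) hy hr'
  simp only [Real.exp_zero, ENNReal.ofReal_one, lintegral_const, Measure.restrict_apply_univ,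
    Real.volume_Ioo, sub_zero, one_mul] at hz
  calc _ = ENNReal.ofReal l⁻¹ * ENNReal.ofReal ρ := by
        rw [← ENNReal.ofReal_mul (by positivity), div_eq_inv_mul]
    _ ≤ ENNReal.ofReal l⁻¹ * (ENNReal.ofReal l * r') := by gcongr
    _ = r' := by
        rw [← mul_assoc, ← ENNReal.ofReal_mul (by positivity), inv_mul_cancel₀ hl.ne',
          ENNReal.ofReal_one, one_mul]

variable [MeasurableSpace M] [BorelSpace M]

/-- In the conformal metric, leaving a ball of radius `ρ` in the chart costs at least
`ρ ^ (1 + ε)` times the exponential of the mean of `f` in this chart. -/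
lemma IsGoodChart.exists_le_rdist_conformal [T2Space M] (hn : 1 ≤ n) {g : RMetric n M} {c : M}
    {R l : ℝ} (hc : IsGoodChart g c R l) (B : ℝ≥0) {ε : ℝ} (hε : 0 < ε) :
    ∃ k : ℝ, 0 < k ∧ ∀ f, HasEnergyLE g B f → ∀ x ∈ chartBall n c (R / 2), ∀ (y : M) (ρ : ℝ),
      0 < ρ → ρ ≤ R / 2 → ¬ (y ∈ (extChartAt (𝓡 n) c).source ∧
        extChartAt (𝓡 n) c y ∈ ball (extChartAt (𝓡 n) c x) ρ) →
      ENNReal.ofReal (k * ρ ^ (1 + ε) * Real.exp (chartMean n f c R)) ≤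
        rdist (conformal g f) x y := by
  have hl : 0 < l := by linarith [hc.one_le]
  have hR := hc.pos
  obtain ⟨A, hA0, hA⟩ := hc.exists_abs_integral_sub_chartMean_le hn B hε
  refine ⟨l⁻¹ * ((2 + R) ^ ε)⁻¹ * Real.exp (-A), by positivity, fun f hf x hx y ρ hρ0 hρ hy ↦ ?_⟩
  refine le_of_forall_gt fun r hr ↦ ?_
  obtain ⟨r', hr', hr'r⟩ := exists_between hr
  refine lt_of_le_of_lt ?_ hr'r
  have hsub := closedBall_subset_of_mem_chartBall hx hρ
  obtain ⟨z, hzm, hzd, hz⟩ := hc.exists_radial_section hx.1 (hsub.trans hc.ball_subset) hy hr'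
  set φ := extChartAt (𝓡 n) c with hφ
  -- The exit points distributed uniformly in the radius. As `z s` lies at distance `s` from the
  -- centre, a ball of radius `s` catches radii from an interval of length `2 s`, which gives linear
  -- growth with constant `2 / ρ`. The extra `R` in `(2 + R) / ρ` makes this constant at least `1`.
  set σ := (ENNReal.ofReal ρ)⁻¹ • (volume.restrict (Ioo 0 ρ)).map z with hσ
  have hρ0' : ENNReal.ofReal ρ ≠ 0 := by simpa using hρ0
  have hprob : IsProbabilityMeasure σ := ⟨by
    rw [hσ, Measure.smul_apply, Measure.map_apply_of_aemeasurable hzm MeasurableSet.univ,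
      preimage_univ, Measure.restrict_apply_univ, Real.volume_Ioo, sub_zero, smul_eq_mul,
      ENNReal.inv_mul_cancel hρ0' ENNReal.ofReal_ne_top]⟩
  have hσB : ∀ᵐ w ∂σ, w ∈ ball (φ c) R := by
    refine Measure.ae_smul_measure ?_ _
    refine (ae_map_iff (p := fun w ↦ w ∈ ball (φ c) R) hzm measurableSet_ball).2 ?_
    refine (ae_restrict_mem measurableSet_Ioo).mono fun s hs ↦ hsub ?_
    rw [mem_closedBall, hzd s hs]
    exact hs.2.le
  have hσF : ∀ w, ∀ s > 0, σ (closedBall w s) ≤ ENNReal.ofReal ((2 + R) / ρ * s) := by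
    intro w s hs
    rw [hσ, Measure.smul_apply, Measure.map_apply_of_aemeasurable hzm measurableSet_closedBall,
      Measure.restrict_apply' measurableSet_Ioo, smul_eq_mul]
    calc _ ≤ (ENNReal.ofReal ρ)⁻¹ *
          volume (Icc (dist w (φ x) - s) (dist w (φ x) + s)) := by
          gcongr
          rintro t ⟨ht, htI⟩
          have h1 := hzd t htI
          have h2 := mem_closedBall.1 (mem_preimage.1 ht)
          have h3 := dist_triangle (z t) w (φ x)
          have h4 := dist_triangle w (z t) (φ x)
          rw [dist_comm w (z t)] at h4
          exact ⟨by linarith, by linarith⟩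
      _ ≤ _ := by
          rw [Real.volume_Icc, ← ENNReal.ofReal_inv_of_pos hρ0,
            ← ENNReal.ofReal_mul (by positivity)]
          apply ENNReal.ofReal_le_ofReal
          rw [show dist w (φ x) + s - (dist w (φ x) - s) = 2 * s by ring, ← mul_assoc,
            div_eq_inv_mul]
          gcongr
          linarith
  have hK : 1 ≤ (2 + R) / ρ := by rw [le_div_iff₀ hρ0]; linarith
  have hmean := (abs_le.1 (hA f hf σ _ hK hσB hσF)).1
  -- By Jensen the mean of the conformal factor over the exit points, which the length controls, is
  -- at least the exponential of the mean of `f`.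
  have hj := ofReal_exp_integral_le (F := fun u ↦ f (φ.symm u)) (isCompact_closedBall _ _)
    (hc.continuousOn_comp_symm hf.1) (hσB.mono fun w hw ↦ hc.ball_subset hw)
  have hle : ∫⁻ w, ENNReal.ofReal (Real.exp (f (φ.symm w))) ∂σ ≤
      (ENNReal.ofReal ρ)⁻¹ * (ENNReal.ofReal l * r') := by
    rw [hσ, lintegral_smul_measure, smul_eq_mul]
    gcongr
    exact (lintegral_map_le _ _).trans hz
  have hE : l⁻¹ * ((2 + R) ^ ε)⁻¹ * Real.exp (-A) * ρ ^ (1 + ε) * Real.exp (chartMean n f c R) =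
      l⁻¹ * ρ * Real.exp (chartMean n f c R - (ε * Real.log ((2 + R) / ρ) + A)) := by
    have h1 : Real.exp (-(ε * Real.log ((2 + R) / ρ))) = ρ ^ ε * ((2 + R) ^ ε)⁻¹ := by
      rw [← mul_neg, ← Real.log_inv, inv_div, mul_comm ε, ← Real.rpow_def_of_pos (by positivity),
        Real.div_rpow hρ0.le (by positivity), div_eq_mul_inv]
    rw [show chartMean n f c R - (ε * Real.log ((2 + R) / ρ) + A) =
      chartMean n f c R + (-(ε * Real.log ((2 + R) / ρ)) + -A) by ring, Real.exp_add, Real.exp_add,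
      h1, Real.rpow_add hρ0, Real.rpow_one]
    ring
  rw [hE, ENNReal.ofReal_mul (by positivity)]
  calc _ ≤ ENNReal.ofReal (l⁻¹ * ρ) * ENNReal.ofReal (Real.exp (∫ w, f (φ.symm w) ∂σ)) := by
        gcongr
        linarith
    _ ≤ ENNReal.ofReal (l⁻¹ * ρ) * ((ENNReal.ofReal ρ)⁻¹ * (ENNReal.ofReal l * r')) := by
        gcongr
        exact hj.trans hle
    _ = r' := by
        rw [← ENNReal.ofReal_inv_of_pos hρ0, ← mul_assoc, ← mul_assoc,
          ← ENNReal.ofReal_mul (by positivity), ← ENNReal.ofReal_mul (by positivity),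
          show l⁻¹ * ρ * ρ⁻¹ * l = 1 by field_simp, ENNReal.ofReal_one, one_mul]

/-- In the conformal metric, the distance of two nearby points is at most a constant times the
power `α` of their distance in the chart and the exponential of the mean of `f`. -/
lemma IsGoodChart.exists_rdist_conformal_le (hn : 1 ≤ n) {g : RMetric n M} {c : M}
    {R l : ℝ} (hc : IsGoodChart g c R l) (B : ℝ≥0) {α : ℝ} (hα₀ : 0 < α) (hα₁ : α < 1) :
    ∃ k : ℝ, 0 < k ∧ ∀ f, HasEnergyLE g B f → ∀ x ∈ chartBall n c (R / 2),
      ∀ y ∈ (extChartAt (𝓡 n) c).source,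
      dist (extChartAt (𝓡 n) c x) (extChartAt (𝓡 n) c y) < R / 2 →
      rdist (conformal g f) x y ≤ ENNReal.ofReal (k * Real.exp (chartMean n f c R) *
        dist (extChartAt (𝓡 n) c x) (extChartAt (𝓡 n) c y) ^ α) := by
  have hl : 0 < l := by linarith [hc.one_le]
  have hn0 : (0 : ℝ) < n := by exact_mod_cast hn
  have h1α : 0 < 1 - α := by linarith
  set p := n / (1 - α) with hp
  have hp0 : 0 < p := by positivity
  set θ := (1 - α) / n with hθ
  have hpθ : p * θ = 1 := by rw [hp, hθ]; field_simp
  obtain ⟨A, hA⟩ := hc.exists_lintegral_exp_le hn B hp0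
  set v := (volume (ball (0 : EuclideanSpace ℝ (Fin n)) 1)).toReal with hv
  have hvt : volume (ball (0 : EuclideanSpace ℝ (Fin n)) 1) ≠ ⊤ := measure_ball_lt_top.ne
  have hv0 : 0 < v := ENNReal.toReal_pos (measure_ball_pos _ _ one_pos).ne' hvt
  refine ⟨2 * l * (2 * (v ^ θ)⁻¹ * (A + 1 : ℝ) ^ θ * α⁻¹), by positivity,
    fun f hf x hx y hy hxy ↦ ?_⟩
  set φ := extChartAt (𝓡 n) c with hφ
  set r := dist (φ x) (φ y) with hr
  rcases (dist_nonneg : 0 ≤ dist (φ x) (φ y)).eq_or_lt with hr0 | hr0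
  · have : x = y := φ.injOn hx.1 hy (dist_eq_zero.1 hr0.symm)
    rw [this, rdist_self]
    exact zero_le
  rw [← hr] at hr0
  set m := chartMean n f c R with hm
  set Q := ball (φ c) R with hQ
  have hxQ : closedBall (φ x) r ⊆ Q := closedBall_subset_of_mem_chartBall hx hxy.le
  set D := ball (φ x) r with hD
  have hDQ : D ⊆ Q := ball_subset_closedBall.trans hxQ
  have haQ : φ x ∈ Q := hxQ (mem_closedBall_self hr0.le)
  have hbQ : φ y ∈ Q := hxQ (by rw [mem_closedBall, dist_comm])
  set H : EuclideanSpace ℝ (Fin n) → ℝ≥0∞ :=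
    Q.indicator fun u ↦ ENNReal.ofReal (Real.exp (f (φ.symm u))) with hH
  have hHm : Measurable H := by
    classical
    rw [hH, ← piecewise_eq_indicator]
    refine ContinuousOn.measurable_piecewise ?_ continuousOn_const measurableSet_ball
    exact (ENNReal.continuous_ofReal.comp Real.continuous_exp).comp_continuousOn
      ((hc.continuousOn_comp_symm hf.1).mono hc.ball_subset)
  have hHint : (∫⁻ w in Q, H w ^ p) ^ θ ≤ ENNReal.ofReal ((A + 1 : ℝ) ^ θ * Real.exp m) := by
    have h1 : ∫⁻ w in Q, H w ^ p ≤ ENNReal.ofReal ((A + 1) * Real.exp (p * m)) := by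
      refine (le_of_eq ?_).trans ((hA f hf).trans ?_)
      · refine setLIntegral_congr_fun measurableSet_ball fun u hu ↦ ?_
        simp only [hH]
        rw [indicator_of_mem hu, ENNReal.ofReal_rpow_of_pos (Real.exp_pos _), ← Real.exp_mul,
          mul_comm p]
      · gcongr
        linarith
    refine (ENNReal.rpow_le_rpow h1 (by positivity)).trans (le_of_eq ?_)
    rw [ENNReal.ofReal_rpow_of_nonneg (by positivity) (by positivity),
      Real.mul_rpow (by positivity) (by positivity), ← Real.exp_mul, mul_right_comm, hpθ, one_mul]
  set I : EuclideanSpace ℝ (Fin n) → EuclideanSpace ℝ (Fin n) → ℝ≥0∞ := fun a w ↦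
    ∫⁻ t in Ioo (0 : ℝ) 1, H (a + t • (w - a)) with hI
  have hIm : ∀ a, Measurable (I a) := fun a ↦ by
    refine Measurable.lintegral_prod_right' (f := fun q : EuclideanSpace ℝ (Fin n) × ℝ ↦
      H (a + q.2 • (q.1 - a))) (hHm.comp ?_)
    fun_prop
  have hvol : volume D = ENNReal.ofReal (r ^ n * v) := by
    rw [hD, Measure.addHaar_ball_of_pos _ _ hr0, finrank_euclideanSpace_fin,
      ENNReal.ofReal_mul (by positivity), hv, ENNReal.ofReal_toReal hvt]
  have hV : 0 < r ^ n * v := by positivity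
  have hIle : ∀ a ∈ Q, ∫⁻ w in D, I a w ≤ ENNReal.ofReal
      ((r ^ n * v) ^ (1 - θ) * ((A + 1 : ℝ) ^ θ * Real.exp m) * α⁻¹) := by
    intro a ha
    refine (lintegral_segment_le hn hHm (convex_ball _ _) measurableSet_ball measurableSet_ball hDQ
      ha hα₀ hα₁).trans ?_
    rw [ENNReal.ofReal_mul (by positivity), ENNReal.ofReal_mul (by positivity),
      ← ENNReal.ofReal_rpow_of_pos hV, ← hvol]
    gcongr
  -- Averaging the sum of both segment integrals gives one intermediate point that is good for both
  -- endpoints.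
  obtain ⟨w, hwD, hw⟩ := exists_le_setLAverage (μ := volume) (s := D)
    (by rw [hvol]; simpa using hV) (by rw [hvol]; exact ENNReal.ofReal_ne_top)
    ((hIm (φ x)).add (hIm (φ y))).aemeasurable
  have hwQ := hDQ hwD
  have hsum : I (φ x) w + I (φ y) w ≤ ENNReal.ofReal
      (2 * (v ^ θ)⁻¹ * (A + 1 : ℝ) ^ θ * α⁻¹ * Real.exp m * r ^ (α - 1)) := by
    refine hw.trans ?_
    rw [setLAverage_eq, hvol]
    simp only [Pi.add_apply]
    rw [lintegral_add_left (hIm _)]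
    refine (ENNReal.div_le_div_right (add_le_add (hIle _ haQ) (hIle _ hbQ)) _).trans ?_
    rw [← ENNReal.ofReal_add (by positivity) (by positivity), ← ENNReal.ofReal_div_of_pos hV]
    apply ENNReal.ofReal_le_ofReal
    apply le_of_eq
    -- Dividing by the volume of `D` leaves `r^(-nθ) = r^(α-1)`; the segment lengths, at most `2 r`,
    -- then raise the power to `r^α`.
    have h1 : (r ^ n * v) ^ (1 - θ) = r ^ n * v * (r ^ (α - 1) * (v ^ θ)⁻¹) := by
      rw [Real.rpow_sub hV, Real.rpow_one, Real.mul_rpow (by positivity) hv0.le,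
        ← Real.rpow_natCast_mul hr0.le, show n * θ = -(α - 1) by rw [hθ]; field_simp; ring,
        Real.rpow_neg hr0.le]
      field_simp
    rw [h1]
    field_simp
    ring
  have hseg : ∀ a ∈ Q, rdist (conformal g f) (φ.symm a) (φ.symm w) ≤
      ENNReal.ofReal (l * ‖w - a‖) * I a w := by
    intro a ha
    refine (hc.rdist_conformal_le f (hc.ball_subset ha) (hc.ball_subset hwQ)).trans (le_of_eq ?_)
    congr 1
    refine setLIntegral_congr_fun measurableSet_Ioo fun t ht ↦ ?_
    simp only [hH]
    rw [indicator_of_mem ((convex_ball _ _).add_smul_sub_mem ha hwQ (Ioo_subset_Icc_self ht))]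
  have h1 := hseg _ haQ
  have h2 := hseg _ hbQ
  rw [φ.left_inv hx.1] at h1
  rw [φ.left_inv hy] at h2
  have hwa : ‖w - φ x‖ ≤ 2 * r := by
    rw [← dist_eq_norm]; linarith [mem_ball.1 hwD]
  have hwb : ‖w - φ y‖ ≤ 2 * r := by
    rw [← dist_eq_norm]; linarith [mem_ball.1 hwD, dist_triangle w (φ x) (φ y)]
  calc rdist (conformal g f) x y
      ≤ rdist (conformal g f) x (φ.symm w) + rdist (conformal g f) (φ.symm w) y :=
        rdist_triangle _ _ _ _
    _ ≤ ENNReal.ofReal (l * (2 * r)) * I (φ x) w + ENNReal.ofReal (l * (2 * r)) * I (φ y) w := by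
        rw [rdist_comm _ (φ.symm w)]
        refine add_le_add (h1.trans ?_) (h2.trans ?_) <;> gcongr
    _ ≤ ENNReal.ofReal (l * (2 * r)) * ENNReal.ofReal
        (2 * (v ^ θ)⁻¹ * (A + 1 : ℝ) ^ θ * α⁻¹ * Real.exp m * r ^ (α - 1)) := by
        rw [← mul_add]
        gcongr
    _ = _ := by
        rw [← ENNReal.ofReal_mul (by positivity), Real.rpow_sub_one hr0.ne']
        congr 1
        field_simp

end LocalDist

/-! ### Comparison of the means in different charts -/

section Overlap

lemma exists_uniform_measure_closedBall_le {n : ℕ} (hn : 1 ≤ n) (a : EuclideanSpace ℝ (Fin n))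
    {s : ℝ} (hs : 0 < s) :
    ∃ K : ℝ, 1 ≤ K ∧ ∀ w, ∀ r > 0, ((volume (ball a s))⁻¹ • volume.restrict (ball a s))
      (closedBall w r) ≤ ENNReal.ofReal (K * r) := by
  have : Nonempty (Fin n) := ⟨⟨0, hn⟩⟩
  set V := volume (ball a s) with hV
  have hV0 : V ≠ 0 := (measure_ball_pos _ _ hs).ne'
  have hVt : V ≠ ⊤ := measure_ball_lt_top.ne
  set v := (V⁻¹ * volume (ball (0 : EuclideanSpace ℝ (Fin n)) 1)).toReal with hv
  have hvt : V⁻¹ * volume (ball (0 : EuclideanSpace ℝ (Fin n)) 1) ≠ ⊤ :=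
    ENNReal.mul_ne_top (ENNReal.inv_ne_top.2 hV0) measure_ball_lt_top.ne
  have hv0 : 0 ≤ v := ENNReal.toReal_nonneg
  refine ⟨1 + v, by linarith, fun w r hr ↦ ?_⟩
  rw [Measure.smul_apply, smul_eq_mul]
  rcases le_total r 1 with h1 | h1
  · calc V⁻¹ * volume.restrict (ball a s) (closedBall w r) ≤ V⁻¹ * volume (closedBall w r) := by
          gcongr
          exact Measure.restrict_le_self
      _ = ENNReal.ofReal (r ^ n * v) := by
          rw [Measure.addHaar_closedBall _ _ hr.le, finrank_euclideanSpace_fin,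
            ENNReal.ofReal_mul (by positivity), hv, ENNReal.ofReal_toReal hvt]
          ring
      _ ≤ _ := by
          apply ENNReal.ofReal_le_ofReal
          have h2 : r ^ n ≤ r := pow_le_of_le_one hr.le h1 (by omega)
          nlinarith
  · calc V⁻¹ * volume.restrict (ball a s) (closedBall w r) ≤ V⁻¹ * V := by
          gcongr
          exact (measure_mono (subset_univ _)).trans_eq (Measure.restrict_apply_univ _)
      _ = ENNReal.ofReal 1 := by rw [ENNReal.inv_mul_cancel hV0 hVt, ENNReal.ofReal_one]
      _ ≤ _ := by
          apply ENNReal.ofReal_le_ofReal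
          nlinarith

variable {n : ℕ} {M : Type*} [TopologicalSpace M]
  [ChartedSpace (EuclideanSpace ℝ (Fin n)) M]

lemma mem_chartBall_self (c : M) {r : ℝ} (hr : 0 < r) : c ∈ chartBall n c r :=
  ⟨mem_extChartAt_source c, mem_ball_self hr⟩

variable [IsManifold (𝓡 n) ∞ M]

/-- Near a common point of two chart domains the inverse of the transition map is Lipschitz. -/
lemma exists_dist_le_dist_extChartAt {c c' x : M} (hx : x ∈ (extChartAt (𝓡 n) c).source)
    (hx' : x ∈ (extChartAt (𝓡 n) c').source) :
    ∃ K : ℝ, 0 ≤ K ∧ ∃ U ∈ 𝓝 x, ∀ p ∈ U, ∀ q ∈ U,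
      dist (extChartAt (𝓡 n) c p) (extChartAt (𝓡 n) c q) ≤
        K * dist (extChartAt (𝓡 n) c' p) (extChartAt (𝓡 n) c' q) := by
  have h1 : ContDiffAt ℝ ∞ (extChartAt (𝓡 n) c ∘ (extChartAt (𝓡 n) c').symm)
      (extChartAt (𝓡 n) c' x) := by
    have h := contDiffWithinAt_ext_coord_change (I := 𝓡 n) (n := ∞) c c'
      (y := extChartAt (𝓡 n) c' x) (by
        rw [PartialEquiv.trans_source, PartialEquiv.symm_source]
        refine ⟨(extChartAt (𝓡 n) c').map_source hx', ?_⟩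
        rwa [mem_preimage, (extChartAt (𝓡 n) c').left_inv hx'])
    rwa [ModelWithCorners.range_eq_univ, contDiffWithinAt_univ] at h
  obtain ⟨K, t, ht, hK⟩ := (h1.of_le (m := 1) (by simp)).exists_lipschitzOnWith
  refine ⟨K, K.2, (extChartAt (𝓡 n) c') ⁻¹' t ∩ (extChartAt (𝓡 n) c').source,
    Filter.inter_mem ((continuousAt_extChartAt' hx').preimage_mem_nhds ht)
      (extChartAt_source_mem_nhds' hx'), fun p hp q hq ↦ ?_⟩
  have h2 := hK.dist_le_mul _ hp.1 _ hq.1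
  simpa only [Function.comp_apply, (extChartAt (𝓡 n) c').left_inv hp.2,
    (extChartAt (𝓡 n) c').left_inv hq.2] using h2

variable [MeasurableSpace M] [BorelSpace M]

/-- The means of `f` in two overlapping charts are at bounded distance. -/
lemma IsGoodChart.exists_abs_chartMean_sub_le (hn : 1 ≤ n) {g : RMetric n M} {c c' : M}
    {R l R' l' : ℝ} (hc : IsGoodChart g c R l) (hc' : IsGoodChart g c' R' l') (B : ℝ≥0) {x : M}
    (hx : x ∈ chartBall n c R) (hx' : x ∈ chartBall n c' R') :
    ∃ A : ℝ, ∀ f, HasEnergyLE g B f → |chartMean n f c R - chartMean n f c' R'| ≤ A := by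
  obtain ⟨A₁, -, hA₁⟩ := hc.exists_abs_integral_sub_chartMean_le hn B one_pos
  obtain ⟨A₂, -, hA₂⟩ := hc'.exists_abs_integral_sub_chartMean_le hn B one_pos
  obtain ⟨K, hK0, U, hU, hK⟩ := exists_dist_le_dist_extChartAt hx.1 hx'.1
  set φ := extChartAt (𝓡 n) c with hφ
  set φ' := extChartAt (𝓡 n) c' with hφ'
  have hnhds : φ.target ∩ φ.symm ⁻¹' (U ∩ (chartBall n c R ∩ chartBall n c' R')) ∈ 𝓝 (φ x) := by
    refine Filter.inter_mem ((isOpen_extChartAt_target c).mem_nhds (φ.map_source hx.1))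
      ((continuousAt_extChartAt_symm' hx.1).preimage_mem_nhds ?_)
    rw [← hφ, φ.left_inv hx.1]
    exact Filter.inter_mem hU (((isOpen_chartBall c R).inter (isOpen_chartBall c' R')).mem_nhds
      ⟨hx, hx'⟩)
  obtain ⟨s, hs, hsub⟩ := Metric.mem_nhds_iff.1 hnhds
  set D := ball (φ x) s with hD
  obtain ⟨K₁, hK₁, hσ₁⟩ := exists_uniform_measure_closedBall_le hn (φ x) hs
  set σ := (volume D)⁻¹ • volume.restrict D with hσ
  have hprob : IsProbabilityMeasure σ := ⟨by
    rw [hσ, Measure.smul_apply, Measure.restrict_apply_univ, smul_eq_mul,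
      ENNReal.inv_mul_cancel (measure_ball_pos _ _ hs).ne' measure_ball_lt_top.ne]⟩
  have hσD : ∀ᵐ w ∂σ, w ∈ D := Measure.ae_smul_measure (ae_restrict_mem measurableSet_ball) _
  set T := fun u ↦ φ' (φ.symm u) with hT
  have hTc : ContinuousOn T D := by
    refine (continuousOn_extChartAt c').comp ((continuousOn_extChartAt_symm c).mono
      fun u hu ↦ (hsub hu).1) fun u hu ↦ (hsub hu).2.2.2.1
  have hTm : AEMeasurable T σ := (hTc.aemeasurable measurableSet_ball).smul_measure _
  have hprob' : IsProbabilityMeasure (σ.map T) := Measure.isProbabilityMeasure_map hTm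
  have hσB : ∀ᵐ w ∂σ, w ∈ ball (φ c) R := hσD.mono fun w hw ↦ by
    have := (hsub hw).2.2.1.2
    rwa [mem_preimage, ← hφ, φ.right_inv (hsub hw).1] at this
  have hσB' : ∀ᵐ w ∂(σ.map T), w ∈ ball (φ' c') R' :=
    (ae_map_iff (p := fun w ↦ w ∈ ball (φ' c') R') hTm measurableSet_ball).2
      (hσD.mono fun w hw ↦ (hsub hw).2.2.2.2)
  have hσ₂ : ∀ w, ∀ r > 0, σ.map T (closedBall w r) ≤
      ENNReal.ofReal (K₁ * (2 * (K + 1)) * r) := by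
    intro w r hr
    rw [Measure.map_apply_of_aemeasurable hTm measurableSet_closedBall]
    have h0 : σ (T ⁻¹' closedBall w r) = σ (T ⁻¹' closedBall w r ∩ D) :=
      (measure_inter_conull hσD).symm
    rw [h0]
    -- The centre `w` need not be in the image of `T`, so the preimage is recentred at one of its
    -- points `q` at the price of doubling the radius. Using `K + 1` in place of `K` keeps the
    -- growth constant at least `1`.
    rcases (T ⁻¹' closedBall w r ∩ D).eq_empty_or_nonempty with he | ⟨q, hq, hqD⟩
    · rw [he, measure_empty]
      exact zero_le
    refine (measure_mono fun p hp ↦ ?_).trans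
      ((hσ₁ q (2 * (K + 1) * r) (by positivity)).trans_eq (by rw [mul_assoc K₁]))
    obtain ⟨hp, hpD⟩ := hp
    have h1 := hK _ (hsub hpD).2.1 _ (hsub hqD).2.1
    rw [φ.right_inv (hsub hpD).1, φ.right_inv (hsub hqD).1] at h1
    have h2 : dist (T p) (T q) ≤ r + r :=
      (dist_triangle_right _ _ w).trans (add_le_add hp hq)
    rw [mem_closedBall]
    calc dist p q ≤ K * dist (T p) (T q) := h1
      _ ≤ K * (r + r) := by gcongr
      _ ≤ _ := by nlinarith
  refine ⟨(1 * Real.log K₁ + A₁) + (1 * Real.log (K₁ * (2 * (K + 1))) + A₂), fun f hf ↦ ?_⟩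
  have hint : ∫ w, f (φ'.symm w) ∂(σ.map T) = ∫ w, f (φ.symm w) ∂σ := by
    rw [integral_map hTm]
    · refine integral_congr_ae (hσD.mono fun w hw ↦ ?_)
      simp only [hT]
      rw [φ'.left_inv (hsub hw).2.2.2.1]
    · have h1 := ((hc'.continuousOn_comp_symm hf.1).mono hc'.ball_subset).aestronglyMeasurable
        (μ := σ.map T) measurableSet_ball
      rwa [Measure.restrict_eq_self_of_ae_mem hσB'] at h1
  have h1 := hA₁ f hf σ K₁ hK₁ hσB hσ₁
  have h2 := hA₂ f hf (σ.map T) _ (by nlinarith) hσB' hσ₂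
  rw [hint] at h2
  rw [abs_sub_comm] at h1
  exact (abs_sub_le _ _ _).trans (add_le_add h1 h2)

/-- Having means at uniformly bounded distance is a symmetric and transitive relation between
centres. It holds between a centre and all nearby ones, whose charts overlap, hence everywhere by
connectedness. -/
lemma exists_abs_chartMean_sub_le [PreconnectedSpace M] (hn : 1 ≤ n) {g : RMetric n M}
    {R l : M → ℝ} (hR : ∀ c, IsGoodChart g c (R c) (l c)) (B : ℝ≥0) (c c' : M) :
    ∃ A : ℝ, ∀ f, HasEnergyLE g B f →
      |chartMean n f c (R c) - chartMean n f c' (R c')| ≤ A := by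
  have key : ∀ {x y : M}, y ∈ chartBall n x (R x) → ∃ A : ℝ, ∀ f, HasEnergyLE g B f →
      |chartMean n f x (R x) - chartMean n f y (R y)| ≤ A := fun hy ↦
    (hR _).exists_abs_chartMean_sub_le hn (hR _) B hy (mem_chartBall_self _ (hR _).pos)
  refine PreconnectedSpace.induction₂' (fun c c' ↦ ∃ A : ℝ, ∀ f, HasEnergyLE g B f →
      |chartMean n f c (R c) - chartMean n f c' (R c')| ≤ A) (fun x ↦ ?_) ⟨?_⟩ c c'
  · have hx := (isOpen_chartBall (n := n) x (R x)).mem_nhds (mem_chartBall_self x (hR x).pos)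
    filter_upwards [hx] with y hy
    refine ⟨key hy, ?_⟩
    simp_rw [abs_sub_comm (chartMean n _ y (R y))]
    exact key hy
  · rintro x y z ⟨A, hA⟩ ⟨A', hA'⟩
    exact ⟨A + A', fun f hf ↦ (abs_sub_le _ _ _).trans (add_le_add (hA f hf) (hA' f hf))⟩

lemma exists_exp_chartMean_le [PreconnectedSpace M] (hn : 1 ≤ n) {g : RMetric n M}
    {R l : M → ℝ} (hR : ∀ c, IsGoodChart g c (R c) (l c)) (B : ℝ≥0) (c₀ c : M) :
    ∃ k : ℝ, 0 < k ∧ ∀ f, HasEnergyLE g B f →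
      Real.exp (chartMean n f c (R c)) ≤ k * Real.exp (chartMean n f c₀ (R c₀)) ∧
      Real.exp (chartMean n f c₀ (R c₀)) ≤ k * Real.exp (chartMean n f c (R c)) := by
  obtain ⟨A, hA⟩ := exists_abs_chartMean_sub_le hn hR B c₀ c
  refine ⟨Real.exp A, Real.exp_pos _, fun f hf ↦ ?_⟩
  have h := abs_le.1 (hA f hf)
  constructor <;> rw [← Real.exp_add] <;> gcongr <;> linarith

end Overlap

/-! ### Globalisation by compactness and connectedness -/

section Global

variable {n : ℕ} {M : Type*} [TopologicalSpace M]
  [ChartedSpace (EuclideanSpace ℝ (Fin n)) M]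

lemma exists_finset_chartBall_cover [CompactSpace M] {r : M → ℝ} (hr : ∀ c, 0 < r c) :
    ∃ S : Finset M, ∀ x, ∃ c ∈ S, x ∈ chartBall n c (r c) := by
  obtain ⟨S, hS⟩ := isCompact_univ.elim_nhds_subcover (fun c ↦ chartBall n c (r c))
    fun c _ ↦ (isOpen_chartBall c _).mem_nhds (mem_chartBall_self c (hr c))
  refine ⟨S, fun x ↦ ?_⟩
  simpa using hS.2 (mem_univ x)

lemma exists_forall_mem_finset_le {ι : Type*} (S : Finset ι) (k : ι → ℝ) :
    ∃ K : ℝ, 0 < K ∧ ∀ c ∈ S, k c ≤ K := by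
  refine ⟨∑ c ∈ S, |k c| + 1, by positivity, fun c hc ↦ ?_⟩
  have h := Finset.single_le_sum (f := fun c ↦ |k c|) (fun _ _ ↦ abs_nonneg _) hc
  have h2 := le_abs_self (k c)
  linarith

variable [MeasurableSpace M]

lemma hasEnergyLE_zero (g : RMetric n M) (B : ℝ≥0) : HasEnergyLE g B (fun _ ↦ 0) := by
  refine ⟨continuous_const, fun _ ↦ 0, ⟨fun c ↦ ?_, fun c v ↦ ?_, fun c v ψ _ _ _ ↦ ?_⟩, ?_⟩
  · exact locallyIntegrableOn_zero
  · exact locallyIntegrableOn_zero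
  · change ∫ u, (0 : ℝ) * fderiv ℝ ψ u v = -∫ u, (0 : ℝ) * ψ u
    simp
  · have h : (fun x ↦ covectorNorm g x 0) = fun _ ↦ 0 := funext fun x ↦ by
      let : RiemannianBundle (fun x : M ↦ TangentSpace (𝓡 n) x) := ⟨g⟩
      refine le_antisymm (ContinuousLinearMap.opNorm_le_bound _ le_rfl fun v ↦ ?_)
        (covectorNorm_nonneg g x 0)
      rw [zero_mul]
      exact norm_zero.le
    rw [covectorLpNorm, h, eLpNorm_zero']
    exact zero_le

variable [IsManifold (𝓡 n) ∞ M] [BorelSpace M] [CompactSpace M] [PreconnectedSpace M]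
  {g : RMetric n M} {R l : M → ℝ}

/-- One chart suffices for the lower bound. For the upper bound the chart estimates are summed over
a finite cover and all means are compared with that at `c₀`. -/
lemma exists_rvolume_conformal_bounds (hn : 1 ≤ n)
    (hR : ∀ c, IsGoodChart g c (R c) (l c)) (B : ℝ≥0) (c₀ : M) :
    ∃ k : ℝ, 0 < k ∧ ∀ f, HasEnergyLE g B f →
      ENNReal.ofReal (k⁻¹ * Real.exp (chartMean n f c₀ (R c₀))) ≤
        rvolume (conformal g f) univ ^ (1 / (n : ℝ)) ∧
      rvolume (conformal g f) univ ^ (1 / (n : ℝ)) ≤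
        ENNReal.ofReal (k * Real.exp (chartMean n f c₀ (R c₀))) := by
  have hn0 : (0 : ℝ) < n := by exact_mod_cast hn
  obtain ⟨S, hS⟩ := exists_finset_chartBall_cover (n := n) fun c ↦ (hR c).pos
  obtain ⟨k₀, hk₀, h₀⟩ := (hR c₀).exists_le_rvolume_conformal
  choose k₁ hk₁ h₁ using fun c ↦ (hR c).exists_lintegral_sqrt_det_conformal_le hn B
  choose k₂ hk₂ h₂ using exists_exp_chartMean_le hn hR B c₀
  set K := ∑ c ∈ S, k₁ c * k₂ c ^ n with hK
  have hK0 : 0 ≤ K := Finset.sum_nonneg fun c _ ↦ by have := hk₁ c; have := hk₂ c; positivity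
  have hroot : ∀ {a m : ℝ}, 0 ≤ a → ENNReal.ofReal (a * Real.exp (n * m)) ^ (1 / (n : ℝ)) =
      ENNReal.ofReal (a ^ (1 / (n : ℝ)) * Real.exp m) := fun {a m} ha ↦ by
    rw [ENNReal.ofReal_rpow_of_nonneg (by positivity) (by positivity),
      Real.mul_rpow ha (Real.exp_pos _).le, ← Real.exp_mul]
    congr 3
    field_simp
  refine ⟨(k₀ ^ (1 / (n : ℝ)))⁻¹ + K ^ (1 / (n : ℝ)), by positivity, fun f hf ↦ ⟨?_, ?_⟩⟩
  · refine le_trans ?_ (ENNReal.rpow_le_rpow (h₀ f hf.1) (by positivity))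
    rw [hroot hk₀.le]
    gcongr
    refine inv_le_of_inv_le₀ (by positivity) ?_
    linarith [Real.rpow_nonneg hK0 (1 / (n : ℝ))]
  · have hV : rvolume (conformal g f) univ ≤
        ENNReal.ofReal (K * Real.exp (n * chartMean n f c₀ (R c₀))) := by
      refine (rvolume_univ_le (S := S) (r := R) _ (eq_univ_of_forall fun x ↦ ?_)).trans ?_
      · simpa using hS x
      · rw [hK, Finset.sum_mul, ENNReal.ofReal_sum_of_nonneg fun c _ ↦ by
          have := hk₁ c; have := hk₂ c; positivity]
        refine Finset.sum_le_sum fun c _ ↦ (h₁ c f hf).trans ?_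
        apply ENNReal.ofReal_le_ofReal
        rw [mul_assoc, Real.exp_nat_mul, Real.exp_nat_mul, ← mul_pow]
        have := hk₁ c
        gcongr
        exact (h₂ c f hf).1
    refine (ENNReal.rpow_le_rpow hV (by positivity)).trans ?_
    rw [hroot hK0]
    gcongr
    have : 0 < k₀ ^ (1 / (n : ℝ)) := by positivity
    linarith [inv_pos.2 this]

/-- A diameter bound for the conformal metric: any point is close to one of finitely many chart
centres, and each centre is joined to `c₀` by chaining charts. -/
lemma exists_rdist_conformal_le_exp (hn : 1 ≤ n)
    (hR : ∀ c, IsGoodChart g c (R c) (l c)) (B : ℝ≥0) (c₀ : M) :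
    ∃ k : ℝ, 0 < k ∧ ∀ f, HasEnergyLE g B f → ∀ x y,
      rdist (conformal g f) x y ≤ ENNReal.ofReal (k * Real.exp (chartMean n f c₀ (R c₀))) := by
  have hlocal : ∀ c, ∃ k : ℝ, 0 < k ∧ ∀ f, HasEnergyLE g B f → ∀ x ∈ chartBall n c (R c / 2),
      rdist (conformal g f) x c ≤
        ENNReal.ofReal (k * Real.exp (chartMean n f c₀ (R c₀))) := by
    intro c
    have hc := (hR c).pos
    -- Any exponent in `(0, 1)` would do, as only boundedness is wanted.
    obtain ⟨k, hk, h⟩ := (hR c).exists_rdist_conformal_le hn B (α := 1 / 2) (by norm_num)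
      (by norm_num)
    obtain ⟨k', hk', h'⟩ := exists_exp_chartMean_le hn hR B c₀ c
    refine ⟨k * k' * (R c / 2) ^ (1 / 2 : ℝ), by positivity, fun f hf x hx ↦
      (h f hf x hx c (mem_extChartAt_source c) hx.2).trans ?_⟩
    apply ENNReal.ofReal_le_ofReal
    calc _ ≤ k * (k' * Real.exp (chartMean n f c₀ (R c₀))) * (R c / 2) ^ (1 / 2 : ℝ) := by
          gcongr
          · exact (h' f hf).1
          · exact (mem_ball.1 hx.2).le
      _ = _ := by ring
  -- The constant here depends on the pair of points; it will be used only for the finitely many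
  -- centres of a cover.
  have hpair : ∀ x y, ∃ k : ℝ, ∀ f, HasEnergyLE g B f →
      rdist (conformal g f) x y ≤
        ENNReal.ofReal (k * Real.exp (chartMean n f c₀ (R c₀))) := by
    refine PreconnectedSpace.induction₂' _ (fun x ↦ ?_) ⟨?_⟩
    · have hx := (isOpen_chartBall (n := n) x (R x / 2)).mem_nhds
        (mem_chartBall_self x (half_pos (hR x).pos))
      obtain ⟨k, -, hk⟩ := hlocal x
      filter_upwards [hx] with y hy
      refine ⟨⟨k, fun f hf ↦ ?_⟩, k, fun f hf ↦ hk f hf y hy⟩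
      rw [rdist_comm]
      exact hk f hf y hy
    · rintro x y z ⟨k, hk⟩ ⟨k', hk'⟩
      refine ⟨|k| + |k'|, fun f hf ↦ ?_⟩
      rw [add_mul, ENNReal.ofReal_add (by positivity) (by positivity)]
      refine (rdist_triangle _ x y z).trans (add_le_add ((hk f hf).trans ?_) ((hk' f hf).trans ?_))
      all_goals gcongr; exact le_abs_self _
  choose k₁ hk₁ h₁ using hlocal
  choose k₂ h₂ using fun c ↦ hpair c c₀
  obtain ⟨S, hS⟩ := exists_finset_chartBall_cover (n := n) fun c ↦ half_pos (hR c).pos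
  obtain ⟨K, hK, hKS⟩ := exists_forall_mem_finset_le S fun c ↦ k₁ c + |k₂ c|
  have hcent : ∀ f, HasEnergyLE g B f → ∀ x, rdist (conformal g f) x c₀ ≤
      ENNReal.ofReal (K * Real.exp (chartMean n f c₀ (R c₀))) := by
    intro f hf x
    obtain ⟨c, hcS, hxc⟩ := hS x
    have := hk₁ c
    calc _ ≤ rdist (conformal g f) x c + rdist (conformal g f) c c₀ := rdist_triangle _ _ _ _
      _ ≤ ENNReal.ofReal (k₁ c * Real.exp (chartMean n f c₀ (R c₀))) +
          ENNReal.ofReal (|k₂ c| * Real.exp (chartMean n f c₀ (R c₀))) := by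
          refine add_le_add (h₁ c f hf x hxc) ((h₂ c f hf).trans ?_)
          gcongr
          exact le_abs_self _
      _ ≤ _ := by
          rw [← ENNReal.ofReal_add (by positivity) (by positivity), ← add_mul]
          gcongr
          exact hKS c hcS
  refine ⟨2 * K, by positivity, fun f hf x y ↦ ?_⟩
  refine (rdist_triangle _ x c₀ y).trans ?_
  rw [rdist_comm _ c₀ y, two_mul, add_mul, ENNReal.ofReal_add (by positivity) (by positivity)]
  exact add_le_add (hcent f hf x) (hcent f hf y)

/-- The preceding bound for `f = 0`, which has zero energy. -/
lemma exists_rdist_le [Nonempty M] (hn : 1 ≤ n) (hR : ∀ c, IsGoodChart g c (R c) (l c)) :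
    ∃ D : ℝ, 0 < D ∧ ∀ x y, rdist g x y ≤ ENNReal.ofReal D := by
  obtain ⟨c₀⟩ := ‹Nonempty M›
  obtain ⟨k, hk, h⟩ := exists_rdist_conformal_le_exp hn hR 0 c₀
  refine ⟨k * Real.exp (chartMean n (fun _ : M ↦ 0) c₀ (R c₀)), by positivity, fun x y ↦ ?_⟩
  have h1 := h _ (hasEnergyLE_zero g 0) x y
  rw [conformal_zero] at h1
  exact h1

variable [T2Space M]

lemma exists_le_rdist_conformal [Nonempty M] (hn : 1 ≤ n)
    (hR : ∀ c, IsGoodChart g c (R c) (l c)) (B : ℝ≥0) (c₀ : M) {β : ℝ} (hβ : 1 < β) :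
    ∃ k : ℝ, 0 < k ∧ ∀ f, HasEnergyLE g B f → ∀ x y,
      ENNReal.ofReal (k⁻¹ * Real.exp (chartMean n f c₀ (R c₀))) * rdist g x y ^ β ≤
        rdist (conformal g f) x y := by
  obtain ⟨D, hD, hDle⟩ := exists_rdist_le hn hR
  choose k₁ hk₁ h₁ using fun c ↦ (hR c).exists_le_rdist_conformal hn B (sub_pos.2 hβ)
  choose k₂ hk₂ h₂ using exists_exp_chartMean_le hn hR B c₀
  obtain ⟨S, hS⟩ := exists_finset_chartBall_cover (n := n) fun c ↦ half_pos (hR c).pos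
  -- The first entry keeps `ρ = q c * d` at most `R c / 2` for every distance `d ≤ D`. The second
  -- puts `y` outside the coordinate ball of radius `ρ`, since otherwise the segment would show
  -- `rdist g x y < d`.
  set q : M → ℝ := fun c ↦ min (R c / (2 * D)) (l c)⁻¹ with hq
  obtain ⟨K, hK, hKS⟩ := exists_forall_mem_finset_le S fun c ↦ (k₁ c)⁻¹ * (q c ^ β)⁻¹ * k₂ c
  refine ⟨K, hK, fun f hf x y ↦ ?_⟩
  obtain ⟨c, hcS, hxc⟩ := hS x
  have hRc := (hR c).pos
  have hl : 0 < l c := by linarith [(hR c).one_le]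
  have hq0 : 0 < q c := by simp only [hq]; positivity
  have := hk₁ c
  have := hk₂ c
  have hdt : rdist g x y ≠ ⊤ := ((hDle x y).trans_lt ENNReal.ofReal_lt_top).ne
  set d := (rdist g x y).toReal with hd
  have hd' : rdist g x y = ENNReal.ofReal d := (ENNReal.ofReal_toReal hdt).symm
  have hdD : d ≤ D := ENNReal.toReal_le_of_le_ofReal hD.le (hDle x y)
  rcases (ENNReal.toReal_nonneg : 0 ≤ (rdist g x y).toReal).eq_or_lt with hd0 | hd0
  · rw [hd', hd, ← hd0, ENNReal.ofReal_zero, ENNReal.zero_rpow_of_pos (by linarith), mul_zero]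
    exact zero_le
  rw [← hd] at hd0
  have hρ : q c * d ≤ R c / 2 := by
    calc _ ≤ R c / (2 * D) * D := by
          gcongr
          exact min_le_left _ _
      _ = _ := by field_simp
  have hlq : l c * (q c * d) ≤ d := by
    calc _ ≤ l c * ((l c)⁻¹ * d) := by
          gcongr
          exact min_le_right _ _
      _ = _ := by field_simp
  have hy : ¬ (y ∈ (extChartAt (𝓡 n) c).source ∧
      extChartAt (𝓡 n) c y ∈ ball (extChartAt (𝓡 n) c x) (q c * d)) := by
    rintro ⟨hys, hyb⟩
    have hsub := (closedBall_subset_of_mem_chartBall hxc hρ).trans (hR c).ball_subset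
    have h := (hR c).rdist_le (hsub (mem_closedBall_self (by positivity)))
      (hsub (ball_subset_closedBall hyb))
    rw [(extChartAt (𝓡 n) c).left_inv hxc.1, (extChartAt (𝓡 n) c).left_inv hys, hd',
      ENNReal.ofReal_le_ofReal_iff (by positivity), dist_comm] at h
    have := mul_lt_mul_of_pos_left (mem_ball.1 hyb) hl
    linarith
  refine le_trans ?_ (h₁ c f hf x hxc y (q c * d) (by positivity) hρ hy)
  rw [hd', ENNReal.ofReal_rpow_of_pos hd0, ← ENNReal.ofReal_mul (by positivity),
    add_sub_cancel, Real.mul_rpow hq0.le hd0.le]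
  apply ENNReal.ofReal_le_ofReal
  have h3 : K⁻¹ ≤ k₁ c * q c ^ β * (k₂ c)⁻¹ := by
    refine inv_le_of_inv_le₀ (by positivity) (le_trans (le_of_eq ?_) (hKS c hcS))
    rw [mul_inv, mul_inv, inv_inv]
  calc _ ≤ k₁ c * q c ^ β * (k₂ c)⁻¹ * (k₂ c * Real.exp (chartMean n f c (R c))) * d ^ β := by
        gcongr
        exact (h₂ c f hf).2
    _ = _ := by field_simp

lemma exists_rdist_conformal_le [Nonempty M] (hn : 1 ≤ n)
    (hR : ∀ c, IsGoodChart g c (R c) (l c)) (B : ℝ≥0) (c₀ : M) {α : ℝ} (hα₀ : 0 < α)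
    (hα₁ : α < 1) :
    ∃ k : ℝ, 0 < k ∧ ∀ f, HasEnergyLE g B f → ∀ x y,
      rdist (conformal g f) x y ≤
        ENNReal.ofReal (k * Real.exp (chartMean n f c₀ (R c₀))) * rdist g x y ^ α := by
  obtain ⟨D, hD, hDle⟩ := exists_rdist_conformal_le_exp hn hR B c₀
  obtain ⟨D', hD', hDle'⟩ := exists_rdist_le hn hR
  choose k₁ hk₁ h₁ using fun c ↦ (hR c).exists_rdist_conformal_le hn B hα₀ hα₁
  choose k₂ hk₂ h₂ using exists_exp_chartMean_le hn hR B c₀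
  obtain ⟨S, hS⟩ := exists_finset_chartBall_cover (n := n) fun c ↦ half_pos (hR c).pos
  obtain ⟨K, hK, hKS⟩ := exists_forall_mem_finset_le S
    -- The first summand serves pairs of points that are close in the chart; the second serves
    -- distant pairs, where `d` is at least `R c / (2 l c)` and the diameter bound suffices.
    fun c ↦ k₁ c * k₂ c * l c ^ α + D * (2 * l c / R c) ^ α
  refine ⟨K, hK, fun f hf x y ↦ ?_⟩
  obtain ⟨c, hcS, hxc⟩ := hS x
  have hRc := (hR c).pos
  have hl : 0 < l c := by linarith [(hR c).one_le]
  have := hk₁ c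
  have := hk₂ c
  have hKc := hKS c hcS
  have h3 : 0 ≤ k₁ c * k₂ c * l c ^ α := by positivity
  have h4 : 0 ≤ D * (2 * l c / R c) ^ α := by positivity
  have hdt : rdist g x y ≠ ⊤ := ((hDle' x y).trans_lt ENNReal.ofReal_lt_top).ne
  set d := (rdist g x y).toReal with hd
  have hd' : rdist g x y = ENNReal.ofReal d := (ENNReal.ofReal_toReal hdt).symm
  have hd0 : 0 ≤ d := ENNReal.toReal_nonneg
  rw [hd', ENNReal.ofReal_rpow_of_nonneg hd0 hα₀.le, ← ENNReal.ofReal_mul (by positivity)]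
  by_cases hy : y ∈ (extChartAt (𝓡 n) c).source ∧
      extChartAt (𝓡 n) c y ∈ ball (extChartAt (𝓡 n) c x) (R c / 2)
  · have hyd := mem_ball'.1 hy.2
    refine (h₁ c f hf x hxc y hy.1 hyd).trans ?_
    -- Taken with `ρ` equal to the coordinate distance of the two points, since `y` is outside the
    -- open ball of that radius; this bounds the coordinate distance by `l c * d`.
    have hle := (hR c).le_rdist hxc hyd.le
      (fun h : y ∈ (extChartAt (𝓡 n) c).source ∧ _ ↦ (mem_ball'.1 h.2).false)
    rw [hd', ENNReal.ofReal_le_ofReal_iff hd0, div_le_iff₀' hl] at hle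
    apply ENNReal.ofReal_le_ofReal
    calc _ ≤ k₁ c * (k₂ c * Real.exp (chartMean n f c₀ (R c₀))) * (l c * d) ^ α := by
          gcongr
          exact (h₂ c f hf).1
      _ = k₁ c * k₂ c * l c ^ α * Real.exp (chartMean n f c₀ (R c₀)) * d ^ α := by
          rw [Real.mul_rpow hl.le hd0]
          ring
      _ ≤ _ := by
          gcongr
          linarith
  · have hle := (hR c).le_rdist hxc le_rfl hy
    rw [hd', ENNReal.ofReal_le_ofReal_iff hd0] at hle
    refine (hDle f hf x y).trans ?_
    apply ENNReal.ofReal_le_ofReal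
    have h5 : 1 ≤ (2 * l c / R c) ^ α * d ^ α := by
      rw [← Real.mul_rpow (by positivity) hd0]
      refine Real.one_le_rpow ?_ hα₀.le
      calc (1 : ℝ) = 2 * l c / R c * (R c / 2 / l c) := by field_simp
        _ ≤ _ := by gcongr
    calc _ ≤ D * Real.exp (chartMean n f c₀ (R c₀)) * ((2 * l c / R c) ^ α * d ^ α) :=
          le_mul_of_one_le_right (by positivity) h5
      _ = D * (2 * l c / R c) ^ α * Real.exp (chartMean n f c₀ (R c₀)) * d ^ α := by ring
      _ ≤ _ := by
          gcongr
          linarith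

end Global

end ConformalDeformation

end

open ConformalDeformation

theorem mainTheorem9 {n : ℕ} (hn : 1 ≤ n)
    {M : Type*} [TopologicalSpace M] [ChartedSpace (EuclideanSpace ℝ (Fin n)) M]
    [IsManifold (𝓡 n) ∞ M] [T2Space M] [CompactSpace M] [ConnectedSpace M]
    [MeasurableSpace M] [BorelSpace M]
    (g₀ : ContMDiffRiemannianMetric (𝓡 n) ∞ (EuclideanSpace ℝ (Fin n))
      (fun x : M ↦ TangentSpace (𝓡 n) x))
    (B : ℝ≥0) (α : ℝ) (hα₀ : 0 < α) (hα₁ : α < 1) :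
    ∃ C : ℝ≥0, 0 < C ∧
      ∀ (f : M → ℝ) (df : ∀ x : M, TangentSpace (𝓡 n) x →L[ℝ] ℝ),
        Continuous f → IsWeakDifferential f df →
        covectorLpNorm g₀.toRiemannianMetric n df ≤ B →
        ∀ x y : M,
          rvolume (conformal g₀.toRiemannianMetric f) univ ^ (1 / (n : ℝ)) / C
              * rdist g₀.toRiemannianMetric x y ^ (1 / α)
            ≤ rdist (conformal g₀.toRiemannianMetric f) x y ∧
          rdist (conformal g₀.toRiemannianMetric f) x y
            ≤ C * rvolume (conformal g₀.toRiemannianMetric f) univ ^ (1 / (n : ℝ))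
              * rdist g₀.toRiemannianMetric x y ^ α := by
  choose R l hR using exists_isGoodChart g₀
  obtain ⟨c₀⟩ : Nonempty M := inferInstance
  obtain ⟨k₁, hk₁, h₁⟩ := exists_rvolume_conformal_bounds hn hR B c₀
  obtain ⟨k₂, hk₂, h₂⟩ := exists_le_rdist_conformal hn hR B c₀ (β := 1 / α)
    (one_lt_one_div hα₀ hα₁)
  obtain ⟨k₃, hk₃, h₃⟩ := exists_rdist_conformal_le hn hR B c₀ hα₀ hα₁
  -- The factor `k₁` trades `exp m` for the root of the volume in either direction, and `k₂ + k₃`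
  -- dominates both distance constants.
  have hC : 0 < k₁ * (k₂ + k₃) := by positivity
  refine ⟨Real.toNNReal (k₁ * (k₂ + k₃)), Real.toNNReal_pos.2 hC,
    fun f df hf hw hB x y ↦ ?_⟩
  have hE : HasEnergyLE g₀.toRiemannianMetric B f := ⟨hf, df, hw, hB⟩
  obtain ⟨h₁l, h₁u⟩ := h₁ f hE
  set m := chartMean n f c₀ (R c₀)
  change _ / ENNReal.ofReal _ * _ ≤ _ ∧ _ ≤ ENNReal.ofReal _ * _ * _
  constructor
  · refine le_trans ?_ (h₂ f hE x y)
    gcongr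
    refine (ENNReal.div_le_div_right h₁u _).trans ?_
    rw [← ENNReal.ofReal_div_of_pos hC]
    apply ENNReal.ofReal_le_ofReal
    rw [mul_div_mul_left _ _ hk₁.ne', div_eq_inv_mul]
    gcongr
    linarith
  · refine (h₃ f hE x y).trans ?_
    gcongr
    calc _ ≤ ENNReal.ofReal (k₁ * (k₂ + k₃)) * ENNReal.ofReal (k₁⁻¹ * Real.exp m) := by
          rw [← ENNReal.ofReal_mul hC.le]
          apply ENNReal.ofReal_le_ofReal
          rw [show k₁ * (k₂ + k₃) * (k₁⁻¹ * Real.exp m) = (k₂ + k₃) * Real.exp m by field_simp]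
          gcongr
          linarith
      _ ≤ _ := by gcongr
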